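/- **Setting.** Let $I$ be a set, $Q$ an acyclic quiver with vertex set $I$ such that only finitely many arrows start or end at each vertex, and $\mathbf d=(d_i)_{i\in I}$ a family of positive integers. Let $n_{ij}=n_{ji}$ be the number of arrows joining $i$ and $j$ (by acyclicity they all have the same direction), and put $b_{ij}=n_{ij}d_j/\gcd(d_i,d_j)$ if these arrows go from $i$ to $j$, $b_{ij}=-n_{ij}d_j/\gcd(d_i,d_j)$ if they go from $j$ to $i$, and $b_{ij}=0$ if there are none. On $\mathcal Q=\bigoplus_{i\in I}\mathbb Z\alpha_i$ consider the bilinear forms given by $\langle\alpha_i,\alpha_i\rangle=d_i$, $\langle\alpha_i,\alpha_j\rangle=-\max(d_ib_{ij},0)$ for $i\neq j$, and $(\alpha_i,\alpha_i)=2d_i$, $(\alpha_i,\alpha_j)=-d_i|b_{ij}|$ for $i\ne j$. Let $\mathbb F$ be a finite field, $v=\sqrt{|\mathbb F|}$ and $v^{1/2}=|\mathbb F|^{1/4}>0$; let $\mathbb F_d$ be the extension of $\mathbb F$ of degree $d$ in a fixed algebraic closure. A representation $V$ of $(Q,\mathbf d)$ consists of an $\mathbb F_{d_i}$-vector space $V_i$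 for each $i\in I$, with $\bigoplus_i V_i$ finite-dimensional, and an $\mathbb F_{\gcd(d_i,d_j)}$-linear map $V_i\to V_j$ for each arrow $i\to j$. Write $[V]$ for its isomorphism class, $|V|=\sum_i(\dim_{\mathbb F_{d_i}}V_i)\,\alpha_i$, and $S_i$ for the representation with $\mathbb F_{d_i}$ at $i$ and $0$ at the other vertices. Put $\mathcal F^V_{UW}=\{R\subset V: R\cong W,\ V/R\cong U\}$. A *twisted bialgebra* is a $\mathcal Q$-graded complex vector space $A$ with a graded associative unital algebra structure and a graded coassociative counital coalgebra structure such that the counit $A\to\mathbb C$ and the comultiplication $\Delta:A\to A\otimes A$ are unital algebra homomorphisms, where $A\otimes A$ has the multiplication $(x\otimes y)(x'\otimes y')=v^{(|y|,|x'|)}\,xx'\otimes yy'$ for homogeneous elements. A *homomorphism of twisted bialgebras* is a degree-preserving linear map between twisted bialgebras that respects multiplication, unit, comultiplication and counit. The *dual Hall–Ringel bialgebra* $\mathcal H^*(Q,\mathbf d)$ is the graded dual of the Hall–Ringel bialgebra. It has the $\mathbb C$-basis of delta functions $\delta_{[V]}$, of degree $-|V|$, unit $\delta_{[0]}$, counit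 $\delta_{[V]}\mapsto\delta_{[V],[0]}$ (Kronecker delta), and $$\delta_{[U]}\delta_{[W]}=\sum_{[V]}v^{\langle|U|,|W|\rangle}\frac{|\mathrm{Aut}(U)||\mathrm{Aut}(W)|}{|\mathrm{Aut}(V)|}|\mathcal F^V_{UW}|\,\delta_{[V]},\qquad \Delta(\delta_{[V]})=\sum_{[U],[W]}v^{\langle|U|,|W|\rangle}|\mathcal F^V_{UW}|\,\delta_{[U]}\otimes\delta_{[W]}.$$ Put $[V]^*=v^{-\frac12\langle|V|,|V|\rangle+\frac12\sum_i d_i\dim_{\mathbb F_{d_i}}V_i}\,\delta_{[V]}$. The *quantum shuffle algebra* $g^*$ (with scalars $\mathbb C$) has as basis the set $\mathbf W$ of all finite words in $I$. With $|\mathbf j|=\alpha_{j_1}+\dots+\alpha_{j_r}$, the word $\mathbf j=(j_1,\dots,j_r)$ is an element of degree $-|\mathbf j|$. The unit is the empty word, the counit is $1$ on the empty word and $0$ on the other words, and $$(j_1,\dots,j_r)\circ(j_{r+1},\dots,j_{r+s})=\sum_{\sigma}v^{\zeta(\sigma)}(j_{\sigma_1},\dots,j_{\sigma_{r+s}}),\qquad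 \Delta(\mathbf h)=\sum_{(\mathbf j_1,\mathbf j_2)=\mathbf h}v^{\frac12(|\mathbf j_1|,|\mathbf j_2|)}\,\mathbf j_1\otimes\mathbf j_2,$$ where $\sigma$ runs over the permutations of $\{1,\dots,r+s\}$ with $\sigma^{-1}_1<\dots<\sigma^{-1}_r$ and $\sigma^{-1}_{r+1}<\dots<\sigma^{-1}_{r+s}$, the second sum is over the factorizations of $\mathbf h$ as a concatenation of two words, and $\zeta(\sigma)=\frac12\sum(\pm1)(\alpha_{j_k},\alpha_{j_\ell})$ over $1\le k\le r<\ell\le r+s$, with sign $+$ if $\sigma^{-1}_\ell<\sigma^{-1}_k$ and $-$ if $\sigma^{-1}_k<\sigma^{-1}_\ell$. For a word $\mathbf j=(j_1,\dots,j_r)$ let $\mathcal F_{\mathbf j}(V)$ be the set of flags of subrepresentations $0=V_r\subset\dots\subset V_1\subset V_0=V$ with $V_{k-1}/V_k\cong S_{j_k}$ for $1\le k\le r$. **Theorem.** $\mathcal H^*(Q,\mathbf d)$ and $g^*$ are twisted bialgebras, and the linear map $\Omega:\mathcal H^*(Q,\mathbf d)\to g^*$ such that, for every representation $V$, $$\Omega([V]^*)=\sum_{\mathbf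 j\in\mathbf W}v^{-\sum_{k<\ell}\langle\alpha_{j_\ell},\alpha_{j_k}\rangle}\,|\mathcal F_{\mathbf j}(V)|\cdot\mathbf j$$ is a homomorphism of twisted bialgebras. -/

import Mathlib

open scoped TensorProduct

universe u w x

noncomputable section

namespace GradedBialgebra

/-- A free `R`-module `B →₀ R` with a `Γ`-homogeneous basis `B`, together with the structure maps of
an algebra and of a coalgebra.  The laws are collected in `IsTwistedBialgebra` below. -/
structure StructureMaps (R : Type*) [CommRing R] (Γ : Type*) (B : Type*) where
  /-- the degree of a basis element -/
  deg : B → Γ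
  /-- the multiplication -/
  mul : (B →₀ R) →ₗ[R] (B →₀ R) →ₗ[R] (B →₀ R)
  /-- the unit element -/
  one : B →₀ R
  /-- the comultiplication -/
  comul : (B →₀ R) →ₗ[R] (B →₀ R) ⊗[R] (B →₀ R)
  /-- the counit -/
  counit : (B →₀ R) →ₗ[R] R

variable {R : Type*} [CommRing R] {Γ : Type*} {B C : Type*}

/-- The homogeneous component of degree `γ`. -/
def StructureMaps.component (S : StructureMaps R Γ B) (γ : Γ) : Submodule R (B →₀ R) :=
  Finsupp.supported R R {b | S.deg b = γ}

/-- The homogeneous component of degree `γ` of the tensor square. -/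
def StructureMaps.tensorComponent [Add Γ] (S : StructureMaps R Γ B) (γ : Γ) :
    Submodule R ((B →₀ R) ⊗[R] (B →₀ R)) :=
  Submodule.span R {t | ∃ b c : B, S.deg b + S.deg c = γ ∧
    t = Finsupp.single b (1 : R) ⊗ₜ[R] Finsupp.single c (1 : R)}

/-- The twisted multiplication on the tensor square: on basis elements
`(b₁ ⊗ b₂) (c₁ ⊗ c₂) = χ (|b₂|, |c₁|) • (b₁ c₁ ⊗ b₂ c₂)`. -/
def StructureMaps.twistedMul (S : StructureMaps R Γ B) (χ : Γ → Γ → R) :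
    ((B →₀ R) ⊗[R] (B →₀ R)) →ₗ[R] ((B →₀ R) ⊗[R] (B →₀ R)) →ₗ[R]
      ((B →₀ R) ⊗[R] (B →₀ R)) :=
  TensorProduct.lift <|
    Finsupp.linearCombination R fun b₁ : B => Finsupp.linearCombination R fun b₂ : B =>
      TensorProduct.lift <|
        Finsupp.linearCombination R fun c₁ : B => Finsupp.linearCombination R fun c₂ : B =>
          χ (S.deg b₂) (S.deg c₁) •
            (S.mul (Finsupp.single b₁ 1) (Finsupp.single c₁ 1) ⊗ₜ[R]
              S.mul (Finsupp.single b₂ 1) (Finsupp.single c₂ 1))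

/-- The laws of a `Γ`-graded bialgebra whose tensor square carries the multiplication twisted
by `χ`. -/
structure StructureMaps.IsTwistedBialgebra [AddMonoid Γ] (S : StructureMaps R Γ B)
    (χ : Γ → Γ → R) : Prop where
  mul_assoc : ∀ f g h, S.mul (S.mul f g) h = S.mul f (S.mul g h)
  one_mul : ∀ f, S.mul S.one f = f
  mul_one : ∀ f, S.mul f S.one = f
  coassoc : (TensorProduct.assoc R (B →₀ R) (B →₀ R) (B →₀ R)).toLinearMap ∘ₗ
      S.comul.rTensor (B →₀ R) ∘ₗ S.comul = S.comul.lTensor (B →₀ R) ∘ₗ S.comul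
  counit_comul : (TensorProduct.lid R (B →₀ R)).toLinearMap ∘ₗ
      S.counit.rTensor (B →₀ R) ∘ₗ S.comul = LinearMap.id
  comul_counit : (TensorProduct.rid R (B →₀ R)).toLinearMap ∘ₗ
      S.counit.lTensor (B →₀ R) ∘ₗ S.comul = LinearMap.id
  comul_mul : ∀ f g, S.comul (S.mul f g) = S.twistedMul χ (S.comul f) (S.comul g)
  comul_one : S.comul S.one = S.one ⊗ₜ[R] S.one
  counit_mul : ∀ f g, S.counit (S.mul f g) = S.counit f * S.counit g
  counit_one : S.counit S.one = 1
  mul_mem : ∀ β γ, ∀ f ∈ S.component β, ∀ g ∈ S.component γ, S.mul f g ∈ S.component (β + γ)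
  one_mem : S.one ∈ S.component 0
  comul_mem : ∀ γ, ∀ f ∈ S.component γ, S.comul f ∈ S.tensorComponent γ
  counit_eq_zero : ∀ γ, γ ≠ 0 → ∀ f ∈ S.component γ, S.counit f = 0

/-- `φ` is a homomorphism between the `χ`-twisted bialgebras `S` and `T`; that `S` and `T` are
twisted bialgebras is part of the assertion. -/
structure IsTwistedBialgebraHom [AddMonoid Γ] (χ : Γ → Γ → R) (S : StructureMaps R Γ B)
    (T : StructureMaps R Γ C) (φ : (B →₀ R) →ₗ[R] (C →₀ R)) : Prop where
  source : S.IsTwistedBialgebra χ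
  target : T.IsTwistedBialgebra χ
  map_mul : ∀ f g, φ (S.mul f g) = T.mul (φ f) (φ g)
  map_one : φ S.one = T.one
  map_comul : T.comul ∘ₗ φ = TensorProduct.map φ φ ∘ₗ S.comul
  map_counit : T.counit ∘ₗ φ = S.counit
  map_component : ∀ γ, ∀ f ∈ S.component γ, φ f ∈ T.component γ

end GradedBialgebra

namespace ValuedQuiver

/-! ### The root lattice and its bilinear forms -/

section Forms

variable {I : Type w} [Quiver.{x + 1} I] (d : I → ℕ)

/-- The quiver has no oriented cycles. -/
def IsAcyclic (I : Type w) [Quiver.{x + 1} I] : Prop :=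
  ∀ (i : I) (p : Quiver.Path i i), p.length = 0

/-- The entries `b i j` of the adjacency matrix: `n d_j / gcd (d_i, d_j)` if there are `n` arrows
`i ⟶ j`, and `- n d_j / gcd (d_i, d_j)` if there are `n` arrows `j ⟶ i` (in an acyclic quiver
the arrows between `i` and `j` all have the same direction). -/
def adjEntry (i j : I) : ℤ :=
  ((Nat.card (i ⟶ j) : ℤ) - (Nat.card (j ⟶ i) : ℤ)) * ((d j / Nat.gcd (d i) (d j) : ℕ) : ℤ)

open Classical in
/-- The entries of the Cartan matrix: `2` on the diagonal and `-|b i j|` off it. -/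
def cartanEntry (i j : I) : ℤ := if i = j then 2 else -|adjEntry d i j|

open Classical in
/-- The Euler--Ringel form on simple roots. -/
def eulerSimple (i j : I) : ℤ :=
  if i = j then (d i : ℤ) else -(max ((d i : ℤ) * adjEntry d i j) 0)

/-- The Euler--Ringel form on the root lattice `I →₀ ℤ`. -/
def euler (a b : I →₀ ℤ) : ℤ := a.sum fun i m => b.sum fun j n => m * n * eulerSimple d i j

/-- The symmetric form of the Cartan datum on the root lattice, `(α_i, α_j) = d_i a_{ij}`. -/
def symForm (a b : I →₀ ℤ) : ℤ :=
  a.sum fun i m => b.sum fun j n => m * n * ((d i : ℤ) * cartanEntry d i j)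

/-- The linear form `∑ d_i a_i` on the root lattice. -/
def weight (a : I →₀ ℤ) : ℤ := a.sum fun i m => (d i : ℤ) * m

/-- The degree `|j| = α_{j_1} + ⋯ + α_{j_r}` of a word. -/
def wordDegree (j : List I) : I →₀ ℤ := (j.map fun i => Finsupp.single i (1 : ℤ)).sum

end Forms

/-! ### Representations -/

section Representations

/-- The degree `n` extension `{z | z ^ (q ^ n) = z}` of the finite field `F`, `q = |F|`, inside an
algebraic closure (for `n ≥ 1`). -/
def extField (F : Type u) [Field F] [Finite F] (n : ℕ) :
    IntermediateField F (AlgebraicClosure F) where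
  carrier := {z | z ^ (Nat.card F ^ n) = z}
  mul_mem' := by
    intro a b ha hb
    change a ^ (Nat.card F ^ n) = a at ha
    change b ^ (Nat.card F ^ n) = b at hb
    change (a * b) ^ (Nat.card F ^ n) = a * b
    rw [mul_pow, ha, hb]
  add_mem' := by
    intro a b ha hb
    change (a + b) ^ (Nat.card F ^ n) = a + b
    change a ^ (Nat.card F ^ n) = a at ha
    change b ^ (Nat.card F ^ n) = b at hb
    obtain ⟨p, hp⟩ := CharP.exists F
    obtain ⟨m, hprime, hm⟩ : ∃ m : ℕ, Nat.Prime p ∧ Nat.card F = p ^ m := by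
      have := Fintype.ofFinite F
      obtain ⟨m, hprime, hm⟩ := FiniteField.card F p
      exact ⟨m, hprime, by rw [Nat.card_eq_fintype_card, hm]⟩
    have := Fact.mk hprime
    have : CharP (AlgebraicClosure F) p := charP_of_injective_algebraMap' F p
    rw [hm, ← pow_mul] at ha hb ⊢
    rw [add_pow_char_pow, ha, hb]
  algebraMap_mem' := by
    intro r
    have := Fintype.ofFinite F
    change algebraMap F (AlgebraicClosure F) r ^ (Nat.card F ^ n) = _
    rw [← map_pow, Nat.card_eq_fintype_card, FiniteField.pow_card_pow]
  inv_mem' := by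
    intro a ha
    change a ^ (Nat.card F ^ n) = a at ha
    change a⁻¹ ^ (Nat.card F ^ n) = a⁻¹
    rw [inv_pow, ha]

theorem extField_le (F : Type u) [Field F] [Finite F] {m n : ℕ} (h : m ∣ n) :
    extField F m ≤ extField F n := by
  obtain ⟨k, rfl⟩ := h
  intro z hz
  have hz' : z ^ (Nat.card F ^ m) = z := hz
  change z ^ (Nat.card F ^ (m * k)) = z
  rw [pow_mul]
  induction k with
  | zero => simp
  | succ k ih => rw [pow_succ, pow_mul, ih, hz']

/-- Finite-dimensional representations of the valued quiver: an `F_{d_i}`-vector space at each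
vertex `i` and an `F_{gcd (d_i, d_j)}`-linear map for each arrow `i ⟶ j`. -/
structure Rep (F : Type u) [Field F] [Finite F] {I : Type w} [Quiver.{x + 1} I] (d : I → ℕ) where
  obj : I → Type u
  [addCommGroup : ∀ i, AddCommGroup (obj i)]
  [module : ∀ i, Module (extField F (d i)) (obj i)]
  [finite : ∀ i, Module.Finite (extField F (d i)) (obj i)]
  finite_support : {i | Nontrivial (obj i)}.Finite
  map : ∀ {i j : I}, (i ⟶ j) → (obj i →+ obj j)
  map_smul : ∀ {i j : I} (a : i ⟶ j) (c : extField F (Nat.gcd (d i) (d j))) (y : obj i),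
    map a ((⟨c, extField_le F (Nat.gcd_dvd_left _ _) c.2⟩ : extField F (d i)) • y) =
      (⟨c, extField_le F (Nat.gcd_dvd_right _ _) c.2⟩ : extField F (d j)) • map a y

attribute [instance] Rep.addCommGroup Rep.module Rep.finite

variable {F : Type u} [Field F] [Finite F] {I : Type w} [Quiver.{x + 1} I] {d : I → ℕ}

namespace Rep

/-- Isomorphisms of representations. -/
structure Iso (V W : Rep F d) where
  equiv : ∀ i, V.obj i ≃ₗ[extField F (d i)] W.obj i
  comm : ∀ {i j : I} (a : i ⟶ j) (y : V.obj i), equiv j (V.map a y) = W.map a (equiv i y)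

instance setoid (F : Type u) [Field F] [Finite F] {I : Type w} [Quiver.{x + 1} I] (d : I → ℕ) :
    Setoid (Rep F d) where
  r V W := Nonempty (Iso V W)
  iseqv :=
    { refl := fun V => ⟨⟨fun _ => LinearEquiv.refl _ _, fun _ _ => rfl⟩⟩
      symm := fun ⟨e⟩ => ⟨⟨fun i => (e.equiv i).symm, fun a y => by
        rw [LinearEquiv.symm_apply_eq, e.comm, LinearEquiv.apply_symm_apply]⟩⟩
      trans := fun ⟨e⟩ ⟨f⟩ => ⟨⟨fun i => (e.equiv i).trans (f.equiv i), fun a y => by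
        simp only [LinearEquiv.trans_apply, e.comm, f.comm]⟩⟩ }

/-- The dimension vector `|V|`, with entries `dim_{F_{d_i}} V_i`. -/
def dimVec (V : Rep F d) : I →₀ ℤ :=
  Finsupp.ofSupportFinite (fun i => (Module.finrank (extField F (d i)) (V.obj i) : ℤ)) <|
    V.finite_support.subset fun i hi => by
      by_contra hn
      have := not_nontrivial_iff_subsingleton.mp hn
      exact hi (by simp only [Module.finrank_zero_of_subsingleton, Nat.cast_zero])

/-- Subrepresentations. -/
structure Sub (V : Rep F d) where
  carrier : ∀ i, Submodule (extField F (d i)) (V.obj i)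
  map_mem : ∀ {i j : I} (a : i ⟶ j), ∀ y ∈ carrier i, V.map a y ∈ carrier j

/-- A subrepresentation as a representation. -/
def Sub.toRep {V : Rep F d} (X : V.Sub) : Rep F d where
  obj i := X.carrier i
  finite_support := V.finite_support.subset fun i (_ : Nontrivial (X.carrier i)) =>
    (X.carrier i).injective_subtype.nontrivial
  map {i _} a :=
    { toFun := fun y => ⟨V.map a (y : V.obj i), X.map_mem a y y.2⟩
      map_zero' := Subtype.ext (map_zero (V.map a))
      map_add' := fun y z => Subtype.ext (map_add (V.map a) (y : V.obj i) (z : V.obj i)) }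
  map_smul {i _} a c y := Subtype.ext (V.map_smul a c (y : V.obj i))

/-- The quotient representation `V / X`. -/
def Sub.quotient {V : Rep F d} (X : V.Sub) : Rep F d where
  obj i := V.obj i ⧸ X.carrier i
  finite_support := V.finite_support.subset fun i (hi : Nontrivial (V.obj i ⧸ X.carrier i)) =>
    (X.carrier i).mkQ_surjective.nontrivial
  map {i j} a :=
    QuotientAddGroup.map (X.carrier i).toAddSubgroup (X.carrier j).toAddSubgroup (V.map a)
      (fun y hy => X.map_mem a y hy)
  map_smul {i j} a c y := by
    obtain ⟨y, rfl⟩ := (X.carrier i).mkQ_surjective y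
    exact congrArg (X.carrier j).mkQ (V.map_smul a c y)

/-- `Y` as a subrepresentation of the representation `X`, that is `X ∩ Y`. -/
def Sub.within {V : Rep F d} (Y X : V.Sub) : X.toRep.Sub where
  carrier i := (Y.carrier i).comap (X.carrier i).subtype
  map_mem {i _} a y hy := Y.map_mem a ((X.carrier i).subtype y) hy

/-- The zero subrepresentation. -/
def Sub.bot (V : Rep F d) : V.Sub where
  carrier _ := ⊥
  map_mem a y hy := by
    rw [Submodule.mem_bot] at hy ⊢
    rw [hy, map_zero]

/-- The subrepresentation `V` of `V`. -/
def Sub.top (V : Rep F d) : V.Sub where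
  carrier _ := ⊤
  map_mem _ _ _ := Submodule.mem_top

open Classical in
/-- The simple representation `S_i`: the space `F_{d_i}` at the vertex `i` and zero elsewhere. -/
def simple (F : Type u) [Field F] [Finite F] {I : Type w} [Quiver.{x + 1} I] (d : I → ℕ) (i : I) :
    Rep F d where
  obj k := ((if k = i then ⊤ else ⊥ :
    Submodule (extField F (d k)) (extField F (d k))) : Type u)
  finite_support := (Set.finite_singleton i).subset fun k hk => by
    by_contra hne
    have hki : ¬ k = i := hne
    have hk' : Nontrivial ((if k = i then ⊤ else ⊥ :
      Submodule (extField F (d k)) (extField F (d k))) : Type u) := hk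
    rw [if_neg hki] at hk'
    exact false_of_nontrivial_of_subsingleton
      ((⊥ : Submodule (extField F (d k)) (extField F (d k))) : Type u)
  map _ := 0
  map_smul _ _ _ := (smul_zero _).symm

/-- Flags `0 = V_r ⊂ ⋯ ⊂ V_1 ⊂ V_0 = V` of type `j`, i.e. with `V_{k-1} / V_k ≅ S_{j_k}` for
`1 ≤ k ≤ r` (below the index `k` runs through `0, …, r - 1`). -/
structure Flag (V : Rep F d) (j : List I) where
  step : Fin (j.length + 1) → V.Sub
  step_zero : step 0 = Sub.top V
  step_last : step (Fin.last j.length) = Sub.bot V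
  anti : ∀ (k : Fin j.length) (i : I), (step k.succ).carrier i ≤ (step k.castSucc).carrier i
  subquotient : ∀ k : Fin j.length,
    Nonempty (Iso ((step k.succ).within (step k.castSucc)).quotient (simple F d (j.get k)))

/-- The zero representation. -/
def zero (F : Type u) [Field F] [Finite F] {I : Type w} [Quiver.{x + 1} I] (d : I → ℕ) :
    Rep F d where
  obj _ := PUnit
  finite_support := Set.finite_empty.subset fun _ hi =>
    (not_nontrivial_iff_subsingleton.mpr inferInstance hi).elim
  map _ := 0
  map_smul _ _ _ := rfl

end Rep

/-- Isomorphism classes of representations. -/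
abbrev IsoClass (F : Type u) [Field F] [Finite F] {I : Type w} [Quiver.{x + 1} I] (d : I → ℕ) :=
  Quotient (Rep.setoid F d)

/-- The isomorphism class `[V]`. -/
def Rep.cls (V : Rep F d) : IsoClass F d := Quotient.mk (Rep.setoid F d) V

/-- The dimension vector of an isomorphism class. -/
def IsoClass.dimVec (V : IsoClass F d) : I →₀ ℤ := Rep.dimVec (Quotient.out V)

/-- The order of the automorphism group of (a representative of) an isomorphism class. -/
def IsoClass.autCard (V : IsoClass F d) : ℕ :=
  Nat.card (Rep.Iso (Quotient.out V) (Quotient.out V))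

/-- The Hall number `|{R ⊂ V : R ≅ W and V / R ≅ U}|`. -/
def hallNumber (U V W : IsoClass F d) : ℕ :=
  Nat.card {X : Rep.Sub (Quotient.out V) // X.toRep.cls = W ∧ X.quotient.cls = U}

end Representations

/-! ### The dual Hall--Ringel bialgebra, the quantum shuffle bialgebra, the character -/

section Bialgebras

/-- The power `v ^ (n / 2)` of `v = √|F|`. -/
def vHalfPow (F : Type u) (n : ℤ) : ℂ := ((√(√(Nat.card F : ℝ)) : ℝ) : ℂ) ^ n

variable (F : Type u) [Field F] [Finite F] {I : Type w} [Quiver.{x + 1} I] (d : I → ℕ)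

/-- The twist `v ^ (β, γ)`. -/
def twist (β γ : I →₀ ℤ) : ℂ := vHalfPow F (2 * symForm d β γ)

variable {F d} in
/-- The coefficient of `[V]` in the Hall product `[U][W]`. -/
def hallMulCoeff (U W V : IsoClass F d) : ℂ :=
  vHalfPow F (2 * euler d U.dimVec W.dimVec) * (hallNumber U V W : ℂ)

variable {F d} in
/-- The coefficient of `[U] ⊗ [W]` in the Hall comultiplication of `[V]`. -/
def hallComulCoeff (V U W : IsoClass F d) : ℂ :=
  vHalfPow F (2 * euler d U.dimVec W.dimVec) *
    (((U.autCard : ℂ) * (W.autCard : ℂ)) / (V.autCard : ℂ)) * (hallNumber U V W : ℂ)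

/-- The graded dual of the Hall--Ringel bialgebra, in the basis of delta functions `δ_{[V]}`, with
`|δ_{[V]}| = -|V|`.  The multiplication is the transpose of the Hall comultiplication and the
comultiplication the transpose of the Hall product; all sums are finite. -/
def dualHall : GradedBialgebra.StructureMaps ℂ (I →₀ ℤ) (IsoClass F d) where
  deg V := -V.dimVec
  mul := Finsupp.linearCombination ℂ fun U => Finsupp.linearCombination ℂ fun W =>
    ∑ᶠ V : IsoClass F d, Finsupp.single V (hallComulCoeff V U W)
  one := Finsupp.single (Rep.zero F d).cls 1
  comul := Finsupp.linearCombination ℂ fun V =>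
    ∑ᶠ P : IsoClass F d × IsoClass F d, hallMulCoeff P.1 P.2 V •
      (Finsupp.single P.1 (1 : ℂ) ⊗ₜ[ℂ] Finsupp.single P.2 (1 : ℂ))
  counit := Finsupp.lapply (Rep.zero F d).cls

/-- The `(r, n - r)`-shuffles, `σ k` being the `k`-th entry of the ordering `σ`: the positions
`σ⁻¹` increase on the first `r` letters and on the other letters. -/
def IsShuffle (r : ℕ) {n : ℕ} (σ : Equiv.Perm (Fin n)) : Prop :=
  ∀ k l : Fin n, k < l → (l.val < r ∨ r ≤ k.val) → σ.symm k < σ.symm l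

/-- Twice the exponent `ζ(σ)`, for the word `j` cut after its `r`-th letter: a pair of a letter `k`
of the first and a letter `l` of the second part counts `+ (α_{j_k}, α_{j_l})` if `l` comes
before `k` in `σ`, and `- (α_{j_k}, α_{j_l})` if it comes after. -/
def twoZeta (j : List I) (r : ℕ) (σ : Equiv.Perm (Fin j.length)) : ℤ :=
  ∑ k : Fin j.length, ∑ l : Fin j.length,
    if k.val < r ∧ r ≤ l.val then
      (if σ.symm l < σ.symm k then 1 else -1) *
        symForm d (wordDegree [j.get k]) (wordDegree [j.get l])
    else 0

open Classical in
/-- The quantum shuffle product of two words. -/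
def shuffleWords (j₁ j₂ : List I) : List I →₀ ℂ :=
  ∑ σ : Equiv.Perm (Fin (j₁ ++ j₂).length),
    if IsShuffle j₁.length σ then
      Finsupp.single (List.ofFn fun k => (j₁ ++ j₂).get (σ k))
        (vHalfPow F (twoZeta d (j₁ ++ j₂) j₁.length σ))
    else 0

/-- The quantum shuffle algebra on words, with scalars `ℂ` and `v = √|F|`.  As in the dual
Hall--Ringel bialgebra, a word `j` is an element of degree `-|j|`. -/
def shuffle : GradedBialgebra.StructureMaps ℂ (I →₀ ℤ) (List I) where
  deg j := -wordDegree j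
  mul := Finsupp.linearCombination ℂ fun j₁ => Finsupp.linearCombination ℂ fun j₂ =>
    shuffleWords F d j₁ j₂
  one := Finsupp.single [] 1
  comul := Finsupp.linearCombination ℂ fun h =>
    ∑ m ∈ Finset.range (h.length + 1),
      vHalfPow F (symForm d (wordDegree (h.take m)) (wordDegree (h.drop m))) •
        (Finsupp.single (h.take m) (1 : ℂ) ⊗ₜ[ℂ] Finsupp.single (h.drop m) (1 : ℂ))
  counit := Finsupp.lapply []

/-- `∑_{k < l} ⟨α_{j_l}, α_{j_k}⟩` for a word `j`. -/
def wordEuler (j : List I) : ℤ :=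
  ∑ k : Fin j.length, ∑ l : Fin j.length, if k < l then eulerSimple d (j.get l) (j.get k) else 0

variable {F d} in
/-- The generating function `∑_j v ^ (-∑_{k < l} ⟨α_{j_l}, α_{j_k}⟩) |F_j(V)| j` of flags in `V`;
only finitely many words contribute. -/
def flagSeries (V : Rep F d) : List I →₀ ℂ :=
  ∑ᶠ j : List I, Finsupp.single j (vHalfPow F (-(2 * wordEuler d j)) * (Nat.card (V.Flag j) : ℂ))

/-- The rescaling factor `v ^ (-⟨a, a⟩ / 2 + ∑ d_i a_i / 2)`. -/
def rescale (a : I →₀ ℤ) : ℂ := vHalfPow F (-euler d a a + weight d a)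

variable {F d} in
/-- The rescaled basis element `[V]^*` of the dual Hall--Ringel bialgebra. -/
def Rep.dualCls (V : Rep F d) : IsoClass F d →₀ ℂ :=
  Finsupp.single V.cls (rescale F d V.dimVec)

/-- The quantum shuffle character: the linear map with `Ω [V]^* = flagSeries V`. -/
def shuffleCharacter : (IsoClass F d →₀ ℂ) →ₗ[ℂ] (List I →₀ ℂ) :=
  Finsupp.linearCombination ℂ fun V : IsoClass F d =>
    (rescale F d V.dimVec)⁻¹ • flagSeries (Quotient.out V)

end Bialgebras

end ValuedQuiver

end

/-! Hall side. Call a family of semilinear maps U_i → W_j, one for each arrow, a cocycle; it defines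
an extension on the spaces U_i × W_i. Riedtmann's formula (`card_extension_mul_autCard`) counts
these extensions by pairs of a short exact sequence and a splitting. It absorbs the automorphism
factors and turns the product of two delta functions into a scalar times a sum over all cocycles
(`dualHall_mul_delta`), while the coproduct is a sum over subrepresentations
(`dualHall_comul_delta`). Associativity becomes the rebracketing of iterated extensions, and
coassociativity becomes the count of chains X ⊂ Y ⊂ V from either end (`sum_chains`). The
compatibility of product and coproduct is Green's formula (`sum_extension_sub`): a subrepresentation
Y of an extension of U by W has an image B in U and an intersection D with W, and a shear carries B
⊕ D to Y. After the shear the cocycle maps B to D, hence splits into a cocycle for U/B and W/D, one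
for B and D, and a free corner from U/B to D. The remaining powers of |F| produce the twist, because
the Euler form is the exponent for vertexwise maps minus the exponent for cocycles (`euler_eq`,
`card_gradedHom`, `card_cocycle`).

Shuffle side. Sorting shuffles by their first letter gives a recursion for the product
(`shuffleSum_eq_shuffleRec`). It says that deleting a first letter i is a derivation twisted by
weight operators (`dropLetter_mul`), and deletion interacts just as simply with the coproduct
(`dropLetter_comul`). An element is determined by its constant term and all its deletions, so
associativity and the compatibility of product and coproduct follow by induction on the total length
of the words.

Character. The coefficient of j in the image of a delta function is a power of v^{1/2} times the
number of flags of type j, and the exponent changes under concatenation only by a skew form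
(`characterExp_append`). Flags of type ab in V amount to a subrepresentation X with a flag of type a
in V/X and one of type b in X (`flagCount_append`), so the character respects the coproduct
(`shuffleCharacter_comul`).

Multiplicativity needs no further counting. In the shuffle algebra the constant term and the parts
of the coproduct with a single letter on the left determine an element. Comparing the coproducts of
both sides of the product identity, the left factors have total degree one, where multiplicativity
holds for degree reasons, and the right factors have smaller total dimension. Induction on the
dimension finishes the proof (`shuffleCharacter_mul_delta`). -/

set_option linter.unusedSectionVars false

noncomputable section

/-! ### Finite fields, isomorphism classes and lattices of subrepresentations. -/

section

namespace ValuedQuiver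

section FieldLemmas

variable (F : Type u) [Field F] [Finite F]

-- The elements are the roots of X^{q^n} - X in the algebraic closure, with q = |F|. This polynomial
-- is separable, so it has as many roots as its degree.
open Polynomial in
theorem card_extField {n : ℕ} (hn : 0 < n) : Nat.card (extField F n) = Nat.card F ^ n := by
  obtain ⟨p, hp⟩ := CharP.exists F
  have := Fintype.ofFinite F
  obtain ⟨m, hprime, hm⟩ := FiniteField.card F p
  rw [Nat.card_eq_fintype_card (α := F), hm]
  have := Fact.mk hprime
  have : CharP (AlgebraicClosure F) p := charP_of_injective_algebraMap' F p
  set E := AlgebraicClosure F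
  have hmn : (m : ℕ) * n ≠ 0 := mul_ne_zero m.2.ne' hn.ne'
  set g : E[X] := X ^ p ^ ((m : ℕ) * n) - X with hg
  have hg0 : g ≠ 0 := FiniteField.X_pow_card_pow_sub_X_ne_zero _ hmn hprime.one_lt
  have hdeg : g.natDegree = p ^ ((m : ℕ) * n) :=
    FiniteField.X_pow_card_pow_sub_X_natDegree_eq _ hmn hprime.one_lt
  have hcard : Fintype.card (g.rootSet E) = g.natDegree :=
    card_rootSet_eq_natDegree (galois_poly_separable p _ (dvd_pow_self p hmn))
      (IsAlgClosed.splits _)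
  rw [← pow_mul, ← hdeg, ← hcard, ← Nat.card_eq_fintype_card]
  refine Nat.card_congr (Equiv.subtypeEquivRight fun z => ?_)
  rw [mem_rootSet_of_ne hg0]
  change z ^ (Nat.card F ^ n) = z ↔ _
  rw [Nat.card_eq_fintype_card (α := F), hm, hg]
  simp only [map_sub, map_pow, aeval_X, sub_eq_zero, ← pow_mul]

theorem finite_extField {n : ℕ} (hn : 0 < n) : Finite (extField F n) :=
  Nat.finite_of_card_ne_zero (by rw [card_extField F hn]; exact pow_ne_zero _ Nat.card_pos.ne')

end FieldLemmas

section Pi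

theorem finite_pi_of_subsingleton {K : Type*} {M : K → Type*} [∀ e, Finite (M e)] {s : Set K}
    (hs : s.Finite) (h : ∀ e, e ∉ s → Subsingleton (M e)) : Finite (∀ e, M e) := by
  have := hs.to_subtype
  refine Finite.of_injective (fun (f : ∀ e, M e) (e : s) => f e) fun f g hfg => funext fun e => ?_
  by_cases he : e ∈ s
  · exact congrFun hfg ⟨e, he⟩
  · exact (h e he).elim _ _

/-- The factors outside `s` are one-point types. This lets families over an infinite vertex set be
counted on the support of a dimension vector. -/
theorem card_pi_of_unique {K : Type*} {M : K → Type*} [∀ e, Nonempty (M e)] (s : Finset K)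
    (h : ∀ e, e ∉ s → Subsingleton (M e)) : Nat.card (∀ e, M e) = ∏ e ∈ s, Nat.card (M e) := by
  classical
  rw [← Finset.prod_coe_sort, ← Nat.card_pi]
  refine Nat.card_congr
    { toFun := fun f e => f e
      invFun := fun f e => if he : e ∈ s then f ⟨e, he⟩ else Classical.arbitrary _
      left_inv := fun f => funext fun e => ?_
      right_inv := fun f => funext fun e => ?_ }
  · by_cases he : e ∈ s
    · simp [he]
    · exact (h e he).elim _ _
  · simp

theorem card_linearMap_of_finite {k M N : Type*} [Field k] [Finite k] [AddCommGroup M]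
    [AddCommGroup N] [Module k M] [Module k N] [Finite M] [Finite N] :
    Nat.card (M →ₗ[k] N) = Nat.card k ^ (Module.finrank k M * Module.finrank k N) := by
  rw [Module.natCard_eq_pow_finrank (K := k), Module.finrank_linearMap]

end Pi

variable {F : Type u} [Field F] [Finite F] {I : Type w} [Quiver.{x + 1} I] {d : I → ℕ}

namespace Rep

theorem finite_obj (hd : ∀ i, 0 < d i) (V : Rep F d) (i : I) : Finite (V.obj i) :=
  have := finite_extField F (hd i)
  Module.finite_of_finite (extField F (d i))

theorem card_obj (hd : ∀ i, 0 < d i) (V : Rep F d) (i : I) : Nat.card (V.obj i) =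
    Nat.card F ^ (d i * Module.finrank (extField F (d i)) (V.obj i)) := by
  rw [Module.natCard_eq_pow_finrank (K := extField F (d i)), card_extField F (hd i), pow_mul]

theorem subsingleton_of_notMem (V : Rep F d) {i : I} (h : i ∉ {i | Nontrivial (V.obj i)}) :
    Subsingleton (V.obj i) := not_nontrivial_iff_subsingleton.mp h

@[ext] theorem Sub.ext {V : Rep F d} {X Y : V.Sub} (h : ∀ i, X.carrier i = Y.carrier i) :
    X = Y := by
  cases X; cases Y; congr; exact funext h

@[ext] theorem Iso.ext {V W : Rep F d} {e f : Iso V W}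
    (h : ∀ i y, e.equiv i y = f.equiv i y) : e = f := by
  cases e; cases f; congr; exact funext fun i => LinearEquiv.ext (h i)

theorem finite_sub (hd : ∀ i, 0 < d i) (V : Rep F d) : Finite V.Sub := by
  have h1 : ∀ i, Finite (Submodule (extField F (d i)) (V.obj i)) := fun i =>
    have := V.finite_obj hd i
    Finite.of_injective _ (SetLike.coe_injective (A := Submodule (extField F (d i)) (V.obj i)))
  have : Finite (∀ i, Submodule (extField F (d i)) (V.obj i)) :=
    finite_pi_of_subsingleton V.finite_support fun i hi =>
      have := V.subsingleton_of_notMem hi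
      inferInstance
  exact Finite.of_injective (fun X : V.Sub => X.carrier) fun X Y h => Sub.ext (congrFun h)

theorem finite_iso (hd : ∀ i, 0 < d i) (V W : Rep F d) : Finite (Iso V W) := by
  have h1 : ∀ i, Finite (V.obj i ≃ₗ[extField F (d i)] W.obj i) := fun i =>
    have := V.finite_obj hd i
    have := W.finite_obj hd i
    Finite.of_injective _ (DFunLike.coe_injective (F := V.obj i ≃ₗ[extField F (d i)] W.obj i))
  have : Finite (∀ i, V.obj i ≃ₗ[extField F (d i)] W.obj i) :=
    finite_pi_of_subsingleton W.finite_support fun i hi =>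
      have := W.subsingleton_of_notMem hi
      ⟨fun e f => LinearEquiv.ext fun y => Subsingleton.elim _ _⟩
  exact Finite.of_injective (fun X : Iso V W => X.equiv) fun X Y h =>
    Iso.ext fun i y => by rw [show X.equiv = Y.equiv from h]

namespace Iso

/-- The identity isomorphism. -/
def refl (V : Rep F d) : Iso V V := ⟨fun _ => LinearEquiv.refl _ _, fun _ _ => rfl⟩

/-- The inverse isomorphism. -/
def symm {V W : Rep F d} (e : Iso V W) : Iso W V :=
  ⟨fun i => (e.equiv i).symm, fun a y => by
    rw [LinearEquiv.symm_apply_eq, e.comm, LinearEquiv.apply_symm_apply]⟩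

/-- The composite of two isomorphisms. -/
def trans {V W Z : Rep F d} (e : Iso V W) (f : Iso W Z) : Iso V Z :=
  ⟨fun i => (e.equiv i).trans (f.equiv i), fun a y => by
    simp only [LinearEquiv.trans_apply, e.comm, f.comm]⟩

end Iso

theorem cls_eq_iff {V W : Rep F d} : V.cls = W.cls ↔ Nonempty (Iso V W) := Quotient.eq

theorem Iso.cls_eq {V W : Rep F d} (e : Iso V W) : V.cls = W.cls := cls_eq_iff.2 ⟨e⟩

theorem cls_out (V : IsoClass F d) : Rep.cls (Quotient.out V) = V := Quotient.out_eq V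

theorem dimVec_apply (V : Rep F d) (i : I) :
    V.dimVec i = (Module.finrank (extField F (d i)) (V.obj i) : ℤ) := rfl

theorem Iso.dimVec_eq {V W : Rep F d} (e : Iso V W) : V.dimVec = W.dimVec :=
  Finsupp.ext fun i => by rw [dimVec_apply, dimVec_apply, (e.equiv i).finrank_eq]

theorem dimVec_cls (V : Rep F d) : V.cls.dimVec = V.dimVec :=
  (cls_eq_iff.1 (cls_out V.cls)).elim fun e => e.dimVec_eq

/-- Conjugation identifies the sets of isomorphisms. -/
def Iso.congr {V V' W W' : Rep F d} (e : Iso V V') (f : Iso W W') : Iso V W ≃ Iso V' W' where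
  toFun g := (e.symm.trans g).trans f
  invFun g := (e.trans g).trans f.symm
  left_inv g := Iso.ext fun i y => by simp [Iso.trans, Iso.symm]
  right_inv g := Iso.ext fun i y => by simp [Iso.trans, Iso.symm]

theorem card_iso_of_cls_eq {V W : Rep F d} (h : V.cls = W.cls) :
    Nat.card (Iso V W) = V.cls.autCard := by
  obtain ⟨e⟩ := cls_eq_iff.1 (cls_out V.cls)
  obtain ⟨f⟩ := cls_eq_iff.1 h
  exact Nat.card_congr (Iso.congr e.symm (f.symm.trans e.symm))

theorem card_iso_of_cls_ne {V W : Rep F d} (h : V.cls ≠ W.cls) : Nat.card (Iso V W) = 0 := by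
  have : IsEmpty (Iso V W) := ⟨fun e => h e.cls_eq⟩
  exact Nat.card_of_isEmpty

theorem autCard_pos (hd : ∀ i, 0 < d i) (V : IsoClass F d) : 0 < V.autCard :=
  have := finite_iso hd (Quotient.out V) (Quotient.out V)
  have : Nonempty (Iso (Quotient.out V) (Quotient.out V)) := ⟨Iso.refl _⟩
  Nat.card_pos

/-- A surjective homomorphism with kernel `X` identifies `V / X` with its target. -/
def Sub.quotientIso {V W : Rep F d} (X : V.Sub) (g : ∀ i, V.obj i →ₗ[extField F (d i)] W.obj i)
    (hg : ∀ {i j : I} (a : i ⟶ j) (y : V.obj i), g j (V.map a y) = W.map a (g i y))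
    (hsurj : ∀ i, Function.Surjective (g i)) (hker : ∀ i y, g i y = 0 ↔ y ∈ X.carrier i) :
    Iso X.quotient W where
  equiv i := (Submodule.quotEquivOfEq _ _ (by
    ext y; exact (hker i y).symm)).trans ((g i).quotKerEquivOfSurjective (hsurj i))
  comm {i j} a y := by
    obtain ⟨y, rfl⟩ := (X.carrier i).mkQ_surjective y
    exact hg a y

/-- An injective homomorphism with image `X` identifies its source with `X`. -/
def Sub.toRepIso {V W : Rep F d} (X : V.Sub) (f : ∀ i, W.obj i →ₗ[extField F (d i)] V.obj i)
    (hf : ∀ {i j : I} (a : i ⟶ j) (y : W.obj i), f j (W.map a y) = V.map a (f i y))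
    (hinj : ∀ i, Function.Injective (f i)) (hrange : ∀ i, LinearMap.range (f i) = X.carrier i) :
    Iso W X.toRep where
  equiv i := (LinearEquiv.ofInjective (f i) (hinj i)).trans (LinearEquiv.ofEq _ _ (hrange i))
  comm a y := Subtype.ext (hf a y)

theorem Sub.dimVec_add {V : Rep F d} (X : V.Sub) :
    X.quotient.dimVec + X.toRep.dimVec = V.dimVec :=
  Finsupp.ext fun i => by
    rw [Finsupp.add_apply, dimVec_apply, dimVec_apply, dimVec_apply]
    exact_mod_cast (X.carrier i).finrank_quotient_add_finrank

/-- The image of a subrepresentation under an isomorphism. -/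
def Iso.mapSub {V W : Rep F d} (e : Iso V W) (X : V.Sub) : W.Sub where
  carrier i := (X.carrier i).map (e.equiv i : V.obj i →ₗ[extField F (d i)] W.obj i)
  map_mem {i j} a y hy := by
    obtain ⟨z, hz, rfl⟩ := hy
    exact ⟨V.map a z, X.map_mem a z hz, e.comm a z⟩

/-- An isomorphism induces a bijection between the subrepresentations. -/
def Iso.subEquiv {V W : Rep F d} (e : Iso V W) : V.Sub ≃ W.Sub where
  toFun := e.mapSub
  invFun := e.symm.mapSub
  left_inv X := Sub.ext fun i => by
    ext y; simp [Iso.mapSub, Iso.symm]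
  right_inv X := Sub.ext fun i => by
    ext y; simp [Iso.mapSub, Iso.symm]

theorem Iso.cls_mapSub {V W : Rep F d} (e : Iso V W) (X : V.Sub) :
    (e.mapSub X).toRep.cls = X.toRep.cls :=
  ((e.mapSub X).toRepIso (W := X.toRep)
    (fun i => (e.equiv i : V.obj i →ₗ[extField F (d i)] W.obj i).comp (X.carrier i).subtype)
    (fun a _ => e.comm a _)
    (fun i => (e.equiv i).injective.comp Subtype.val_injective)
    (fun i => (LinearMap.range_comp (X.carrier i).subtype
      (e.equiv i : V.obj i →ₗ[extField F (d i)] W.obj i)).trans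
        (congrArg _ (X.carrier i).range_subtype))).cls_eq.symm

theorem Iso.cls_quotient_mapSub {V W : Rep F d} (e : Iso V W) (X : V.Sub) :
    (e.mapSub X).quotient.cls = X.quotient.cls :=
  (X.quotientIso (W := (e.mapSub X).quotient)
    (fun i => ((e.mapSub X).carrier i).mkQ.comp
      (e.equiv i : V.obj i →ₗ[extField F (d i)] W.obj i))
    (fun {i j} a y => congrArg ((e.mapSub X).carrier j).mkQ (e.comm a y))
    (fun i => ((e.mapSub X).carrier i).mkQ_surjective.comp (e.equiv i).surjective)
    (fun i y => by
      refine (Submodule.Quotient.mk_eq_zero ((e.mapSub X).carrier i)).trans ?_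
      exact ⟨fun ⟨z, hz, h⟩ => (e.equiv i).injective h ▸ hz, fun h => ⟨y, h, rfl⟩⟩)).cls_eq.symm

/-- Sums over the subrepresentations only depend on the isomorphism class. -/
theorem Iso.sum_sub {M : Type*} [AddCommMonoid M] {V W : Rep F d} [Fintype V.Sub] [Fintype W.Sub]
    (e : Iso V W) (f : IsoClass F d → IsoClass F d → M) :
    ∑ X : V.Sub, f X.quotient.cls X.toRep.cls = ∑ X : W.Sub, f X.quotient.cls X.toRep.cls :=
  Fintype.sum_equiv e.subEquiv _ _ fun X => by
    change _ = f (e.mapSub X).quotient.cls (e.mapSub X).toRep.cls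
    rw [e.cls_mapSub, e.cls_quotient_mapSub]

/-- Subrepresentations of `V / X` correspond to the subrepresentations of `V` containing `X`. -/
def Sub.quotientSubEquiv {V : Rep F d} (X : V.Sub) :
    {Y : V.Sub // ∀ i, X.carrier i ≤ Y.carrier i} ≃ X.quotient.Sub where
  toFun Y :=
    { carrier := fun i => (Y.1.carrier i).map (X.carrier i).mkQ
      map_mem := by
        rintro i j a _ ⟨y, hy, rfl⟩
        exact ⟨V.map a y, Y.1.map_mem a y hy, rfl⟩ }
  invFun Z :=
    ⟨{ carrier := fun i => (Z.carrier i).comap (X.carrier i).mkQ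
       map_mem := fun {i j} a y hy => Z.map_mem a ((X.carrier i).mkQ y) hy },
      fun i y hy => by
        have h : (X.carrier i).mkQ y = 0 := (Submodule.Quotient.mk_eq_zero (X.carrier i)).2 hy
        change (X.carrier i).mkQ y ∈ Z.carrier i
        exact h ▸ (Z.carrier i).zero_mem⟩
  left_inv Y := Subtype.ext <| Sub.ext fun i => by
    change ((Y.1.carrier i).map (X.carrier i).mkQ).comap (X.carrier i).mkQ = _
    rw [Submodule.comap_map_mkQ, sup_eq_right.2 (Y.2 i)]
  right_inv Z := Sub.ext fun i =>
    Submodule.map_comap_eq_of_surjective (X.carrier i).mkQ_surjective _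

/-- Third isomorphism theorem: the composite V → V/X → (V/X)/(Y/X) is surjective with kernel Y. -/
theorem Sub.cls_quotientSubEquiv_quotient {V : Rep F d} (X : V.Sub)
    (Y : {Y : V.Sub // ∀ i, X.carrier i ≤ Y.carrier i}) :
    (X.quotientSubEquiv Y).quotient.cls = Y.1.quotient.cls :=
  (Y.1.quotientIso (W := (X.quotientSubEquiv Y).quotient)
    (fun i => ((X.quotientSubEquiv Y).carrier i).mkQ.comp (X.carrier i).mkQ)
    (fun _ _ => rfl)
    (fun i => ((X.quotientSubEquiv Y).carrier i).mkQ_surjective.comp (X.carrier i).mkQ_surjective)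
    (fun i y => by
      refine (Submodule.Quotient.mk_eq_zero ((X.quotientSubEquiv Y).carrier i)).trans ?_
      change y ∈ ((Y.1.carrier i).map (X.carrier i).mkQ).comap (X.carrier i).mkQ ↔ _
      rw [Submodule.comap_map_mkQ, sup_eq_right.2 (Y.2 i)])).cls_eq.symm

/-- The projection V → V/X restricts to a surjection from Y onto its image, and the kernel of this
restriction is X. -/
theorem Sub.cls_quotientSubEquiv {V : Rep F d} (X : V.Sub)
    (Y : {Y : V.Sub // ∀ i, X.carrier i ≤ Y.carrier i}) :
    (X.quotientSubEquiv Y).toRep.cls = (X.within Y.1).quotient.cls :=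
  ((X.within Y.1).quotientIso (W := (X.quotientSubEquiv Y).toRep)
    (fun i => ((X.carrier i).mkQ.restrict (p := Y.1.carrier i)
      (q := (X.quotientSubEquiv Y).carrier i) fun y hy => ⟨y, hy, rfl⟩))
    (fun _ _ => rfl)
    (fun i => by
      rintro ⟨_, y, hy, rfl⟩
      exact ⟨⟨y, hy⟩, rfl⟩)
    (fun i y => by
      refine Subtype.ext_iff.trans ?_
      exact Submodule.Quotient.mk_eq_zero (X.carrier i))).cls_eq.symm

/-- Subrepresentations of `Y` correspond to the subrepresentations of `V` contained in `Y`. -/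
def Sub.subEquiv {V : Rep F d} (Y : V.Sub) :
    {X : V.Sub // ∀ i, X.carrier i ≤ Y.carrier i} ≃ Y.toRep.Sub where
  toFun X := X.1.within Y
  invFun Z :=
    ⟨{ carrier := fun i => (Z.carrier i).map (Y.carrier i).subtype
       map_mem := by
        rintro i j a _ ⟨y, hy, rfl⟩
        exact ⟨_, Z.map_mem a y hy, rfl⟩ }, fun i => Submodule.map_subtype_le _ _⟩
  left_inv X := Subtype.ext <| Sub.ext fun i => by
    change ((X.1.carrier i).comap (Y.carrier i).subtype).map (Y.carrier i).subtype = _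
    rw [Submodule.map_comap_subtype, inf_eq_right.2 (X.2 i)]
  right_inv Z := Sub.ext fun i =>
    Submodule.comap_map_eq_of_injective Subtype.val_injective _

theorem Sub.cls_within {V : Rep F d} {X Y : V.Sub} (h : ∀ i, X.carrier i ≤ Y.carrier i) :
    (X.within Y).toRep.cls = X.toRep.cls :=
  ((X.within Y).toRepIso (W := X.toRep)
    (fun i => Submodule.inclusion (h i))
    (fun _ _ => rfl)
    (fun i => Submodule.inclusion_injective (h i))
    (fun i => Submodule.range_inclusion _ _ (h i))).cls_eq.symm

end Rep
end ValuedQuiver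

end

/-! ### Semilinear maps, cocycles, and extensions as split short exact sequences. -/

section

namespace ValuedQuiver
variable {F : Type u} [Field F] [Finite F] {I : Type w} [Quiver.{x + 1} I] {d : I → ℕ}
namespace Rep

/-- The additive maps `U_i → W_j` that are linear over `F_{gcd (d_i, d_j)}`. -/
def SLin (U W : Rep F d) (i j : I) : AddSubgroup (U.obj i →+ W.obj j) where
  carrier := {f | ∀ (c : extField F (Nat.gcd (d i) (d j))) (y : U.obj i),
    f ((⟨c, extField_le F (Nat.gcd_dvd_left _ _) c.2⟩ : extField F (d i)) • y) =
      (⟨c, extField_le F (Nat.gcd_dvd_right _ _) c.2⟩ : extField F (d j)) • f y}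
  zero_mem' c y := (smul_zero _).symm
  add_mem' {f g} hf hg c y := by
    change f _ + g _ = _ • (f y + g y)
    rw [hf c y, hg c y, smul_add]
  neg_mem' {f} hf c y := by
    change -f _ = _ • (-f y)
    rw [hf c y, smul_neg]

instance (U W : Rep F d) (i j : I) : CoeFun (SLin U W i j) fun _ => U.obj i → W.obj j :=
  ⟨fun f => f.1⟩

namespace SLin

variable {U U' W W' : Rep F d} {i j : I}

theorem ext {f g : SLin U W i j} (h : ∀ y, f y = g y) : f = g :=
  Subtype.ext (AddMonoidHom.ext h)

theorem add_apply (f g : SLin U W i j) (y : U.obj i) : (f + g) y = f y + g y := rfl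
theorem map_add (f : SLin U W i j) (y z : U.obj i) : f (y + z) = f y + f z := f.1.map_add y z
theorem map_zero (f : SLin U W i j) : f 0 = 0 := f.1.map_zero

/-- Composition with linear maps on both sides. -/
def conj (q : W.obj j →ₗ[extField F (d j)] W'.obj j) (f : SLin U W i j)
    (p : U'.obj i →ₗ[extField F (d i)] U.obj i) : SLin U' W' i j :=
  ⟨(q.toAddMonoidHom.comp f.1).comp p.toAddMonoidHom, fun c y => by
    change q (f.1 (p _)) = _ • q (f.1 (p y))
    rw [p.map_smul, f.2, q.map_smul]⟩

/-- The map of a representation along an arrow. -/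
def ofArrow (U : Rep F d) (a : i ⟶ j) : SLin U U i j := ⟨U.map a, U.map_smul a⟩

/-- A semilinear map `U_i → W_i` is linear. -/
def linear (f : SLin U W i i) : U.obj i →ₗ[extField F (d i)] W.obj i where
  toFun := f.1
  map_add' := f.1.map_add
  -- For i = j the common subfield has degree gcd(d_i, d_i) = d_i, so it is the whole field.
  map_smul' c := f.2 ⟨c, by rw [Nat.gcd_self]; exact c.2⟩

/-- A linear map `U_i → W_i` as a semilinear map. -/
def ofLinear (f : U.obj i →ₗ[extField F (d i)] W.obj i) : SLin U W i i :=
  ⟨f.toAddMonoidHom, fun _ y => f.map_smul _ y⟩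

end SLin

/-- Families of semilinear maps `U_{s e} → W_{t e}`. -/
abbrev FamHom {K : Type*} (s t : K → I) (U W : Rep F d) := ∀ e : K, SLin U W (s e) (t e)

/-- Families of semilinear maps indexed by the arrows. -/
abbrev Cocycle (U W : Rep F d) := FamHom (Quiver.Total.left (V := I)) Quiver.Total.right U W

/-- Families of linear maps indexed by the vertices. -/
abbrev GradedHom (U W : Rep F d) := FamHom (fun i : I => i) (fun i => i) U W

/-- The extension of `U` by `W` given by a cocycle. -/
@[reducible] def extension {U W : Rep F d} (c : Cocycle U W) : Rep F d where
  obj i := U.obj i × W.obj i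
  finite_support := (U.finite_support.union W.finite_support).subset fun i hi => by
    by_contra hn
    rw [Set.mem_union, not_or] at hn
    have := U.subsingleton_of_notMem hn.1
    have := W.subsingleton_of_notMem hn.2
    exact not_nontrivial _ hi
  map {i j} a :=
    { toFun := fun y => (U.map a y.1, c ⟨i, j, a⟩ y.1 + W.map a y.2)
      map_zero' := by
        ext <;> simp [SLin.map_zero]
      map_add' := fun y z => by
        ext
        · simp
        · simp only [Prod.fst_add, Prod.snd_add, _root_.map_add]; abel }
  map_smul {i j} a k y := by
    ext
    · exact U.map_smul a k y.1
    · exact (congrArg₂ (· + ·) ((c ⟨i, j, a⟩).2 k y.1) (W.map_smul a k y.2)).trans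
        (smul_add _ _ _).symm

theorem extension_map {U W : Rep F d} (c : Cocycle U W) {i j : I} (a : i ⟶ j)
    (y : U.obj i × W.obj i) :
    (extension c).map a y = (U.map a y.1, c ⟨i, j, a⟩ y.1 + W.map a y.2) := rfl

theorem dimVec_extension {U W : Rep F d} (c : Cocycle U W) :
    (extension c).dimVec = U.dimVec + W.dimVec :=
  Finsupp.ext fun i => by
    rw [Finsupp.add_apply, dimVec_apply, dimVec_apply, dimVec_apply]
    exact_mod_cast Module.finrank_prod

section Splitting

variable {U W V : Rep F d}

/-- The underlying linear maps already determine the cocycle: transporting the action of an arrow on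
(y, 0) from V back to the extension, its second component is the value of the cocycle at y. -/
theorem sigma_iso_ext {p p' : Σ c : Cocycle U W, Iso (extension c) V}
    (h : ∀ i y, p.2.equiv i y = p'.2.equiv i y) : p = p' := by
  obtain ⟨c, e⟩ := p
  obtain ⟨c', e'⟩ := p'
  have hc : c = c' := by
    funext ⟨i, j, a⟩
    refine SLin.ext fun y => ?_
    have h1 : e'.equiv j (U.map a y, c ⟨i, j, a⟩ y + W.map a 0) =
        e'.equiv j (U.map a y, c' ⟨i, j, a⟩ y + W.map a 0) := by
      rw [← h]
      exact (e.comm a (y, 0)).trans ((congrArg (V.map a) (h i (y, 0))).trans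
        (e'.comm a (y, 0)).symm)
    exact add_right_cancel (congrArg Prod.snd ((e'.equiv j).injective h1))
  subst hc
  rw [show e = e' from Iso.ext h]

/-- A family of linear bijections `U_i × W_i → V_i` that is compatible with a subrepresentation `W`
and a quotient `U` of `V` is an isomorphism from an extension to `V`. -/
def splitIso (φ : ∀ i, (U.obj i × W.obj i) ≃ₗ[extField F (d i)] V.obj i)
    (h₁ : ∀ {i j : I} (a : i ⟶ j) (y : W.obj i), V.map a (φ i (0, y)) = φ j (0, W.map a y))
    (h₂ : ∀ {i j : I} (a : i ⟶ j) (y : U.obj i),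
      ((φ j).symm (V.map a (φ i (y, 0)))).1 = U.map a y) :
    Σ c : Cocycle U W, Iso (extension c) V :=
  -- The cocycle is the one off-diagonal block of the arrow in the coordinates φ: include U, act in
  -- V, and take the W-component.
  ⟨fun e => SLin.conj ((LinearMap.snd _ _ _).comp (φ e.right).symm.toLinearMap)
      (SLin.ofArrow V e.hom) ((φ e.left).toLinearMap.comp (LinearMap.inl _ _ _)),
    { equiv := φ
      comm := fun {i j} a y => by
        rw [← (φ j).eq_symm_apply]
        have h3 : V.map a (φ i y) = V.map a (φ i (y.1, 0)) + V.map a (φ i (0, y.2)) := by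
          rw [← _root_.map_add, ← _root_.map_add]; simp
        rw [h3, _root_.map_add, h₁, LinearEquiv.symm_apply_apply]
        refine Prod.ext ?_ ?_
        · rw [Prod.fst_add, h₂]; exact (add_zero _).symm
        · rfl }⟩

variable (U W V) in
/-- The set of pairs of a subrepresentation `X ≅ W` of `V` and an isomorphism `V / X ≅ U`. -/
abbrev ShortExact := Σ X : V.Sub, Iso W X.toRep × Iso X.quotient U

namespace ShortExact

/-- The inclusion. -/
def incl (p : ShortExact U W V) (i : I) : W.obj i →ₗ[extField F (d i)] V.obj i :=
  (p.1.carrier i).subtype.comp (p.2.1.equiv i).toLinearMap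

/-- The projection. -/
def proj (p : ShortExact U W V) (i : I) : V.obj i →ₗ[extField F (d i)] U.obj i :=
  (p.2.2.equiv i).toLinearMap.comp (p.1.carrier i).mkQ

theorem incl_comm (p : ShortExact U W V) {i j : I} (a : i ⟶ j) (y : W.obj i) :
    p.incl j (W.map a y) = V.map a (p.incl i y) :=
  congrArg (p.1.carrier j).subtype (p.2.1.comm a y)

theorem proj_comm (p : ShortExact U W V) {i j : I} (a : i ⟶ j) (y : V.obj i) :
    p.proj j (V.map a y) = U.map a (p.proj i y) :=
  p.2.2.comm a ((p.1.carrier i).mkQ y)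

theorem incl_injective (p : ShortExact U W V) (i : I) : Function.Injective (p.incl i) :=
  (p.1.carrier i).injective_subtype.comp (p.2.1.equiv i).injective

theorem proj_surjective (p : ShortExact U W V) (i : I) : Function.Surjective (p.proj i) :=
  (p.2.2.equiv i).surjective.comp (p.1.carrier i).mkQ_surjective

theorem range_incl (p : ShortExact U W V) (i : I) :
    LinearMap.range (p.incl i) = p.1.carrier i :=
  (LinearMap.range_comp_of_range_eq_top _ (p.2.1.equiv i).range).trans
    (p.1.carrier i).range_subtype

theorem proj_eq_zero (p : ShortExact U W V) (i : I) (y : V.obj i) :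
    p.proj i y = 0 ↔ y ∈ p.1.carrier i :=
  ((p.2.2.equiv i).map_eq_zero_iff).trans (Submodule.Quotient.mk_eq_zero _)

theorem proj_incl (p : ShortExact U W V) (i : I) (y : W.obj i) : p.proj i (p.incl i y) = 0 :=
  (p.proj_eq_zero i _).2 (p.range_incl i ▸ LinearMap.mem_range_self _ y)

theorem ext {p p' : ShortExact U W V} (h₁ : ∀ i y, p.incl i y = p'.incl i y)
    (h₂ : ∀ i y, p.proj i y = p'.proj i y) : p = p' := by
  have h : p.1 = p'.1 := Sub.ext fun i => by
    rw [← p.range_incl, ← p'.range_incl, LinearMap.ext (h₁ i)]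
  obtain ⟨X, e, f⟩ := p
  obtain ⟨X', e', f'⟩ := p'
  obtain rfl : X = X' := h
  have he : e = e' := Iso.ext fun i y => Subtype.ext (h₁ i y)
  have hf : f = f' := Iso.ext fun i y => by
    obtain ⟨y, rfl⟩ := (X.carrier i).mkQ_surjective y
    exact h₂ i y
  rw [he, hf]

/-- A family of linear sections of the projection. -/
def sec (p : ShortExact U W V) (i : I) : U.obj i →ₗ[extField F (d i)] V.obj i :=
  Classical.choose ((p.proj i).exists_rightInverse_of_surjective
    (LinearMap.range_eq_top.2 (p.proj_surjective i)))

theorem proj_sec (p : ShortExact U W V) (i : I) (y : U.obj i) : p.proj i (p.sec i y) = y :=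
  LinearMap.congr_fun (Classical.choose_spec ((p.proj i).exists_rightInverse_of_surjective
    (LinearMap.range_eq_top.2 (p.proj_surjective i)))) y

/-- The linear map `U_i × W_i → V_i` given by the inclusion and a section. -/
def splitMap (p : ShortExact U W V) (S : GradedHom U W) (i : I) :
    (U.obj i × W.obj i) →ₗ[extField F (d i)] V.obj i :=
  (p.sec i + (p.incl i).comp (SLin.linear (S i))).coprod (p.incl i)

theorem splitMap_apply (p : ShortExact U W V) (S : GradedHom U W) (i : I)
    (y : U.obj i × W.obj i) :
    p.splitMap S i y = p.sec i y.1 + p.incl i (S i y.1) + p.incl i y.2 := rfl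

theorem proj_splitMap (p : ShortExact U W V) (S : GradedHom U W) (i : I)
    (y : U.obj i × W.obj i) : p.proj i (p.splitMap S i y) = y.1 := by
  rw [splitMap_apply, map_add, map_add, proj_sec, proj_incl, proj_incl, add_zero, add_zero]

/-- The projection recovers the first coordinate, and the inclusion is injective on the second.
Conversely, subtracting the lift of its projection from a vector leaves an element of the kernel,
which is the image of the inclusion. -/
theorem splitMap_bijective (p : ShortExact U W V) (S : GradedHom U W) (i : I) :
    Function.Bijective (p.splitMap S i) := by
  constructor
  · rw [injective_iff_map_eq_zero]
    intro y hy
    have h1 : y.1 = 0 := by rw [← p.proj_splitMap S, hy, map_zero]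
    rw [splitMap_apply, h1, SLin.map_zero, map_zero, map_zero, zero_add, zero_add] at hy
    exact Prod.ext h1 (p.incl_injective i (hy.trans (map_zero _).symm))
  · intro v
    have h : p.proj i (v - p.splitMap S i (p.proj i v, 0)) = 0 := by
      rw [map_sub, proj_splitMap, sub_self]
    rw [proj_eq_zero, ← range_incl] at h
    obtain ⟨y, hy⟩ := h
    refine ⟨(p.proj i v, y), ?_⟩
    rw [splitMap_apply, hy, splitMap_apply, map_zero, add_zero, add_sub_cancel]

/-- The linear bijection `U_i × W_i → V_i` given by the inclusion and a section. -/
def splitEquiv (p : ShortExact U W V) (S : GradedHom U W) (i : I) :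
    (U.obj i × W.obj i) ≃ₗ[extField F (d i)] V.obj i :=
  LinearEquiv.ofBijective _ (p.splitMap_bijective S i)

theorem splitEquiv_apply (p : ShortExact U W V) (S : GradedHom U W) (i : I)
    (y : U.obj i × W.obj i) :
    p.splitEquiv S i y = p.sec i y.1 + p.incl i (S i y.1) + p.incl i y.2 := rfl

theorem fst_splitEquiv_symm (p : ShortExact U W V) (S : GradedHom U W) (i : I) (v : V.obj i) :
    ((p.splitEquiv S i).symm v).1 = p.proj i v := by
  conv_rhs => rw [← (p.splitEquiv S i).apply_symm_apply v]
  exact (p.proj_splitMap S i _).symm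

/-- The isomorphism from an extension to `V` given by a short exact sequence and a splitting. -/
def toSigmaIso (q : ShortExact U W V × GradedHom U W) :
    Σ c : Cocycle U W, Iso (extension c) V :=
  splitIso (q.1.splitEquiv q.2)
    (fun a y => by
      rw [splitEquiv_apply, splitEquiv_apply]
      simp only [_root_.map_zero, zero_add, incl_comm])
    (fun a y => by
      rw [fst_splitEquiv_symm, proj_comm]
      exact congrArg _ (q.1.proj_splitMap q.2 _ _))

theorem toSigmaIso_equiv (q : ShortExact U W V × GradedHom U W) (i : I)
    (y : U.obj i × W.obj i) : (toSigmaIso q).2.equiv i y =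
      q.1.sec i y.1 + q.1.incl i (q.2 i y.1) + q.1.incl i y.2 := rfl

/-- This is the double count behind Riedtmann's formula. With one linear section fixed for each
short exact sequence, all its sections differ from that one by a `GradedHom`; a short exact sequence
with a section is the same as an isomorphism from an extension to V. -/
theorem toSigmaIso_bijective : Function.Bijective (toSigmaIso (U := U) (W := W) (V := V)) := by
  constructor
  · rintro ⟨p, S⟩ ⟨p', S'⟩ h
    have h1 : ∀ i y, p.splitMap S i y = p'.splitMap S' i y := fun i y =>
      show (toSigmaIso (p, S)).2.equiv i y = (toSigmaIso (p', S')).2.equiv i y by rw [h]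
    have hincl : ∀ i y, p.incl i y = p'.incl i y := fun i y => by
      have := h1 i (0, y)
      simpa only [splitMap_apply, SLin.map_zero, _root_.map_zero, zero_add] using this
    obtain rfl : p = p' := ext hincl fun i v => by
      obtain ⟨y, rfl⟩ := (p.splitMap_bijective S i).2 v
      rw [proj_splitMap, h1, proj_splitMap]
    have hS : S = S' := funext fun i => SLin.ext fun y => by
      have := h1 i (y, 0)
      rw [splitMap_apply, splitMap_apply] at this
      exact p.incl_injective i (add_left_cancel (add_right_cancel this))
    rw [hS]
  · rintro ⟨c, e⟩
    -- For surjectivity, an isomorphism e from an extension gives the subrepresentation e(0 × W) and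
    -- the projection that takes the first coordinate of the inverse of e.
    let φ : ∀ i, (U.obj i × W.obj i) ≃ₗ[extField F (d i)] V.obj i := e.equiv
    have hφ : ∀ {i j : I} (a : i ⟶ j) (y : U.obj i × W.obj i),
      φ j (U.map a y.1, c ⟨i, j, a⟩ y.1 + W.map a y.2) = V.map a (φ i y) := e.comm
    let f : ∀ i, W.obj i →ₗ[extField F (d i)] V.obj i := fun i =>
      (φ i).toLinearMap.comp (LinearMap.inr _ _ _)
    have hf : ∀ i y, f i y = φ i (0, y) := fun _ _ => rfl
    let g : ∀ i, V.obj i →ₗ[extField F (d i)] U.obj i := fun i =>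
      (LinearMap.fst _ _ _).comp (φ i).symm.toLinearMap
    have hg : ∀ i v, g i v = ((φ i).symm v).1 := fun _ _ => rfl
    have hfc : ∀ {i j : I} (a : i ⟶ j) (y : W.obj i), f j (W.map a y) = V.map a (f i y) :=
      fun a y => by
        rw [hf, hf, ← hφ]
        simp only [_root_.map_zero, zero_add]
    let X : V.Sub :=
      { carrier := fun i => LinearMap.range (f i)
        map_mem := by
          rintro i j a _ ⟨y, rfl⟩
          exact ⟨W.map a y, hfc a y⟩ }
    let e₁ : Iso W X.toRep := X.toRepIso f hfc
      (fun i => (φ i).injective.comp (LinearMap.inr_injective (R := extField F (d i)))) (fun i => rfl)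
    let e₂ : Iso X.quotient U := X.quotientIso g
      (fun {i j} a v => by
        obtain ⟨y, rfl⟩ := (φ i).surjective v
        rw [← hφ, hg, hg, LinearEquiv.symm_apply_apply, LinearEquiv.symm_apply_apply])
      (fun i => Prod.fst_surjective.comp (φ i).symm.surjective)
      (fun i v => by
        obtain ⟨y, rfl⟩ := (φ i).surjective v
        rw [hg, LinearEquiv.symm_apply_apply]
        constructor
        · rintro h
          exact ⟨y.2, congrArg (φ i) (Prod.ext h.symm rfl)⟩
        · rintro ⟨z, hz⟩
          exact (congrArg Prod.fst ((φ i).injective hz)).symm)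
    let p : ShortExact U W V := ⟨X, e₁, e₂⟩
    have hpi : ∀ i y, p.incl i y = φ i (0, y) := fun _ _ => rfl
    have hpp : ∀ i v, p.proj i v = ((φ i).symm v).1 := fun _ _ => rfl
    -- The section y ↦ φ(y, 0) and the chosen section have the same projection, so their difference
    -- lies in the image of W; `S` is this difference read in W.
    let S : GradedHom U W := fun i => SLin.ofLinear <|
      (LinearMap.snd _ _ _).comp ((φ i).symm.toLinearMap.comp
        ((φ i).toLinearMap.comp (LinearMap.inl _ _ _) - p.sec i))
    have hS : ∀ i y, S i y = ((φ i).symm (φ i (y, 0) - p.sec i y)).2 := fun _ _ => rfl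
    refine ⟨(p, S), sigma_iso_ext fun i y => ?_⟩
    rw [toSigmaIso_equiv]
    change p.sec i y.1 + p.incl i (S i y.1) + p.incl i y.2 = φ i y
    rw [hpi, hpi, hS]
    have h0 : ((φ i).symm (φ i (y.1, 0) - p.sec i y.1)).1 = 0 := by
      rw [← hpp, map_sub, proj_sec, hpp, LinearEquiv.symm_apply_apply, sub_self]
    have h1 : φ i (0, ((φ i).symm (φ i (y.1, 0) - p.sec i y.1)).2) =
        φ i (y.1, 0) - p.sec i y.1 := by
      rw [← h0]; exact (φ i).apply_symm_apply _
    rw [h1, add_sub_cancel, ← map_add]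
    simp

end ShortExact

end Splitting

end Rep
end ValuedQuiver

end

/-! ### Powers of v, the bilinear forms, and cardinalities of spaces of maps. -/

section

namespace ValuedQuiver

section Exponents

variable (F : Type u) [Field F] [Finite F]

theorem vHalfPow_base_ne_zero : ((√(√(Nat.card F : ℝ)) : ℝ) : ℂ) ≠ 0 := by
  have : (0 : ℝ) < Nat.card F := by exact_mod_cast Nat.card_pos
  exact_mod_cast (Real.sqrt_pos.2 (Real.sqrt_pos.2 this)).ne'

theorem vHalfPow_add (m n : ℤ) : vHalfPow F (m + n) = vHalfPow F m * vHalfPow F n :=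
  zpow_add₀ (vHalfPow_base_ne_zero F) m n

theorem vHalfPow_zero : vHalfPow F 0 = 1 := zpow_zero _

theorem vHalfPow_ne_zero (n : ℤ) : vHalfPow F n ≠ 0 := zpow_ne_zero _ (vHalfPow_base_ne_zero F)

theorem vHalfPow_neg (n : ℤ) : vHalfPow F (-n) = (vHalfPow F n)⁻¹ := zpow_neg _ n

/-- The base of `vHalfPow` is the fourth root of |F|, hence the factor 4. -/
theorem card_pow_eq_vHalfPow (n : ℕ) : ((Nat.card F ^ n : ℕ) : ℂ) = vHalfPow F (4 * n) := by
  have h : ((√(√(Nat.card F : ℝ)) : ℝ) : ℂ) ^ 4 = (Nat.card F : ℂ) := by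
    rw [← Complex.ofReal_pow, show (4 : ℕ) = 2 * 2 from rfl, pow_mul,
      Real.sq_sqrt (Real.sqrt_nonneg _), Real.sq_sqrt (Nat.cast_nonneg _), Complex.ofReal_natCast]
  rw [vHalfPow, zpow_mul, zpow_natCast, Nat.cast_pow, ← h]
  norm_cast

end Exponents

section Bilinear

variable {I : Type w}

/-- The bilinear form on the root lattice with given values on simple roots. -/
def bilin (c : I → I → ℤ) (a b : I →₀ ℤ) : ℤ :=
  a.sum fun i m => b.sum fun j n => m * n * c i j

variable (c : I → I → ℤ)

theorem bilin_add_left (a a' b : I →₀ ℤ) : bilin c (a + a') b = bilin c a b + bilin c a' b := by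
  refine Finsupp.sum_add_index' (fun i => ?_) fun i m m' => ?_
  · simp
  · rw [← Finsupp.sum_add]
    exact Finset.sum_congr rfl fun j _ => by ring

theorem bilin_add_right (a b b' : I →₀ ℤ) : bilin c a (b + b') = bilin c a b + bilin c a b' := by
  rw [bilin, bilin, bilin, ← Finsupp.sum_add]
  refine Finset.sum_congr rfl fun i _ => Finsupp.sum_add_index' (fun j => ?_) fun j n n' => ?_
  · simp
  · ring

theorem bilin_zero_left (b : I →₀ ℤ) : bilin c 0 b = 0 := Finsupp.sum_zero_index

theorem bilin_zero_right (a : I →₀ ℤ) : bilin c a 0 = 0 := by simp [bilin]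

theorem bilin_neg_left (a b : I →₀ ℤ) : bilin c (-a) b = -bilin c a b := by
  rw [eq_neg_iff_add_eq_zero, ← bilin_add_left, neg_add_cancel, bilin_zero_left]

theorem bilin_neg_right (a b : I →₀ ℤ) : bilin c a (-b) = -bilin c a b := by
  rw [eq_neg_iff_add_eq_zero, ← bilin_add_right, neg_add_cancel, bilin_zero_right]

theorem bilin_single (i j : I) (m n : ℤ) :
    bilin c (Finsupp.single i m) (Finsupp.single j n) = m * n * c i j := by
  simp [bilin]

theorem bilin_sub_coeff (c c' : I → I → ℤ) (a b : I →₀ ℤ) :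
    bilin (fun i j => c i j - c' i j) a b = bilin c a b - bilin c' a b := by
  simp only [bilin, Finsupp.sum, mul_sub, Finset.sum_sub_distrib]

theorem bilin_add_coeff (c c' : I → I → ℤ) (a b : I →₀ ℤ) :
    bilin (fun i j => c i j + c' i j) a b = bilin c a b + bilin c' a b := by
  simp only [bilin, Finsupp.sum, mul_add, Finset.sum_add_distrib]

theorem bilin_swap (c : I → I → ℤ) (a b : I →₀ ℤ) :
    bilin (fun i j => c j i) a b = bilin c b a := by
  simp only [bilin, Finsupp.sum]
  rw [Finset.sum_comm]
  exact Finset.sum_congr rfl fun i _ => Finset.sum_congr rfl fun j _ => by ring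

end Bilinear

/-- The standing assumptions: a locally finite acyclic quiver and positive valuations. -/
class IsAdmissible (I : Type w) [Quiver.{x + 1} I] (d : I → ℕ) : Prop where
  locallyFinite : ∀ i : I, Finite (Quiver.Star i) ∧ Finite (Quiver.Costar i)
  acyclic : IsAcyclic I
  pos : ∀ i, 0 < d i

variable {F : Type u} [Field F] [Finite F] {I : Type w} [Quiver.{x + 1} I] {d : I → ℕ}

section Forms

variable (d)

open Classical in
/-- The form `∑ d_i a_i b_i` on the root lattice. -/
def homForm (a b : I →₀ ℤ) : ℤ := bilin (fun i j => if i = j then (d i : ℤ) else 0) a b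

theorem finite_hom [h : IsAdmissible I d] (i j : I) : Finite (i ⟶ j) :=
  have := (h.locallyFinite i).1
  Finite.of_injective (fun a => (⟨j, a⟩ : Quiver.Star i)) fun a b hab => by
    simpa using hab

/-- An arrow back would close an oriented cycle of length two. The case i = j is included and
excludes loops, since a loop can be traversed twice. -/
theorem card_hom_eq_zero_of_path [h : IsAdmissible I d] {i j : I} (a : i ⟶ j) :
    Nat.card (j ⟶ i) = 0 := by
  have : IsEmpty (j ⟶ i) := ⟨fun b => by
    have := h.acyclic i ((Quiver.Path.nil.cons a).cons b)
    simp at this⟩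
  exact Nat.card_of_isEmpty

/-- Here d_i · d_j / gcd(d_i, d_j) is the lcm, and by acyclicity arrows run in at most one direction
between two vertices, so the maximum with 0 retains the arrows from i to j. The two terms are the
dimensions over F of the vertexwise maps and of the cocycles. -/
theorem euler_eq [IsAdmissible I d] (a b : I →₀ ℤ) : euler d a b = homForm d a b -
    bilin (fun i j => (Nat.card (i ⟶ j) : ℤ) * (Nat.lcm (d i) (d j) : ℤ)) a b := by
  rw [homForm, ← bilin_sub_coeff]
  change bilin (eulerSimple d) a b = _
  congr 1
  funext i j
  by_cases hij : i = j
  · subst hij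
    have h0 : Nat.card (i ⟶ i) = 0 := by
      by_contra hne
      have : Nonempty (i ⟶ i) := by
        by_contra he
        rw [not_nonempty_iff] at he
        exact hne Nat.card_of_isEmpty
      exact hne (this.elim fun a => card_hom_eq_zero_of_path d a)
    simp [eulerSimple, h0]
  · rw [eulerSimple, if_neg hij, if_neg hij, zero_sub, neg_inj, adjEntry]
    have hl : (d i : ℤ) * ((d j / Nat.gcd (d i) (d j) : ℕ) : ℤ) = Nat.lcm (d i) (d j) := by
      rw [← Nat.cast_mul, Nat.lcm, Nat.mul_div_assoc _ (Nat.gcd_dvd_right _ _)]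
    rw [mul_left_comm, hl]
    rcases isEmpty_or_nonempty (i ⟶ j) with he | ⟨⟨a⟩⟩
    · rw [Nat.card_of_isEmpty, Nat.cast_zero, zero_sub, zero_mul]
      exact max_eq_right (mul_nonpos_of_nonpos_of_nonneg (by simp) (Nat.cast_nonneg _))
    · rw [card_hom_eq_zero_of_path d a, Nat.cast_zero, sub_zero]
      exact max_eq_left (by positivity)

/-- The numbers x = d_i b_ij are antisymmetric in i and j, and |x| = max(x, 0) + max(-x, 0). -/
theorem symForm_eq (a b : I →₀ ℤ) : symForm d a b = euler d a b + euler d b a := by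
  have : symForm d a b = bilin (fun i j => eulerSimple d i j + eulerSimple d j i) a b := by
    change bilin (fun i j => (d i : ℤ) * cartanEntry d i j) a b = _
    congr 1
    funext i j
    by_cases hij : i = j
    · subst hij
      simp [eulerSimple, cartanEntry]; ring
    · rw [eulerSimple, eulerSimple, cartanEntry, if_neg hij, if_neg hij, if_neg (Ne.symm hij)]
      have h : (d j : ℤ) * adjEntry d j i = -((d i : ℤ) * adjEntry d i j) := by
        have hl : (d i : ℤ) * ((d j / Nat.gcd (d i) (d j) : ℕ) : ℤ) =
            (d j : ℤ) * ((d i / Nat.gcd (d j) (d i) : ℕ) : ℤ) := by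
          rw [← Nat.cast_mul, ← Nat.cast_mul, ← Nat.mul_div_assoc _ (Nat.gcd_dvd_right _ _),
            ← Nat.mul_div_assoc _ (Nat.gcd_dvd_right _ _), mul_comm (d j), Nat.gcd_comm]
        rw [adjEntry, adjEntry]
        linear_combination ((Nat.card (i ⟶ j) : ℤ) - (Nat.card (j ⟶ i) : ℤ)) * hl
      rw [h, mul_neg, ← abs_of_nonneg (Int.natCast_nonneg (d i)), ← abs_mul,
        abs_of_nonneg (Int.natCast_nonneg (d i))]
      rcases le_total 0 ((d i : ℤ) * adjEntry d i j) with h0 | h0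
      · rw [abs_of_nonneg h0, max_eq_left h0, max_eq_right (by omega)]; ring
      · rw [abs_of_nonpos h0, max_eq_right h0, max_eq_left (by omega)]; ring
  rw [this, bilin_add_coeff, bilin_swap (eulerSimple d)]
  rfl

end Forms

namespace Rep

variable [hI : IsAdmissible I d]

instance (V : Rep F d) (i : I) : Finite (V.obj i) := finite_obj hI.pos V i
instance (V : Rep F d) : Finite V.Sub := finite_sub hI.pos V
instance (V W : Rep F d) : Finite (Iso V W) := finite_iso hI.pos V W

instance (U W : Rep F d) (i j : I) : Finite (SLin U W i j) :=
  have : Finite (U.obj i →+ W.obj j) := Finite.of_injective _ DFunLike.coe_injective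
  inferInstance

/-- Both spaces are vector spaces over the common subfield of degree g = gcd(d_i, d_j). Their
dimensions over it are found by comparing cardinalities, after which the maps are counted as
ordinary linear maps. -/
theorem card_sLin (U W : Rep F d) (i j : I) : Nat.card (SLin U W i j) =
    Nat.card F ^ (Nat.lcm (d i) (d j) * (Module.finrank (extField F (d i)) (U.obj i) *
      Module.finrank (extField F (d j)) (W.obj j))) := by
  set g := Nat.gcd (d i) (d j)
  have hg : 0 < g := Nat.gcd_pos_of_pos_left _ (hI.pos i)
  have := finite_extField F hg
  let : Module (extField F g) (U.obj i) := Module.compHom _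
    (IntermediateField.inclusion (extField_le F (Nat.gcd_dvd_left (d i) (d j)))).toRingHom
  let : Module (extField F g) (W.obj j) := Module.compHom _
    (IntermediateField.inclusion (extField_le F (Nat.gcd_dvd_right (d i) (d j)))).toRingHom
  let e : SLin U W i j ≃ (U.obj i →ₗ[extField F g] W.obj j) :=
    { toFun := fun f => { toFun := f.1, map_add' := f.1.map_add, map_smul' := f.2 }
      invFun := fun f => ⟨f.toAddMonoidHom, f.map_smul⟩
      left_inv := fun f => rfl
      right_inv := fun f => rfl }
  have hq : 1 < Nat.card F := Finite.one_lt_card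
  have h1 := (Module.natCard_eq_pow_finrank (K := extField F g) (V := U.obj i)).symm.trans
    (card_obj hI.pos U i)
  have h2 := (Module.natCard_eq_pow_finrank (K := extField F g) (V := W.obj j)).symm.trans
    (card_obj hI.pos W j)
  rw [card_extField F hg, ← pow_mul] at h1 h2
  have h1' := Nat.pow_right_injective hq h1
  have h2' := Nat.pow_right_injective hq h2
  rw [Nat.card_congr e, card_linearMap_of_finite, card_extField F hg, ← pow_mul]
  congr 1
  -- Multiplication by g avoids a division, and gcd times lcm equals d_i d_j.
  refine Nat.eq_of_mul_eq_mul_left hg ?_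
  rw [show g * (Nat.lcm (d i) (d j) * (Module.finrank (extField F (d i)) (U.obj i) *
      Module.finrank (extField F (d j)) (W.obj j))) = (g * Nat.lcm (d i) (d j)) *
      (Module.finrank (extField F (d i)) (U.obj i) *
      Module.finrank (extField F (d j)) (W.obj j)) by ring, Nat.gcd_mul_lcm,
    mul_mul_mul_comm, ← h1', ← h2']
  ring

theorem subsingleton_obj_of_dimVec (V : Rep F d) {i : I} (h : i ∉ V.dimVec.support) :
    Subsingleton (V.obj i) := by
  rw [Finsupp.notMem_support_iff, dimVec_apply, Nat.cast_eq_zero] at h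
  exact Module.finrank_zero_iff.1 h

theorem subsingleton_sLin_left (U W : Rep F d) (i j : I) (h : i ∉ U.dimVec.support) :
    Subsingleton (SLin U W i j) :=
  have := U.subsingleton_obj_of_dimVec h
  ⟨fun f g => SLin.ext fun y => by
    rw [Subsingleton.elim y 0, SLin.map_zero, SLin.map_zero]⟩

theorem subsingleton_sLin_right (U W : Rep F d) (i j : I) (h : j ∉ W.dimVec.support) :
    Subsingleton (SLin U W i j) :=
  have := W.subsingleton_obj_of_dimVec h
  ⟨fun _ _ => SLin.ext fun _ => Subsingleton.elim _ _⟩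

instance (U W : Rep F d) : Finite (GradedHom U W) :=
  finite_pi_of_subsingleton (Finset.finite_toSet U.dimVec.support) fun i hi =>
    subsingleton_sLin_left U W i i hi

theorem card_gradedHom (U W : Rep F d) :
    (Nat.card (GradedHom U W) : ℂ) = vHalfPow F (4 * homForm d U.dimVec W.dimVec) := by
  have : Nat.card (GradedHom U W) = ∏ i ∈ U.dimVec.support, _ :=
    card_pi_of_unique U.dimVec.support fun i hi => subsingleton_sLin_left U W i i hi
  rw [this]
  simp only [card_sLin]
  rw [Finset.prod_pow_eq_pow_sum, card_pow_eq_vHalfPow]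
  congr 2
  rw [homForm, bilin, Finsupp.sum, Nat.cast_sum]
  refine Finset.sum_congr rfl fun i _ => ?_
  rw [Finsupp.sum, Finset.sum_eq_single i]
  · rw [if_pos rfl, Nat.lcm_self, dimVec_apply, dimVec_apply]; push_cast; ring
  · intro j _ hj
    rw [if_neg (Ne.symm hj), mul_zero]
  · intro hi
    rw [Finsupp.notMem_support_iff] at hi
    rw [hi]; ring

/-- A cocycle consists of functions from the sets of arrows between two vertices. -/
def cocycleEquiv (U W : Rep F d) :
    Cocycle U W ≃ ∀ p : I × I, (p.1 ⟶ p.2) → SLin U W p.1 p.2 where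
  toFun c p a := c ⟨p.1, p.2, a⟩
  invFun f e := f (e.left, e.right) e.hom
  left_inv _ := rfl
  right_inv _ := rfl

theorem subsingleton_cocycle_component (U W : Rep F d) (p : I × I)
    (hp : p ∉ U.dimVec.support ×ˢ W.dimVec.support) :
    Subsingleton ((p.1 ⟶ p.2) → SLin U W p.1 p.2) := by
  rw [Finset.mem_product, not_and_or] at hp
  rcases hp with h | h
  · have := subsingleton_sLin_left U W p.1 p.2 h
    infer_instance
  · have := subsingleton_sLin_right U W p.1 p.2 h
    infer_instance

instance (U W : Rep F d) : Finite (Cocycle U W) :=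
  have (p : I × I) : Finite (p.1 ⟶ p.2) := finite_hom d _ _
  have : Finite (∀ p : I × I, (p.1 ⟶ p.2) → SLin U W p.1 p.2) :=
    finite_pi_of_subsingleton (Finset.finite_toSet (U.dimVec.support ×ˢ W.dimVec.support))
      fun p hp => subsingleton_cocycle_component U W p hp
  Finite.of_equiv _ (cocycleEquiv U W).symm

/-- Each arrow i → j contributes lcm(d_i, d_j) u_i w_j to the exponent of |F|, and by `euler_eq`
these add up to the difference of the two forms. -/
theorem card_cocycle (U W : Rep F d) : (Nat.card (Cocycle U W) : ℂ) =
    vHalfPow F (4 * (homForm d U.dimVec W.dimVec - euler d U.dimVec W.dimVec)) := by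
  have (p : I × I) : Finite (p.1 ⟶ p.2) := finite_hom d _ _
  rw [Nat.card_congr (cocycleEquiv U W), card_pi_of_unique (U.dimVec.support ×ˢ W.dimVec.support)
    fun p hp => subsingleton_cocycle_component U W p hp]
  simp only [Nat.card_fun, card_sLin, ← pow_mul]
  rw [Finset.prod_pow_eq_pow_sum, card_pow_eq_vHalfPow]
  congr 2
  rw [euler_eq, sub_sub_cancel, bilin, Finsupp.sum, Nat.cast_sum, Finset.sum_product]
  refine Finset.sum_congr rfl fun i _ => Finset.sum_congr rfl fun j _ => ?_
  rw [dimVec_apply, dimVec_apply]; push_cast; ring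

end Rep
end ValuedQuiver

end

/-! ### Riedtmann's formula and the structure maps on delta functions. -/

section

namespace ValuedQuiver

attribute [local instance 50] Fintype.ofFinite

section Finsum

theorem finsum_single_apply {B : Type*} (g : B → ℂ) (hg : g.support.Finite) (b : B) :
    (∑ᶠ V, Finsupp.single V (g V)) b = g b := by
  rw [finsum_eq_sum_of_support_subset (s := hg.toFinset) _ (fun V hV => ?_),
    Finsupp.finsetSum_apply, Finset.sum_eq_single b]
  · simp
  · intro c _ hc
    exact Finsupp.single_eq_of_ne hc.symm
  · intro hb
    have : g b = 0 := by simpa using hb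
    simp [this]
  · rw [Set.Finite.coe_toFinset, Function.mem_support]
    intro h0
    exact hV (by simp [h0])

/-- Values outside the image of `g` have empty fibres and drop out. It converts a sum over
isomorphism classes weighted by Hall numbers into a sum over subrepresentations. -/
theorem finsum_card_fiber_smul {P X M : Type*} [Fintype X] [AddCommMonoid M] [Module ℂ M]
    (g : X → P) (f : P → M) : ∑ᶠ p, (Nat.card {y // g y = p} : ℂ) • f p = ∑ y, f (g y) := by
  classical
  rw [finsum_eq_sum_of_support_subset (s := Finset.univ.image g) _ (fun p hp => ?_),
    ← Finset.sum_fiberwise_of_maps_to (s := Finset.univ) (t := Finset.univ.image g) (g := g)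
      (fun y _ => Finset.mem_image_of_mem g (Finset.mem_univ y))]
  · refine Finset.sum_congr rfl fun p _ => ?_
    rw [Finset.sum_congr rfl fun y hy => by rw [(Finset.mem_filter.1 hy).2], Finset.sum_const,
      Nat.card_eq_fintype_card, Fintype.card_subtype, Nat.cast_smul_eq_nsmul]
  · by_contra hne
    have : IsEmpty {y // g y = p} := ⟨fun y => hne <| by
      rw [← y.2]
      exact Finset.mem_coe.2 (Finset.mem_image_of_mem g (Finset.mem_univ _))⟩
    exact hp (by simp only [Nat.card_of_isEmpty, Nat.cast_zero, zero_smul])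

end Finsum

variable {F : Type u} [Field F] [Finite F] {I : Type w} [Quiver.{x + 1} I] {d : I → ℕ}

open ValuedQuiver.Rep

variable [hI : IsAdmissible I d]

namespace Rep

/-- A fixed X admits isomorphisms W ≅ X and V/X ≅ U only if the classes match, and then there are
|Aut W| and |Aut U| choices. -/
theorem card_shortExact (U W : Rep F d) (V : IsoClass F d) :
    Nat.card (ShortExact U W (Quotient.out V)) =
      hallNumber U.cls V W.cls * (U.cls.autCard * W.cls.autCard) := by
  classical
  rw [Nat.card_sigma]
  have h : ∀ X : (Quotient.out V).Sub, Nat.card (Iso W X.toRep × Iso X.quotient U) =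
      if X.toRep.cls = W.cls ∧ X.quotient.cls = U.cls then U.cls.autCard * W.cls.autCard
      else 0 := fun X => by
    rw [Nat.card_prod]
    split_ifs with hX
    · rw [card_iso_of_cls_eq hX.1.symm, card_iso_of_cls_eq hX.2, hX.2, mul_comm]
    · rw [not_and_or] at hX
      rcases hX with hX | hX
      · rw [card_iso_of_cls_ne (Ne.symm hX), zero_mul]
      · rw [card_iso_of_cls_ne hX, mul_zero]
  rw [Finset.sum_congr rfl fun X _ => h X, ← Finset.sum_filter, Finset.sum_const, smul_eq_mul,
    hallNumber, Nat.card_eq_fintype_card, Fintype.card_subtype]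

theorem card_sigma_iso_extension (U W : Rep F d) (V : IsoClass F d) :
    Nat.card (Σ c : Cocycle U W, Iso (extension c) (Quotient.out V)) =
      Nat.card {c : Cocycle U W // (extension c).cls = V} * V.autCard := by
  classical
  rw [Nat.card_sigma]
  have h : ∀ c : Cocycle U W, Nat.card (Iso (extension c) (Quotient.out V)) =
      if (extension c).cls = V then V.autCard else 0 := fun c => by
    split_ifs with hc
    · rw [card_iso_of_cls_eq (hc.trans (cls_out V).symm), hc]
    · exact card_iso_of_cls_ne fun h => hc (h.trans (cls_out V))
  rw [Finset.sum_congr rfl fun X _ => h X, ← Finset.sum_filter, Finset.sum_const, smul_eq_mul,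
    Nat.card_eq_fintype_card (α := {c // _}), Fintype.card_subtype]

/-- Riedtmann's formula. -/
theorem card_extension_mul_autCard (U W : Rep F d) (V : IsoClass F d) :
    Nat.card {c : Cocycle U W // (extension c).cls = V} * V.autCard =
      hallNumber U.cls V W.cls * (U.cls.autCard * W.cls.autCard) *
        Nat.card (GradedHom U W) := by
  -- Both sides count isomorphisms from extensions of U by W to V, the right-hand one as short exact
  -- sequences with a section.
  rw [← card_sigma_iso_extension, ← card_shortExact, ← Nat.card_prod]
  exact (Nat.card_congr (Equiv.ofBijective _ ShortExact.toSigmaIso_bijective)).symm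

/-- The quotient of automorphism orders in the structure constant is the one in Riedtmann's formula,
so the Hall number becomes a number of cocycles divided by |`GradedHom U W`|. -/
theorem hallComulCoeff_eq (U W : Rep F d) (V : IsoClass F d) :
    hallComulCoeff V U.cls W.cls =
      vHalfPow F (2 * euler d U.dimVec W.dimVec - 4 * homForm d U.dimVec W.dimVec) *
        (Nat.card {c : Cocycle U W // (extension c).cls = V} : ℂ) := by
  have h := congrArg (Nat.cast (R := ℂ)) (card_extension_mul_autCard U W V)
  push_cast at h
  rw [card_gradedHom] at h
  have h1 : (V.autCard : ℂ) ≠ 0 := by exact_mod_cast (autCard_pos hI.pos V).ne'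
  have h2 := vHalfPow_ne_zero F (4 * homForm d U.dimVec W.dimVec)
  rw [hallComulCoeff, dimVec_cls, dimVec_cls, sub_eq_add_neg, vHalfPow_add, vHalfPow_neg]
  field_simp
  linear_combination -vHalfPow F (2 * euler d U.dimVec W.dimVec) * h

end Rep

/-- The coefficient of the product of delta functions in the basis of extensions. -/
def mulCoeff (F : Type u) (d : I → ℕ) (a b : I →₀ ℤ) : ℂ :=
  vHalfPow F (2 * euler d a b - 4 * homForm d a b)

/-- The delta function of the class of a representation. -/
def delta (V : Rep F d) : IsoClass F d →₀ ℂ := Finsupp.single V.cls 1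

theorem Rep.Iso.delta_eq {V W : Rep F d} (e : Iso V W) : delta V = delta W := by
  rw [delta, delta, e.cls_eq]

/-- This form of the product is free of automorphism groups and Hall numbers; associativity and
Green's formula start from it. -/
theorem dualHall_mul_delta (U W : Rep F d) : (dualHall F d).mul (delta U) (delta W) =
    mulCoeff F d U.dimVec W.dimVec • ∑ c : Cocycle U W, delta (extension c) := by
  classical
  have h : (dualHall F d).mul (delta U) (delta W) =
      ∑ᶠ V : IsoClass F d, Finsupp.single V (hallComulCoeff V U.cls W.cls) := by
    simp [dualHall, delta]
  rw [h]
  ext V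
  have hsupp : (fun V : IsoClass F d => hallComulCoeff V U.cls W.cls).support.Finite := by
    refine (Set.finite_range fun c : Cocycle U W => (extension c).cls).subset fun V hV => ?_
    by_contra hne
    have : IsEmpty {c : Cocycle U W // (extension c).cls = V} := ⟨fun c => hne ⟨c.1, c.2⟩⟩
    exact hV (by
      change hallComulCoeff V U.cls W.cls = 0
      rw [hallComulCoeff_eq, Nat.card_of_isEmpty, Nat.cast_zero, mul_zero])
  rw [finsum_single_apply _ hsupp, hallComulCoeff_eq, Finsupp.smul_apply, smul_eq_mul,
    Finsupp.finsetSum_apply, mulCoeff]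
  congr 1
  rw [Finset.sum_congr rfl fun c _ => show delta (extension c) V =
    if (extension c).cls = V then 1 else 0 from Finsupp.single_apply, Finset.sum_boole,
    Nat.card_eq_fintype_card, Fintype.card_subtype]

/-- The Hall number for the pair of classes (U, W) is the size of the fibre over that pair under X ↦
([V/X], [X]), so the sum over pairs of classes unfolds into a sum over X. -/
theorem dualHall_comul_delta (V : Rep F d) : (dualHall F d).comul (delta V) =
    ∑ X : V.Sub, vHalfPow F (2 * euler d X.quotient.dimVec X.toRep.dimVec) •
      (delta X.quotient ⊗ₜ[ℂ] delta X.toRep) := by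
  let f : IsoClass F d × IsoClass F d → (IsoClass F d →₀ ℂ) ⊗[ℂ] (IsoClass F d →₀ ℂ) := fun P =>
    vHalfPow F (2 * euler d P.1.dimVec P.2.dimVec) •
      (Finsupp.single P.1 (1 : ℂ) ⊗ₜ[ℂ] Finsupp.single P.2 (1 : ℂ))
  have h : (dualHall F d).comul (delta V) = ∑ᶠ P : IsoClass F d × IsoClass F d,
      (Nat.card {X : (Quotient.out V.cls).Sub // (X.quotient.cls, X.toRep.cls) = P} : ℂ) •
        f P := by
    simp only [dualHall, delta, Finsupp.linearCombination_single, one_smul]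
    refine finsum_congr fun P => ?_
    have hcard : Nat.card {X : (Quotient.out V.cls).Sub //
        X.toRep.cls = P.2 ∧ X.quotient.cls = P.1} =
        Nat.card {X : (Quotient.out V.cls).Sub // (X.quotient.cls, X.toRep.cls) = P} :=
      Nat.card_congr (Equiv.subtypeEquivRight fun X => by rw [Prod.ext_iff, and_comm])
    rw [hallMulCoeff, mul_comm, mul_smul, hallNumber, hcard]
  obtain ⟨e⟩ := cls_eq_iff.1 (cls_out V.cls)
  rw [h, finsum_card_fiber_smul
    (fun X : (Quotient.out V.cls).Sub => (X.quotient.cls, X.toRep.cls)) f, e.sum_sub fun a b => f (a, b)]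
  refine Finset.sum_congr rfl fun X _ => ?_
  simp only [f, dimVec_cls, delta]

theorem dualHall_one : (dualHall F d).one = delta (Rep.zero F d) := rfl

theorem delta_induction {p : (IsoClass F d →₀ ℂ) → Prop} (f : IsoClass F d →₀ ℂ)
    (h₀ : p 0) (hadd : ∀ f g, p f → p g → p (f + g))
    (hsmul : ∀ (r : ℂ) (V : Rep F d), p (r • delta V)) : p f := by
  induction f using Finsupp.induction_linear with
  | zero => exact h₀
  | add f g hf hg => exact hadd f g hf hg
  | single V r =>
    have := hsmul r (Quotient.out V)
    rwa [delta, cls_out, Finsupp.smul_single, smul_eq_mul, mul_one] at this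

theorem linearMap_ext_delta {M : Type*} [AddCommMonoid M] [Module ℂ M]
    {f g : (IsoClass F d →₀ ℂ) →ₗ[ℂ] M} (h : ∀ V : Rep F d, f (delta V) = g (delta V)) : f = g :=
  LinearMap.ext fun y => by
    induction y using delta_induction with
    | h₀ => simp
    | hadd a b ha hb => rw [map_add, map_add, ha, hb]
    | hsmul r V => rw [LinearMap.map_smul, LinearMap.map_smul, h]

theorem dimVec_zero : (Rep.zero F d).dimVec = 0 :=
  Finsupp.ext fun i => by
    rw [dimVec_apply]
    exact congrArg Nat.cast (Module.finrank_zero_of_subsingleton (R := extField F (d i))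
      (M := PUnit.{u + 1}))

/-- A representation of dimension zero is the zero representation. -/
theorem cls_eq_zero_of_dimVec {V : Rep F d} (h : V.dimVec = 0) : V.cls = (Rep.zero F d).cls := by
  have hs : ∀ i, Subsingleton (V.obj i) := fun i => V.subsingleton_obj_of_dimVec (by simp [h])
  exact Iso.cls_eq
    { equiv := fun i =>
        have := hs i
        LinearEquiv.ofSubsingleton (V.obj i) PUnit.{u + 1}
      comm := fun a y => rfl }

theorem cls_eq_zero_iff {V : Rep F d} : V.cls = (Rep.zero F d).cls ↔ V.dimVec = 0 :=
  ⟨fun h => by rw [← dimVec_cls, h, dimVec_cls, dimVec_zero], cls_eq_zero_of_dimVec⟩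

end ValuedQuiver

end

/-! ### Graded modules, iterated extensions, and chains of subrepresentations. -/

section

namespace GradedBialgebra

variable {R : Type*} [CommRing R] {Γ : Type*} {B : Type*}

theorem StructureMaps.component_eq_span (S : StructureMaps R Γ B) (γ : Γ) :
    S.component γ = Submodule.span R ((fun b => Finsupp.single b (1 : R)) '' {b | S.deg b = γ}) :=
  Finsupp.supported_eq_span_single R _

theorem StructureMaps.map_mem_of_basis {M : Type*} [AddCommMonoid M] [Module R M]
    (S : StructureMaps R Γ B) {γ : Γ} (φ : (B →₀ R) →ₗ[R] M) {P : Submodule R M}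
    (h : ∀ b, S.deg b = γ → φ (Finsupp.single b 1) ∈ P) : ∀ f ∈ S.component γ, φ f ∈ P := by
  rw [S.component_eq_span]
  intro f hf
  have : Submodule.span R ((fun b => Finsupp.single b (1 : R)) '' {b | S.deg b = γ}) ≤
      P.comap φ := by
    rw [Submodule.span_le]
    rintro _ ⟨b, hb, rfl⟩
    exact h b hb
  exact this hf

theorem StructureMaps.map₂_mem_of_basis {M : Type*} [AddCommMonoid M] [Module R M]
    (S : StructureMaps R Γ B) {β γ : Γ} (φ : (B →₀ R) →ₗ[R] (B →₀ R) →ₗ[R] M) {P : Submodule R M}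
    (h : ∀ b c, S.deg b = β → S.deg c = γ → φ (Finsupp.single b 1) (Finsupp.single c 1) ∈ P) :
    ∀ f ∈ S.component β, ∀ g ∈ S.component γ, φ f g ∈ P := fun f hf g hg =>
  S.map_mem_of_basis (φ.flip g) (fun b hb =>
    S.map_mem_of_basis (φ (Finsupp.single b 1)) (fun c hc => h b c hb hc) g hg) f hf

theorem StructureMaps.single_mem_component (S : StructureMaps R Γ B) (b : B) (r : R) {γ : Γ}
    (h : S.deg b = γ) : Finsupp.single b r ∈ S.component γ :=
  Finsupp.single_mem_supported R r h

theorem StructureMaps.twistedMul_tmul (S : StructureMaps R Γ B) (χ : Γ → Γ → R) (b₁ b₂ c₁ c₂ : B) :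
    S.twistedMul χ (Finsupp.single b₁ 1 ⊗ₜ[R] Finsupp.single b₂ 1)
      (Finsupp.single c₁ 1 ⊗ₜ[R] Finsupp.single c₂ 1) =
    χ (S.deg b₂) (S.deg c₁) • (S.mul (Finsupp.single b₁ 1) (Finsupp.single c₁ 1) ⊗ₜ[R]
      S.mul (Finsupp.single b₂ 1) (Finsupp.single c₂ 1)) := by
  simp [StructureMaps.twistedMul]

theorem bilinear_ext {M : Type*} [AddCommMonoid M] [Module R M] {C : Type*}
    {φ ψ : (B →₀ R) →ₗ[R] (C →₀ R) →ₗ[R] M}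
    (h : ∀ b c, φ (Finsupp.single b 1) (Finsupp.single c 1) =
      ψ (Finsupp.single b 1) (Finsupp.single c 1)) : φ = ψ :=
  Finsupp.lhom_ext' fun b => LinearMap.ext_ring <| Finsupp.lhom_ext' fun c =>
    LinearMap.ext_ring (h b c)

end GradedBialgebra

namespace ValuedQuiver

attribute [local instance 50] Fintype.ofFinite

variable {F : Type u} [Field F] [Finite F] {I : Type w} [Quiver.{x + 1} I] {d : I → ℕ}

section MulCoeff

variable (F d)

theorem euler_add_left (a a' b : I →₀ ℤ) : euler d (a + a') b = euler d a b + euler d a' b :=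
  bilin_add_left _ a a' b

theorem euler_add_right (a b b' : I →₀ ℤ) : euler d a (b + b') = euler d a b + euler d a b' :=
  bilin_add_right _ a b b'

theorem euler_zero_left (b : I →₀ ℤ) : euler d 0 b = 0 := bilin_zero_left _ b

theorem euler_zero_right (a : I →₀ ℤ) : euler d a 0 = 0 := bilin_zero_right _ a

theorem symForm_add_left (a a' b : I →₀ ℤ) : symForm d (a + a') b = symForm d a b + symForm d a' b :=
  bilin_add_left _ a a' b

theorem symForm_add_right (a b b' : I →₀ ℤ) :
    symForm d a (b + b') = symForm d a b + symForm d a b' :=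
  bilin_add_right _ a b b'

theorem symForm_zero_left (b : I →₀ ℤ) : symForm d 0 b = 0 := bilin_zero_left _ b

theorem symForm_zero_right (a : I →₀ ℤ) : symForm d a 0 = 0 := bilin_zero_right _ a

theorem symForm_comm (a b : I →₀ ℤ) : symForm d a b = symForm d b a := by
  rw [symForm_eq, symForm_eq, add_comm]

theorem symForm_neg_neg (a b : I →₀ ℤ) : symForm d (-a) (-b) = symForm d a b := by
  change bilin _ (-a) (-b) = _
  rw [bilin_neg_left, bilin_neg_right, neg_neg]
  rfl

theorem homForm_add_left (a a' b : I →₀ ℤ) : homForm d (a + a') b = homForm d a b + homForm d a' b :=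
  bilin_add_left _ a a' b

theorem homForm_add_right (a b b' : I →₀ ℤ) :
    homForm d a (b + b') = homForm d a b + homForm d a b' :=
  bilin_add_right _ a b b'

theorem mulCoeff_add_left (a a' b : I →₀ ℤ) :
    mulCoeff F d (a + a') b = mulCoeff F d a b * mulCoeff F d a' b := by
  rw [mulCoeff, mulCoeff, mulCoeff, ← vHalfPow_add, euler_add_left, homForm_add_left]
  congr 1; ring

theorem mulCoeff_add_right (a b b' : I →₀ ℤ) :
    mulCoeff F d a (b + b') = mulCoeff F d a b * mulCoeff F d a b' := by
  rw [mulCoeff, mulCoeff, mulCoeff, ← vHalfPow_add, euler_add_right, homForm_add_right]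
  congr 1; ring

theorem mulCoeff_zero_left (b : I →₀ ℤ) : mulCoeff F d 0 b = 1 := by
  rw [mulCoeff, euler_zero_left, homForm, bilin_zero_left]
  exact vHalfPow_zero F

theorem mulCoeff_zero_right (a : I →₀ ℤ) : mulCoeff F d a 0 = 1 := by
  rw [mulCoeff, euler_zero_right, homForm, bilin_zero_right]
  exact vHalfPow_zero F

end MulCoeff

namespace Rep

namespace SLin

variable {U W Z : Rep F d} {i j : I}

/-- A map into an extension. -/
def pair (c : Cocycle W Z) (f : SLin U W i j) (g : SLin U Z i j) : SLin U (extension c) i j :=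
  conj (W' := extension c) (LinearMap.inl (extField F (d j)) (W.obj j) (Z.obj j)) f .id +
    conj (W' := extension c) (LinearMap.inr (extField F (d j)) (W.obj j) (Z.obj j)) g .id

theorem pair_apply (c : Cocycle W Z) (f : SLin U W i j) (g : SLin U Z i j) (y : U.obj i) :
    (pair c f g).1 y = (f y, g y) := by
  refine (add_apply _ _ _).trans ?_
  exact Prod.ext (add_zero _) (zero_add _)

/-- A map out of an extension. -/
def copair (c : Cocycle U W) (f : SLin U Z i j) (g : SLin W Z i j) : SLin (extension c) Z i j :=
  conj (U' := extension c) .id f (LinearMap.fst (extField F (d i)) (U.obj i) (W.obj i)) +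
    conj (U' := extension c) .id g (LinearMap.snd (extField F (d i)) (U.obj i) (W.obj i))

end SLin

section Assoc

variable {U W Z : Rep F d}

variable (W) in
/-- Cocycles on an extension are pairs of cocycles. -/
def copairEquiv (c : Cocycle U W) : Cocycle U Z × Cocycle W Z ≃ Cocycle (extension c) Z where
  toFun p e := SLin.copair c (p.1 e) (p.2 e)
  invFun f := (fun e => SLin.conj .id (f e)
      (LinearMap.inl (extField F (d e.left)) (U.obj e.left) (W.obj e.left)),
    fun e => SLin.conj .id (f e)
      (LinearMap.inr (extField F (d e.left)) (U.obj e.left) (W.obj e.left)))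
  left_inv p := Prod.ext
    (funext fun e => SLin.ext fun y => by
      change p.1 e y + p.2 e 0 = p.1 e y
      rw [SLin.map_zero, add_zero])
    (funext fun e => SLin.ext fun y => by
      change p.1 e 0 + p.2 e y = p.2 e y
      rw [SLin.map_zero, zero_add])
  right_inv f := funext fun e => SLin.ext fun y => by
    refine ((f e).1.map_add (y.1, 0) (0, y.2)).symm.trans (congrArg (f e).1 ?_)
    exact Prod.ext (add_zero _) (zero_add _)

/-- Cocycles with values in an extension are pairs of cocycles. -/
def pairEquiv (c : Cocycle W Z) : Cocycle U W × Cocycle U Z ≃ Cocycle U (extension c) where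
  toFun p e := SLin.pair c (p.1 e) (p.2 e)
  invFun f := (fun e => SLin.conj (U' := U) (W := extension c) (W' := W)
      (LinearMap.fst (extField F (d e.right)) (W.obj e.right) (Z.obj e.right)) (f e) .id,
    fun e => SLin.conj (U' := U) (W := extension c) (W' := Z)
      (LinearMap.snd (extField F (d e.right)) (W.obj e.right) (Z.obj e.right)) (f e) .id)
  left_inv p := Prod.ext
    (funext fun e => SLin.ext fun y => congrArg Prod.fst (SLin.pair_apply c (p.1 e) (p.2 e) y))
    (funext fun e => SLin.ext fun y => congrArg Prod.snd (SLin.pair_apply c (p.1 e) (p.2 e) y))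
  right_inv _ := funext fun _ => SLin.ext fun y => SLin.pair_apply c _ _ y

/-- Iterated extensions can be bracketed in both ways. -/
def extensionAssoc (c : Cocycle U W) (f : Cocycle U Z) (g : Cocycle W Z) :
    Iso (extension (copairEquiv W c (f, g))) (extension (pairEquiv g (c, f))) where
  equiv i := LinearEquiv.prodAssoc (extField F (d i)) (U.obj i) (W.obj i) (Z.obj i)
  comm {i j} a y := by
    have h := SLin.pair_apply g (c ⟨i, j, a⟩) (f ⟨i, j, a⟩) y.1.1
    change (U.map a y.1.1, (c ⟨i, j, a⟩ y.1.1 + W.map a y.1.2,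
      f ⟨i, j, a⟩ y.1.1 + g ⟨i, j, a⟩ y.1.2 + Z.map a y.2)) =
      (U.map a y.1.1, (SLin.pair g (c ⟨i, j, a⟩) (f ⟨i, j, a⟩)).1 y.1.1 +
        (W.map a y.1.2, g ⟨i, j, a⟩ y.1.2 + Z.map a y.2))
    rw [h]
    refine Prod.ext rfl (Prod.ext rfl ?_)
    exact add_assoc _ _ _

end Assoc

section Zero

/-- The extension of `0` by `W` is `W`. -/
def extensionZeroLeft {W : Rep F d} (c : Cocycle (Rep.zero F d) W) : Iso (extension c) W where
  equiv i := LinearEquiv.ofBijective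
    (LinearMap.snd (extField F (d i)) ((Rep.zero F d).obj i) (W.obj i))
    ⟨fun y z h => Prod.ext rfl h, fun y => ⟨(0, y), rfl⟩⟩
  comm {i j} a y := by
    change c ⟨i, j, a⟩ 0 + W.map a y.2 = W.map a y.2
    rw [SLin.map_zero, zero_add]

/-- The extension of `U` by `0` is `U`. -/
def extensionZeroRight {U : Rep F d} (c : Cocycle U (Rep.zero F d)) : Iso (extension c) U where
  equiv i := LinearEquiv.ofBijective
    (LinearMap.fst (extField F (d i)) (U.obj i) ((Rep.zero F d).obj i))
    ⟨fun _ _ h => Prod.ext h rfl, fun y => ⟨(y, 0), rfl⟩⟩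
  comm {_ _} _ _ := rfl

instance (W : Rep F d) : Subsingleton (Cocycle (Rep.zero F d) W) :=
  ⟨fun c c' => funext fun e => SLin.ext fun _ => (c e).1.map_zero.trans (c' e).1.map_zero.symm⟩

instance (U : Rep F d) : Subsingleton (Cocycle U (Rep.zero F d)) :=
  ⟨fun _ _ => funext fun _ => SLin.ext fun _ => rfl⟩

end Zero

section Chains

variable [IsAdmissible I d] {M : Type*} [AddCommMonoid M]

theorem Sub.sum_quotient_sub {V : Rep F d} (X : V.Sub) (f : IsoClass F d → IsoClass F d → M) :
    ∑ Z : X.quotient.Sub, f Z.quotient.cls Z.toRep.cls =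
      ∑ Y : {Y : V.Sub // ∀ i, X.carrier i ≤ Y.carrier i},
        f Y.1.quotient.cls (X.within Y.1).quotient.cls :=
  (Fintype.sum_equiv X.quotientSubEquiv _ _ fun Y => by
    rw [X.cls_quotientSubEquiv, X.cls_quotientSubEquiv_quotient]).symm

theorem Sub.sum_toRep_sub {V : Rep F d} (Y : V.Sub) (f : IsoClass F d → IsoClass F d → M) :
    ∑ Z : Y.toRep.Sub, f Z.quotient.cls Z.toRep.cls =
      ∑ X : {X : V.Sub // ∀ i, X.carrier i ≤ Y.carrier i},
        f (X.1.within Y).quotient.cls X.1.toRep.cls :=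
  (Fintype.sum_equiv Y.subEquiv _ _ fun X => by
    rw [← Sub.cls_within X.2]; rfl).symm

/-- Both ways of summing over the chains of two subrepresentations agree. -/
theorem sum_chains (V : Rep F d) (f : IsoClass F d → IsoClass F d → IsoClass F d → M) :
    ∑ X : V.Sub, ∑ Z : X.quotient.Sub, f Z.quotient.cls Z.toRep.cls X.toRep.cls =
      ∑ Y : V.Sub, ∑ Z : Y.toRep.Sub, f Y.quotient.cls Z.quotient.cls Z.toRep.cls := by
  simp only [fun X : V.Sub => X.sum_quotient_sub fun a b => f a b X.toRep.cls,
    fun Y : V.Sub => Y.sum_toRep_sub fun a b => f Y.quotient.cls a b]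
  rw [Finset.sum_sigma', Finset.sum_sigma']
  -- Both sides are now sums over pairs X ⊂ Y of subrepresentations of V, differing only in which of
  -- the two is chosen first.
  refine Finset.sum_bij' (fun p _ => ⟨p.2.1, p.1, p.2.2⟩) (fun p _ => ⟨p.2.1, p.1, p.2.2⟩)
    ?_ ?_ ?_ ?_ ?_ <;> simp

theorem cls_toRep_top (V : Rep F d) : (Sub.top V).toRep.cls = V.cls :=
  ((Sub.top V).toRepIso (fun _ => LinearMap.id) (fun _ _ => rfl) (fun _ => Function.injective_id)
    (fun _ => LinearMap.range_id)).cls_eq.symm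

theorem cls_quotient_bot (V : Rep F d) : (Sub.bot V).quotient.cls = V.cls :=
  ((Sub.bot V).quotientIso (fun _ => LinearMap.id) (fun _ _ => rfl)
    (fun _ => Function.surjective_id) (fun _ _ => (Submodule.mem_bot _).symm)).cls_eq

theorem Sub.cls_quotient_eq_zero_iff {V : Rep F d} (X : V.Sub) :
    X.quotient.cls = (Rep.zero F d).cls ↔ X = Sub.top V := by
  rw [cls_eq_zero_iff]
  constructor
  · intro h
    refine Sub.ext fun i => ?_
    have : Subsingleton (V.obj i ⧸ X.carrier i) :=
      X.quotient.subsingleton_obj_of_dimVec (by simp [h])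
    exact Submodule.Quotient.subsingleton_iff.1 this
  · rintro rfl
    have h := (Sub.top V).dimVec_add
    rwa [← dimVec_cls (Sub.top V).toRep, cls_toRep_top, dimVec_cls, add_eq_right] at h

theorem Sub.cls_toRep_eq_zero_iff {V : Rep F d} (X : V.Sub) :
    X.toRep.cls = (Rep.zero F d).cls ↔ X = Sub.bot V := by
  rw [cls_eq_zero_iff]
  constructor
  · intro h
    refine Sub.ext fun i => ?_
    have : Subsingleton (X.carrier i) := X.toRep.subsingleton_obj_of_dimVec (by simp [h])
    exact Submodule.subsingleton_iff_eq_bot.1 this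
  · rintro rfl
    have h := (Sub.bot V).dimVec_add
    rwa [← dimVec_cls (Sub.bot V).quotient, cls_quotient_bot, dimVec_cls, add_eq_left] at h

end Chains

end Rep
end ValuedQuiver

end

/-! ### The algebra laws and the coalgebra laws of the dual Hall bialgebra. -/

section

namespace ValuedQuiver

attribute [local instance 50] Fintype.ofFinite

variable {F : Type u} [Field F] [Finite F] {I : Type w} [Quiver.{x + 1} I] {d : I → ℕ}

open ValuedQuiver.Rep GradedBialgebra

variable [hI : IsAdmissible I d]

/-- The coefficient of `[U] ⊗ [W]` for a single subrepresentation. -/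
def comulCoeff (F : Type u) (d : I → ℕ) (a b : I →₀ ℤ) : ℂ := vHalfPow F (2 * euler d a b)

theorem comulCoeff_add_left (a a' b : I →₀ ℤ) :
    comulCoeff F d (a + a') b = comulCoeff F d a b * comulCoeff F d a' b := by
  rw [comulCoeff, comulCoeff, comulCoeff, ← vHalfPow_add, euler_add_left, mul_add]

theorem comulCoeff_add_right (a b b' : I →₀ ℤ) :
    comulCoeff F d a (b + b') = comulCoeff F d a b * comulCoeff F d a b' := by
  rw [comulCoeff, comulCoeff, comulCoeff, ← vHalfPow_add, euler_add_right, mul_add]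

theorem comulCoeff_zero_left (b : I →₀ ℤ) : comulCoeff F d 0 b = 1 := by
  rw [comulCoeff, euler_zero_left]; exact vHalfPow_zero F

theorem comulCoeff_zero_right (b : I →₀ ℤ) : comulCoeff F d b 0 = 1 := by
  rw [comulCoeff, euler_zero_right]; exact vHalfPow_zero F

/-- The scalars agree because `mulCoeff` is multiplicative in both arguments. Either bracketing sums
over the triples of cocycles U → W, U → Z, W → Z, and corresponding iterated extensions are
isomorphic. -/
theorem dualHall_mul_assoc (f g h : IsoClass F d →₀ ℂ) :
    (dualHall F d).mul ((dualHall F d).mul f g) h =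
      (dualHall F d).mul f ((dualHall F d).mul g h) := by
  induction f using delta_induction with
  | h₀ => simp
  | hadd a b ha hb => simp only [map_add, LinearMap.add_apply, ha, hb]
  | hsmul r U =>
  induction g using delta_induction with
  | h₀ => simp
  | hadd a b ha hb => simp only [map_add, LinearMap.add_apply, ha, hb]
  | hsmul s W =>
  induction h using delta_induction with
  | h₀ => simp
  | hadd a b ha hb => simp only [map_add, ha, hb]
  | hsmul t Z =>
    simp only [LinearMap.map_smul, LinearMap.smul_apply]
    congr 3
    simp only [dualHall_mul_delta, LinearMap.map_smul, LinearMap.smul_apply, map_sum,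
      LinearMap.sum_apply, dimVec_extension]
    simp only [← Finset.smul_sum, smul_smul, mulCoeff_add_left, mulCoeff_add_right]
    congr 1
    · ring
    -- A cocycle on an extension, or with values in one, is a pair of cocycles; this exposes the
    -- common triple of summation variables.
    · have h1 : ∀ c : Cocycle U W, ∑ e : Cocycle (extension c) Z, delta (extension e) =
          ∑ f : Cocycle U Z, ∑ g : Cocycle W Z, delta (extension (copairEquiv W c (f, g))) :=
        fun c => by
          rw [← Fintype.sum_prod_type']
          exact (Fintype.sum_equiv (copairEquiv W c) _ _ fun _ => rfl).symm
      have h2 : ∀ g : Cocycle W Z, ∑ e : Cocycle U (extension g), delta (extension e) =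
          ∑ c : Cocycle U W, ∑ f : Cocycle U Z, delta (extension (pairEquiv g (c, f))) :=
        fun g => by
          rw [← Fintype.sum_prod_type']
          exact (Fintype.sum_equiv (pairEquiv g) _ _ fun _ => rfl).symm
      rw [Finset.sum_congr rfl fun c _ => h1 c, Finset.sum_congr rfl fun g _ => h2 g,
        Finset.sum_comm (s := (Finset.univ : Finset (Cocycle W Z)))]
      refine Finset.sum_congr rfl fun c _ => ?_
      rw [Finset.sum_comm (s := (Finset.univ : Finset (Cocycle W Z)))]
      exact Finset.sum_congr rfl fun f _ => Finset.sum_congr rfl fun g _ =>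
        (extensionAssoc c f g).delta_eq

theorem dualHall_one_mul (f : IsoClass F d →₀ ℂ) :
    (dualHall F d).mul (dualHall F d).one f = f := by
  have h : (dualHall F d).mul (dualHall F d).one = LinearMap.id := linearMap_ext_delta fun W => by
    rw [dualHall_one, dualHall_mul_delta, dimVec_zero, mulCoeff_zero_left, one_smul,
      Fintype.sum_eq_single (0 : Cocycle (Rep.zero F d) W)
        fun c hc => (hc (Subsingleton.elim _ _)).elim, (extensionZeroLeft 0).delta_eq,
      LinearMap.id_apply]
  rw [h, LinearMap.id_apply]

theorem dualHall_mul_one (f : IsoClass F d →₀ ℂ) :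
    (dualHall F d).mul f (dualHall F d).one = f := by
  have h : (dualHall F d).mul.flip (dualHall F d).one = LinearMap.id :=
    linearMap_ext_delta fun W => by
      rw [LinearMap.flip_apply, dualHall_one, dualHall_mul_delta, dimVec_zero, mulCoeff_zero_right,
        one_smul, Fintype.sum_eq_single (0 : Cocycle W (Rep.zero F d))
          fun c hc => (hc (Subsingleton.elim _ _)).elim,
        (extensionZeroRight 0).delta_eq, LinearMap.id_apply]
  exact LinearMap.congr_fun h f

theorem delta_eq_single (V : Rep F d) : delta V = Finsupp.single V.cls 1 := rfl

theorem dualHall_comul_delta' (V : Rep F d) : (dualHall F d).comul (delta V) =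
    ∑ X : V.Sub, comulCoeff F d X.quotient.cls.dimVec X.toRep.cls.dimVec •
      (Finsupp.single X.quotient.cls (1 : ℂ) ⊗ₜ[ℂ] Finsupp.single X.toRep.cls (1 : ℂ)) := by
  simp only [dualHall_comul_delta, dimVec_cls]; rfl

/-- Both sides sum over chains X ⊂ Y ⊂ V the tensor of the three subquotients. Since the Euler form
is additive, the coefficient is the product over the three pairs of subquotients, whichever step is
cut off first. -/
theorem dualHall_coassoc :
    (TensorProduct.assoc ℂ (IsoClass F d →₀ ℂ) (IsoClass F d →₀ ℂ)
      (IsoClass F d →₀ ℂ)).toLinearMap ∘ₗ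
      (dualHall F d).comul.rTensor (IsoClass F d →₀ ℂ) ∘ₗ (dualHall F d).comul =
    (dualHall F d).comul.lTensor (IsoClass F d →₀ ℂ) ∘ₗ (dualHall F d).comul := by
    refine linearMap_ext_delta fun V => ?_
    let f : IsoClass F d → IsoClass F d → IsoClass F d →
        (IsoClass F d →₀ ℂ) ⊗[ℂ] ((IsoClass F d →₀ ℂ) ⊗[ℂ] (IsoClass F d →₀ ℂ)) := fun a b c =>
      (comulCoeff F d a.dimVec b.dimVec * comulCoeff F d a.dimVec c.dimVec *
        comulCoeff F d b.dimVec c.dimVec) •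
        (Finsupp.single a (1 : ℂ) ⊗ₜ[ℂ] (Finsupp.single b (1 : ℂ) ⊗ₜ[ℂ] Finsupp.single c (1 : ℂ)))
    have hl : ((TensorProduct.assoc ℂ (IsoClass F d →₀ ℂ) (IsoClass F d →₀ ℂ)
        (IsoClass F d →₀ ℂ)).toLinearMap ∘ₗ
        (dualHall F d).comul.rTensor (IsoClass F d →₀ ℂ) ∘ₗ (dualHall F d).comul) (delta V) =
        ∑ X : V.Sub, ∑ Z : X.quotient.Sub, f Z.quotient.cls Z.toRep.cls X.toRep.cls := by
      rw [LinearMap.comp_apply, LinearMap.comp_apply, dualHall_comul_delta, map_sum, map_sum]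
      refine Finset.sum_congr rfl fun X _ => ?_
      rw [LinearMap.map_smul, LinearMap.rTensor_tmul, dualHall_comul_delta, TensorProduct.sum_tmul,
        LinearMap.map_smul, map_sum, Finset.smul_sum]
      refine Finset.sum_congr rfl fun Z _ => ?_
      rw [← TensorProduct.smul_tmul', LinearMap.map_smul, smul_smul]
      simp only [f, dimVec_cls]
      rw [← Z.dimVec_add, ← comulCoeff, ← comulCoeff, comulCoeff_add_left]
      congr 1
      ring
    have hr : ((dualHall F d).comul.lTensor (IsoClass F d →₀ ℂ) ∘ₗ (dualHall F d).comul)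
        (delta V) =
        ∑ Y : V.Sub, ∑ Z : Y.toRep.Sub, f Y.quotient.cls Z.quotient.cls Z.toRep.cls := by
      rw [LinearMap.comp_apply, dualHall_comul_delta, map_sum]
      refine Finset.sum_congr rfl fun Y _ => ?_
      rw [LinearMap.map_smul, LinearMap.lTensor_tmul, dualHall_comul_delta, TensorProduct.tmul_sum,
        Finset.smul_sum]
      refine Finset.sum_congr rfl fun Z _ => ?_
      rw [TensorProduct.tmul_smul, smul_smul]
      simp only [f, dimVec_cls]
      rw [← Z.dimVec_add, ← comulCoeff, ← comulCoeff, comulCoeff_add_right]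
      rfl
    rw [hl, hr, sum_chains]

open Classical in
theorem dualHall_counit_delta (V : Rep F d) : (dualHall F d).counit (delta V) =
    if V.cls = (Rep.zero F d).cls then 1 else 0 := Finsupp.single_apply

theorem dualHall_counit_comul :
    (TensorProduct.lid ℂ (IsoClass F d →₀ ℂ)).toLinearMap ∘ₗ
      (dualHall F d).counit.rTensor (IsoClass F d →₀ ℂ) ∘ₗ (dualHall F d).comul =
        LinearMap.id :=
  linearMap_ext_delta fun V => by
    rw [LinearMap.comp_apply, LinearMap.comp_apply, dualHall_comul_delta, map_sum, map_sum,
      Finset.sum_eq_single (Sub.top V)]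
    · rw [LinearMap.map_smul, LinearMap.rTensor_tmul, dualHall_counit_delta,
        if_pos ((Sub.top V).cls_quotient_eq_zero_iff.2 rfl), ← comulCoeff,
        cls_eq_zero_iff.1 ((Sub.top V).cls_quotient_eq_zero_iff.2 rfl), comulCoeff_zero_left,
        one_smul, delta_eq_single, cls_toRep_top]
      exact TensorProduct.lid_tmul _ _ |>.trans (one_smul _ _)
    · intro X _ hX
      rw [LinearMap.map_smul, LinearMap.rTensor_tmul, dualHall_counit_delta,
        if_neg fun h => hX (X.cls_quotient_eq_zero_iff.1 h), TensorProduct.zero_tmul, smul_zero,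
        map_zero]
    · exact fun h => (h (Finset.mem_univ _)).elim

theorem dualHall_comul_counit :
    (TensorProduct.rid ℂ (IsoClass F d →₀ ℂ)).toLinearMap ∘ₗ
      (dualHall F d).counit.lTensor (IsoClass F d →₀ ℂ) ∘ₗ (dualHall F d).comul =
        LinearMap.id :=
  linearMap_ext_delta fun V => by
    rw [LinearMap.comp_apply, LinearMap.comp_apply, dualHall_comul_delta, map_sum, map_sum,
      Finset.sum_eq_single (Sub.bot V)]
    · rw [LinearMap.map_smul, LinearMap.lTensor_tmul, dualHall_counit_delta,
        if_pos ((Sub.bot V).cls_toRep_eq_zero_iff.2 rfl), ← comulCoeff,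
        cls_eq_zero_iff.1 ((Sub.bot V).cls_toRep_eq_zero_iff.2 rfl), comulCoeff_zero_right,
        one_smul, delta_eq_single, cls_quotient_bot]
      exact TensorProduct.rid_tmul _ _ |>.trans (one_smul _ _)
    · intro X _ hX
      rw [LinearMap.map_smul, LinearMap.lTensor_tmul, dualHall_counit_delta,
        if_neg fun h => hX (X.cls_toRep_eq_zero_iff.1 h), TensorProduct.tmul_zero, smul_zero,
        map_zero]
    · exact fun h => (h (Finset.mem_univ _)).elim

theorem dualHall_comul_one : (dualHall F d).comul (dualHall F d).one =
    (dualHall F d).one ⊗ₜ[ℂ] (dualHall F d).one := by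
  have : Subsingleton (Rep.zero F d).Sub := ⟨fun X Y => Sub.ext fun i =>
    Submodule.ext fun y => ⟨fun _ => (Y.carrier i).zero_mem, fun _ => (X.carrier i).zero_mem⟩⟩
  rw [dualHall_one, dualHall_comul_delta, Fintype.sum_subsingleton _ (Sub.top _),
    delta_eq_single, delta_eq_single, (Sub.top _).cls_quotient_eq_zero_iff.2 rfl, cls_toRep_top,
    ← comulCoeff, cls_eq_zero_iff.1 ((Sub.top _).cls_quotient_eq_zero_iff.2 rfl),
    comulCoeff_zero_left, one_smul]
  rfl

theorem Rep.dimVec_nonneg (V : Rep F d) : 0 ≤ V.dimVec := fun _ => Int.natCast_nonneg _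

/-- If U is zero, its delta function is the unit. Otherwise both sides vanish, because every
extension of U by W has dimension vector at least that of U. -/
theorem dualHall_counit_mul (f g : IsoClass F d →₀ ℂ) : (dualHall F d).counit
    ((dualHall F d).mul f g) = (dualHall F d).counit f * (dualHall F d).counit g := by
  induction f using delta_induction with
  | h₀ => simp
  | hadd a b ha hb => simp only [map_add, LinearMap.add_apply, ha, hb, add_mul]
  | hsmul r U =>
  induction g using delta_induction with
  | h₀ => simp
  | hadd a b ha hb => simp only [map_add, ha, hb, mul_add]
  | hsmul s W =>
    simp only [LinearMap.map_smul, LinearMap.smul_apply, smul_eq_mul]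
    suffices h : (dualHall F d).counit ((dualHall F d).mul (delta U) (delta W)) =
        (dualHall F d).counit (delta U) * (dualHall F d).counit (delta W) by rw [h]; ring
    by_cases hU : U.cls = (Rep.zero F d).cls
    · have : delta U = (dualHall F d).one := by rw [delta, hU]; rfl
      rw [dualHall_counit_delta U, if_pos hU, this, dualHall_one_mul, one_mul]
    · rw [dualHall_mul_delta, LinearMap.map_smul, map_sum, Finset.sum_eq_zero, smul_zero,
        dualHall_counit_delta U, if_neg hU, zero_mul]
      intro c _
      rw [dualHall_counit_delta, if_neg]
      rw [cls_eq_zero_iff, dimVec_extension] at *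
      intro h
      refine hU (le_antisymm ?_ U.dimVec_nonneg)
      rw [← h]
      exact le_add_of_nonneg_right W.dimVec_nonneg

theorem dualHall_counit_one : (dualHall F d).counit (dualHall F d).one = 1 := by
  rw [dualHall_one, dualHall_counit_delta, if_pos rfl]

theorem dualHall_deg (V : Rep F d) : (dualHall F d).deg V.cls = -V.dimVec := by
  rw [← dimVec_cls]; rfl

theorem dualHall_mul_mem (β γ : I →₀ ℤ) : ∀ f ∈ (dualHall F d).component β,
    ∀ g ∈ (dualHall F d).component γ,
      (dualHall F d).mul f g ∈ (dualHall F d).component (β + γ) :=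
  (dualHall F d).map₂_mem_of_basis _ fun b c hb hc => by
    rw [← cls_out b, dualHall_deg] at hb
    rw [← cls_out c, dualHall_deg] at hc
    rw [← cls_out b, ← cls_out c, ← delta_eq_single, ← delta_eq_single, dualHall_mul_delta]
    refine Submodule.smul_mem _ _ (Submodule.sum_mem _ fun e _ => ?_)
    refine (dualHall F d).single_mem_component _ _ ?_
    rw [dualHall_deg, dimVec_extension, ← hb, ← hc, neg_add]

theorem dualHall_comul_mem (γ : I →₀ ℤ) : ∀ f ∈ (dualHall F d).component γ,
    (dualHall F d).comul f ∈ (dualHall F d).tensorComponent γ :=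
  (dualHall F d).map_mem_of_basis _ fun b hb => by
    rw [← cls_out b, dualHall_deg] at hb
    rw [← cls_out b, ← delta_eq_single, dualHall_comul_delta]
    refine Submodule.sum_mem _ fun X _ => Submodule.smul_mem _ _ (Submodule.subset_span ?_)
    refine ⟨_, _, ?_, rfl⟩
    rw [dualHall_deg, dualHall_deg, ← neg_add, X.dimVec_add, hb]

theorem dualHall_counit_eq_zero (γ : I →₀ ℤ) (hγ : γ ≠ 0) :
    ∀ f ∈ (dualHall F d).component γ, (dualHall F d).counit f = 0 := fun f hf => by
  have := (dualHall F d).map_mem_of_basis (dualHall F d).counit (P := ⊥) (fun b hb => by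
    rw [← cls_out b, dualHall_deg] at hb
    rw [← cls_out b, ← delta_eq_single, dualHall_counit_delta, if_neg]
    · exact Submodule.zero_mem _
    · rw [cls_eq_zero_iff]
      rintro h
      exact hγ (by rw [← hb, h, neg_zero])) f hf
  simpa using this

end ValuedQuiver

end

/-! ### Block decomposition of maps that preserve subrepresentations. -/

section

namespace ValuedQuiver

attribute [local instance 50] Fintype.ofFinite

variable {F : Type u} [Field F] [Finite F] {I : Type w} [Quiver.{x + 1} I] {d : I → ℕ}

open ValuedQuiver.Rep GradedBialgebra

namespace Rep

namespace SLin

variable {U W : Rep F d} (B : U.Sub) (D : W.Sub) {i j : I}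

/-- `f` maps `B` to `D`. -/
def Preserves (f : SLin U W i j) : Prop := ∀ y ∈ B.carrier i, f y ∈ D.carrier j

variable {B D}

/-- The restriction of `f` to `B → D`. -/
def restrict (f : SLin U W i j) (h : Preserves B D f) : SLin B.toRep D.toRep i j :=
  ⟨{ toFun := fun y : B.carrier i => (⟨f y.1, h y.1 y.2⟩ : D.carrier j)
     map_zero' := Subtype.ext f.1.map_zero
     map_add' := fun y z => Subtype.ext (f.1.map_add y.1 z.1) },
    fun c y => Subtype.ext (f.2 c y.1)⟩

/-- The map `U / B → W / D` induced by `f`. -/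
def descend (f : SLin U W i j) (h : Preserves B D f) : SLin B.quotient D.quotient i j :=
  ⟨QuotientAddGroup.map (B.carrier i).toAddSubgroup (D.carrier j).toAddSubgroup f.1 h,
    fun c y => by
      obtain ⟨y, rfl⟩ := (B.carrier i).mkQ_surjective y
      exact congrArg (D.carrier j).mkQ (f.2 c y)⟩

variable (B) in
/-- A linear projection onto a subrepresentation. -/
def retraction (i : I) : U.obj i →ₗ[extField F (d i)] B.carrier i :=
  Classical.choose ((B.carrier i).subtype.exists_leftInverse_of_injective
    (B.carrier i).ker_subtype)

theorem retraction_apply (i : I) (y : B.carrier i) : retraction B i y = y :=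
  LinearMap.congr_fun (Classical.choose_spec
    ((B.carrier i).subtype.exists_leftInverse_of_injective (B.carrier i).ker_subtype)) y

variable (D) in
/-- A linear section of the projection to the quotient by a subrepresentation. -/
def quotientSection (j : I) : (W.obj j ⧸ D.carrier j) →ₗ[extField F (d j)] W.obj j :=
  Classical.choose ((D.carrier j).mkQ.exists_rightInverse_of_surjective (D.carrier j).range_mkQ)

theorem mkQ_quotientSection (j : I) (y : W.obj j ⧸ D.carrier j) :
    (D.carrier j).mkQ (quotientSection D j y) = y :=
  LinearMap.congr_fun (Classical.choose_spec
    ((D.carrier j).mkQ.exists_rightInverse_of_surjective (D.carrier j).range_mkQ)) y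

variable (B D) in
/-- A map `U → W` that maps `B` to `D`, from its components. -/
def glue (k : SLin B.quotient D.toRep i j) (y : SLin B.quotient D.quotient i j)
    (z : SLin B.toRep D.toRep i j) : SLin U W i j :=
  conj (U := B.quotient) (W := D.toRep) (D.carrier j).subtype k (B.carrier i).mkQ +
  conj (U := B.quotient) (W := D.quotient) (quotientSection D j) y (B.carrier i).mkQ +
  conj (U := B.toRep) (W := D.toRep) (D.carrier j).subtype z (retraction B i)

theorem glue_apply (k : SLin B.quotient D.toRep i j) (y : SLin B.quotient D.quotient i j)
    (z : SLin B.toRep D.toRep i j) (v : U.obj i) : glue B D k y z v =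
      (D.carrier j).subtype (k.1 ((B.carrier i).mkQ v)) +
        quotientSection D j (y.1 ((B.carrier i).mkQ v)) +
        (D.carrier j).subtype (z.1 (retraction B i v)) := rfl

theorem glue_apply_of_mem (k : SLin B.quotient D.toRep i j) (y : SLin B.quotient D.quotient i j)
    (z : SLin B.toRep D.toRep i j) (v : B.carrier i) :
    glue B D k y z (v : U.obj i) = (D.carrier j).subtype (z.1 v) := by
  have h : (B.carrier i).mkQ (v : U.obj i) = 0 := (Submodule.Quotient.mk_eq_zero _).2 v.2
  have h1 : k.1 ((B.carrier i).mkQ (v : U.obj i)) = 0 := by rw [h]; exact k.1.map_zero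
  have h2 : y.1 ((B.carrier i).mkQ (v : U.obj i)) = 0 := by rw [h]; exact y.1.map_zero
  rw [glue_apply, retraction_apply, h1, h2]
  refine (congrArg₂ (· + ·) (congrArg₂ (· + ·) (D.carrier j).subtype.map_zero
    (quotientSection D j).map_zero) rfl).trans ?_
  rw [add_zero, zero_add]

theorem preserves_glue (k : SLin B.quotient D.toRep i j) (y : SLin B.quotient D.quotient i j)
    (z : SLin B.toRep D.toRep i j) : Preserves B D (glue B D k y z) := fun v hv => by
  rw [glue_apply_of_mem k y z ⟨v, hv⟩]
  exact (z.1 (⟨v, hv⟩ : B.carrier i) : D.carrier j).2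

theorem restrict_glue (k : SLin B.quotient D.toRep i j) (y : SLin B.quotient D.quotient i j)
    (z : SLin B.toRep D.toRep i j) (h : Preserves B D (glue B D k y z)) :
    restrict (glue B D k y z) h = z :=
  SLin.ext fun v => Subtype.ext (glue_apply_of_mem k y z v)

theorem mkQ_coe (v : D.carrier j) : (D.carrier j).mkQ ((D.carrier j).subtype v) = 0 :=
  (Submodule.Quotient.mk_eq_zero _).2 v.2

theorem descend_glue (k : SLin B.quotient D.toRep i j) (y : SLin B.quotient D.quotient i j)
    (z : SLin B.toRep D.toRep i j) (h : Preserves B D (glue B D k y z)) :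
    descend (glue B D k y z) h = y :=
  SLin.ext fun v => by
    obtain ⟨v, rfl⟩ := (B.carrier i).mkQ_surjective v
    change (D.carrier j).mkQ (glue B D k y z v) = _
    rw [glue_apply, _root_.map_add, _root_.map_add]
    exact (congrArg₂ (· + ·) (congrArg₂ (· + ·) (mkQ_coe _) (mkQ_quotientSection _ _))
      (mkQ_coe _)).trans ((add_zero _).trans (zero_add _))

/-- Descent to the quotients recovers `y` and restriction recovers `z`. After cancelling these two
blocks, what is left is `k` composed with an injection and a surjection. -/
theorem glue_injective {k k' : SLin B.quotient D.toRep i j} {y y' : SLin B.quotient D.quotient i j}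
    {z z' : SLin B.toRep D.toRep i j} (h : glue B D k y z = glue B D k' y' z') :
    k = k' ∧ y = y' ∧ z = z' := by
  have hy : y = y' := by
    rw [← descend_glue k y z (preserves_glue k y z), ← descend_glue k' y' z' (h ▸ preserves_glue k y z)]
    congr 1
  have hz : z = z' := by
    rw [← restrict_glue k y z (preserves_glue k y z),
      ← restrict_glue k' y' z' (h ▸ preserves_glue k y z)]
    congr 1
  refine ⟨SLin.ext fun v => ?_, hy, hz⟩
  subst hy hz
  obtain ⟨v, rfl⟩ := (B.carrier i).mkQ_surjective v
  have := congrArg (fun f : SLin U W i j => f v) h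
  simp only [glue_apply] at this
  exact (D.carrier j).injective_subtype (add_right_cancel (add_right_cancel this))

theorem exists_glue (f : SLin U W i j) (h : Preserves B D f) :
    ∃ k y z, glue B D k y z = f := by
  -- With the two diagonal blocks removed, the difference kills B and takes values in D, so it
  -- factors through a map U/B → D, the missing corner.
  let g : SLin U W i j := f - glue B D 0 (descend f h) (restrict f h)
  have hg : ∀ v, g v = f v - glue B D 0 (descend f h) (restrict f h) v := fun _ => rfl
  have hgB : ∀ v ∈ B.carrier i, g v = 0 := fun v hv => by
    rw [hg, glue_apply_of_mem 0 _ _ ⟨v, hv⟩]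
    exact sub_self _
  have hgD : ∀ v, g v ∈ D.carrier j := fun v => by
    have hp := preserves_glue 0 (descend f h) (restrict f h)
    have h1 : (D.carrier j).mkQ (glue B D 0 (descend f h) (restrict f h) v) =
        (D.carrier j).mkQ (f v) :=
      congrArg (fun y : SLin B.quotient D.quotient i j => y.1 ((B.carrier i).mkQ v))
        (descend_glue 0 (descend f h) (restrict f h) hp)
    refine (Submodule.Quotient.mk_eq_zero (D.carrier j)).1 ?_
    change (D.carrier j).mkQ (g v) = 0
    rw [hg, _root_.map_sub, h1, sub_self]
  let k₀ : U.obj i →+ D.carrier j :=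
    { toFun := fun v => ⟨g v, hgD v⟩
      map_zero' := Subtype.ext g.1.map_zero
      map_add' := fun v v' => Subtype.ext (g.1.map_add v v') }
  let k : SLin B.quotient D.toRep i j :=
    ⟨QuotientAddGroup.lift (B.carrier i).toAddSubgroup k₀
      (fun v hv => Subtype.ext (hgB v hv)), fun c y => by
        obtain ⟨y, rfl⟩ := (B.carrier i).mkQ_surjective y
        exact Subtype.ext (g.2 c y)⟩
  refine ⟨k, descend f h, restrict f h, SLin.ext fun v => ?_⟩
  have h2 : (D.carrier j).subtype (k.1 ((B.carrier i).mkQ v)) = g v := rfl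
  rw [glue_apply, h2, hg, glue_apply]
  have h3 : (D.carrier j).subtype ((0 : SLin B.quotient D.toRep i j).1 ((B.carrier i).mkQ v)) = 0 :=
    (D.carrier j).subtype.map_zero
  rw [h3]
  abel

end SLin

section Fam

variable {U W : Rep F d} {K : Type*} {s t : K → I}

/-- The members of the family map `B` to `D`. -/
def FamHom.Preserves (B : U.Sub) (D : W.Sub) (f : FamHom s t U W) : Prop :=
  ∀ e, SLin.Preserves B D (f e)

/-- The restriction of a family. -/
def FamHom.restrict {B : U.Sub} {D : W.Sub} (f : FamHom s t U W) (h : FamHom.Preserves B D f) :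
    FamHom s t B.toRep D.toRep := fun e => SLin.restrict (f e) (h e)

/-- The induced family of maps of quotients. -/
def FamHom.descend {B : U.Sub} {D : W.Sub} (f : FamHom s t U W) (h : FamHom.Preserves B D f) :
    FamHom s t B.quotient D.quotient := fun e => SLin.descend (f e) (h e)

/-- The components of a family preserving subrepresentations. -/
def FamHom.glueEquiv (s t : K → I) (B : U.Sub) (D : W.Sub) :
    FamHom s t B.quotient D.toRep × FamHom s t B.quotient D.quotient ×
      FamHom s t B.toRep D.toRep ≃ {f : FamHom s t U W // FamHom.Preserves B D f} :=
  Equiv.ofBijective (fun p => ⟨fun e => SLin.glue B D (p.1 e) (p.2.1 e) (p.2.2 e),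
      fun e => SLin.preserves_glue _ _ _⟩) <| by
    constructor
    · rintro ⟨k, y, z⟩ ⟨k', y', z'⟩ h
      have h' : ∀ e, _ := fun e => SLin.glue_injective (congrFun (congrArg Subtype.val h) e)
      rw [show k = k' from funext fun e => (h' e).1, show y = y' from funext fun e => (h' e).2.1,
        show z = z' from funext fun e => (h' e).2.2]
    · rintro ⟨f, hf⟩
      choose k y z h using fun e => SLin.exists_glue (f e) (hf e)
      exact ⟨(k, y, z), Subtype.ext (funext h)⟩

theorem FamHom.descend_glueEquiv (B : U.Sub) (D : W.Sub) (p) :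
    FamHom.descend _ (FamHom.glueEquiv s t B D p).2 = p.2.1 :=
  funext fun _ => SLin.descend_glue _ _ _ _

theorem FamHom.restrict_glueEquiv (B : U.Sub) (D : W.Sub) (p) :
    FamHom.restrict _ (FamHom.glueEquiv s t B D p).2 = p.2.2 :=
  funext fun _ => SLin.restrict_glue _ _ _ _

theorem FamHom.card_preserves (B : U.Sub) (D : W.Sub) :
    Nat.card {f : FamHom s t U W // FamHom.Preserves B D f} =
      Nat.card (FamHom s t B.quotient D.toRep) * (Nat.card (FamHom s t B.quotient D.quotient) *
        Nat.card (FamHom s t B.toRep D.toRep)) := by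
  rw [← Nat.card_congr (FamHom.glueEquiv s t B D), Nat.card_prod, Nat.card_prod]

end Fam

variable [IsAdmissible I d]

/-- A preserving cocycle consists of two diagonal blocks and a corner U/B → D. The summand ignores
the corner, which therefore contributes only its cardinality. -/
theorem sum_preserves {M : Type*} [AddCommMonoid M] [Module ℂ M] {U W : Rep F d} (B : U.Sub)
    (D : W.Sub) (φ : Cocycle B.quotient D.quotient → Cocycle B.toRep D.toRep → M) :
    ∑ f : {f : Cocycle U W // FamHom.Preserves B D f}, φ (f.1.descend f.2) (f.1.restrict f.2) =
      (Nat.card (Cocycle B.quotient D.toRep) : ℂ) •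
        ∑ y : Cocycle B.quotient D.quotient, ∑ z : Cocycle B.toRep D.toRep, φ y z := by
  rw [← Fintype.sum_prod_type', Nat.cast_smul_eq_nsmul, Nat.card_eq_fintype_card,
    ← Finset.card_univ, ← Finset.sum_const, ← Fintype.sum_prod_type']
  refine (Fintype.sum_equiv (FamHom.glueEquiv _ _ B D) _ _ fun p => ?_).symm
  rw [FamHom.descend_glueEquiv, FamHom.restrict_glueEquiv]

end Rep
end ValuedQuiver

end

/-! ### Green's formula and the compatibility of the Hall product with the coproduct. -/

section

namespace ValuedQuiver

attribute [local instance 50] Fintype.ofFinite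

variable {F : Type u} [Field F] [Finite F] {I : Type w} [Quiver.{x + 1} I] {d : I → ℕ}

open ValuedQuiver.Rep GradedBialgebra

theorem sum_subtype_eq_sum_dite {X M : Type*} [Fintype X] [AddCommMonoid M] (p : X → Prop)
    [DecidablePred p] {_ : Fintype {y // p y}} (g : {y // p y} → M) :
    ∑ y, g y = ∑ y, if h : p y then g ⟨y, h⟩ else 0 :=
  Finset.sum_of_injOn Subtype.val Subtype.val_injective.injOn (fun _ _ => Finset.mem_univ _)
    (fun y _ hy => dif_neg fun h => hy ⟨⟨y, h⟩, Finset.mem_coe.2 (Finset.mem_univ _), rfl⟩)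
    fun y _ => by rw [dif_pos y.2]

namespace Rep

section Shear

variable {U W : Rep F d}

/-- The change of a cocycle caused by a change of the splitting. -/
def shear (S : GradedHom U W) (c : Cocycle U W) : Cocycle U W := fun e =>
  c e + (SLin.conj .id (SLin.ofArrow W e.hom) (SLin.linear (S e.left)) -
    SLin.conj (SLin.linear (S e.right)) (SLin.ofArrow U e.hom) .id)

theorem shear_apply (S : GradedHom U W) (c : Cocycle U W) {i j : I} (a : i ⟶ j) (y : U.obj i) :
    shear S c ⟨i, j, a⟩ y = c ⟨i, j, a⟩ y + (W.map a (S i y) - S j (U.map a y)) := rfl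

/-- The shear is a translation, namely by the coboundary of `S`. -/
theorem shear_bijective (S : GradedHom U W) : Function.Bijective (shear S) :=
  (Equiv.addRight (fun e : Quiver.Total I =>
    (SLin.conj .id (SLin.ofArrow W e.hom) (SLin.linear (S e.left)) -
      SLin.conj (SLin.linear (S e.right)) (SLin.ofArrow U e.hom) .id : SLin U W _ _))).bijective

/-- A change of the splitting gives isomorphic extensions. -/
def shearIso (S : GradedHom U W) (c : Cocycle U W) :
    Iso (extension (shear S c)) (extension c) where
  equiv i :=
    { toFun := fun y => (y.1, S i y.1 + y.2)
      map_add' := fun y z => by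
        refine Prod.ext rfl ?_
        change S i (y.1 + z.1) + (y.2 + z.2) = (S i y.1 + y.2) + (S i z.1 + z.2)
        rw [SLin.map_add]; abel
      map_smul' := fun r y => by
        refine Prod.ext rfl ?_
        exact (congrArg (· + r • y.2) ((SLin.linear (S i)).map_smul r y.1)).trans
          (smul_add _ _ _).symm
      invFun := fun y => (y.1, y.2 - S i y.1)
      left_inv := fun y => Prod.ext rfl (add_sub_cancel_left _ _)
      right_inv := fun y => Prod.ext rfl (add_sub_cancel _ _) }
  comm {i j} a y := by
    change (U.map a y.1, S j (U.map a y.1) + (shear S c ⟨i, j, a⟩ y.1 + W.map a y.2)) =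
      (U.map a y.1, c ⟨i, j, a⟩ y.1 + W.map a (S i y.1 + y.2))
    rw [shear_apply, map_add]
    refine Prod.ext rfl ?_
    change _ + (_ + _ + _) = _ + (_ + _)
    abel

/-- The subrepresentation `B ⊕ D` of an extension. -/
def splitSub {B : U.Sub} {D : W.Sub} (c : Cocycle U W) (h : FamHom.Preserves B D c) :
    (extension c).Sub where
  carrier i := (B.carrier i).prod (D.carrier i)
  map_mem {i j} a y hy := ⟨B.map_mem a y.1 hy.1,
    (D.carrier j).add_mem (h ⟨i, j, a⟩ y.1 hy.1) (D.map_mem a y.2 hy.2)⟩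

theorem cls_splitSub {B : U.Sub} {D : W.Sub} (c : Cocycle U W) (h : FamHom.Preserves B D c) :
    (splitSub c h).toRep.cls = (extension (FamHom.restrict c h)).cls :=
  ((splitSub c h).toRepIso (W := extension (FamHom.restrict c h))
    (fun i => (B.carrier i).subtype.prodMap (D.carrier i).subtype)
    (fun a y => rfl)
    (fun i => (B.carrier i).injective_subtype.prodMap (D.carrier i).injective_subtype)
    (fun i => by
      refine (LinearMap.range_prodMap _ _).trans ?_
      exact congrArg₂ (fun p q => Submodule.prod p q) (B.carrier i).range_subtype
        (D.carrier i).range_subtype)).cls_eq.symm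

theorem cls_quotient_splitSub {B : U.Sub} {D : W.Sub} (c : Cocycle U W)
    (h : FamHom.Preserves B D c) :
    (splitSub c h).quotient.cls = (extension (FamHom.descend c h)).cls :=
  ((splitSub c h).quotientIso (W := extension (FamHom.descend c h))
    (fun i => (B.carrier i).mkQ.prodMap (D.carrier i).mkQ)
    (fun _ _ => rfl)
    (fun i => (B.carrier i).mkQ_surjective.prodMap (D.carrier i).mkQ_surjective)
    (fun i _ => Prod.ext_iff.trans (and_congr
      (Submodule.Quotient.mk_eq_zero (B.carrier i))
      (Submodule.Quotient.mk_eq_zero (D.carrier i))))).cls_eq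

/-- `Y` is the image of `B ⊕ D` under the shear with `S`. -/
def IsSheared {c : Cocycle U W} (Y : (extension c).Sub) (B : U.Sub) (D : W.Sub)
    (S : GradedHom U W) : Prop :=
  ∀ (i : I) (y : U.obj i × W.obj i),
    y ∈ Y.carrier i ↔ y.1 ∈ B.carrier i ∧ y.2 - S i y.1 ∈ D.carrier i

/-- For y in B the vector (y, S y) lies in Y. Apply an arrow to it and read the membership in Y of
the result: its D-condition is the assertion for the sheared cocycle. -/
theorem IsSheared.preserves {c : Cocycle U W} {Y : (extension c).Sub} {B : U.Sub} {D : W.Sub}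
    {S : GradedHom U W} (h : IsSheared Y B D S) : FamHom.Preserves B D (shear S c) := by
  rintro ⟨i, j, a⟩ y hy
  have h1 : ((y, S i y) : U.obj i × W.obj i) ∈ Y.carrier i :=
    (h i _).2 ⟨hy, by rw [sub_self]; exact (D.carrier i).zero_mem⟩
  have h2 := ((h j _).1 (Y.map_mem a _ h1)).2
  change shear S c ⟨i, j, a⟩ y ∈ D.carrier j
  rw [shear_apply, ← add_sub_assoc]
  exact h2

theorem isSheared_iff {c : Cocycle U W} (Y : (extension c).Sub) {B : U.Sub} {D : W.Sub}
    {S : GradedHom U W} (h : FamHom.Preserves B D (shear S c)) :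
    IsSheared Y B D S ↔ Y = (shearIso S c).mapSub (splitSub (shear S c) h) := by
  have h1 : IsSheared ((shearIso S c).mapSub (splitSub (shear S c) h)) B D S := fun i y => by
    constructor
    · rintro ⟨z, hz, rfl⟩
      refine ⟨hz.1, ?_⟩
      change (S i z.1 + z.2) - S i z.1 ∈ _
      rw [add_sub_cancel_left]
      exact hz.2
    · rintro ⟨h1, h2⟩
      exact ⟨(y.1, y.2 - S i y.1), ⟨h1, h2⟩, Prod.ext rfl (add_sub_cancel _ _)⟩
  constructor
  · intro h2
    exact Sub.ext fun i => Submodule.ext fun y => (h2 i y).trans (h1 i y).symm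
  · rintro rfl
    exact h1

/-- Every subrepresentation of an extension is the image under a shear of `B ⊕ D` for unique
`B` and `D`. -/
theorem exists_isSheared {c : Cocycle U W} (Y : (extension c).Sub) :
    ∃ B D S, IsSheared Y B D S := by
  let B : U.Sub :=
    { carrier := fun i => (Y.carrier i).map (LinearMap.fst _ (U.obj i) (W.obj i))
      map_mem := by
        rintro i j a _ ⟨y, hy, rfl⟩
        exact ⟨_, Y.map_mem a y hy, rfl⟩ }
  let D : W.Sub :=
    { carrier := fun i => (Y.carrier i).comap (LinearMap.inr _ (U.obj i) (W.obj i))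
      map_mem := fun {i j} a y hy => by
        have h := Y.map_mem a ((0, y) : U.obj i × W.obj i) hy
        rw [extension_map] at h
        simp only [_root_.map_zero, zero_add] at h
        exact h }
  have hS : ∀ i, ∃ S : U.obj i →ₗ[extField F (d i)] W.obj i, ∀ y ∈ B.carrier i,
      ((y, S y) : U.obj i × W.obj i) ∈ Y.carrier i := fun i => by
    let Yi : Submodule (extField F (d i)) (U.obj i × W.obj i) := Y.carrier i
    let g : Yi →ₗ[extField F (d i)] B.carrier i :=
      (LinearMap.fst _ (U.obj i) (W.obj i)).restrict fun y hy => ⟨y, hy, rfl⟩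
    have hg : Function.Surjective g := by
      rintro ⟨_, y, hy, rfl⟩
      exact ⟨⟨y, hy⟩, rfl⟩
    -- A linear section of the projection Y → B at the vertex i, followed by the second coordinate,
    -- describes Y over B; it is then extended arbitrarily from B to U.
    obtain ⟨r, hr⟩ := g.exists_rightInverse_of_surjective (LinearMap.range_eq_top.2 hg)
    obtain ⟨S, hS⟩ := LinearMap.exists_extend
      ((LinearMap.snd _ (U.obj i) (W.obj i)).comp (Yi.subtype.comp r))
    refine ⟨S, fun y hy => ?_⟩
    have h1 : S y = (r ⟨y, hy⟩ : U.obj i × W.obj i).2 := LinearMap.congr_fun hS ⟨y, hy⟩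
    have h2 : (r ⟨y, hy⟩ : U.obj i × W.obj i).1 = y :=
      congrArg Subtype.val (LinearMap.congr_fun hr ⟨y, hy⟩)
    have h3 : ((y, S y) : U.obj i × W.obj i) = r ⟨y, hy⟩ := Prod.ext h2.symm h1
    rw [h3]
    exact (r ⟨y, hy⟩).2
  choose S hS using hS
  refine ⟨B, D, fun i => SLin.ofLinear (S i), fun i y => ?_⟩
  have key : ∀ hy : y.1 ∈ B.carrier i, (y ∈ Y.carrier i ↔ y.2 - S i y.1 ∈ D.carrier i) :=
    fun hy => by
      have h := hS i y.1 hy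
      have e : y = (y.1, S i y.1) + (0, y.2 - S i y.1) :=
        Prod.ext (add_zero _).symm (add_sub_cancel _ _).symm
      conv_lhs => rw [e]
      exact (Y.carrier i).add_mem_iff_right h
  constructor
  · intro hy
    have hB : y.1 ∈ B.carrier i := ⟨y, hy, rfl⟩
    exact ⟨hB, (key hB).1 hy⟩
  · rintro ⟨hB, hD⟩
    exact (key hB).2 hD

/-- The test vectors (y, S y) with y in B and (0, y) with y in D lie in Y, and their membership in
terms of the primed data gives the inclusions. -/
theorem IsSheared.unique {c : Cocycle U W} {Y : (extension c).Sub} {B B' : U.Sub} {D D' : W.Sub}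
    {S S' : GradedHom U W} (h : IsSheared Y B D S) (h' : IsSheared Y B' D' S') :
    B = B' ∧ D = D' := by
  have hB : ∀ {B B' : U.Sub} {D D' : W.Sub} {S S' : GradedHom U W}, IsSheared Y B D S →
      IsSheared Y B' D' S' → ∀ i, B.carrier i ≤ B'.carrier i := fun {B B' D D' S S'} h h' i y hy =>
    ((h' i (y, S i y)).1 ((h i _).2 ⟨hy, by
      rw [sub_self]; exact (D.carrier i).zero_mem⟩)).1
  have hD : ∀ {B B' : U.Sub} {D D' : W.Sub} {S S' : GradedHom U W}, IsSheared Y B D S →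
      IsSheared Y B' D' S' → ∀ i, D.carrier i ≤ D'.carrier i := fun {B B' D D' S S'} h h' i y hy => by
    have h1 := ((h' i (0, y)).1 ((h i _).2 ⟨(B.carrier i).zero_mem, by
      rw [SLin.map_zero, sub_zero]; exact hy⟩)).2
    rwa [SLin.map_zero, sub_zero] at h1
  exact ⟨Sub.ext fun i => le_antisymm (hB h h' i) (hB h' h i),
    Sub.ext fun i => le_antisymm (hD h h' i) (hD h' h i)⟩

/-- The shears that describe a given Y form a coset of the group of families mapping B to D. Hence
their number does not depend on Y, which is what the averaging in `sum_isSheared` requires. -/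
theorem IsSheared.iff_preserves {c : Cocycle U W} {Y : (extension c).Sub} {B : U.Sub} {D : W.Sub}
    {S : GradedHom U W} (h : IsSheared Y B D S) (S' : GradedHom U W) :
    IsSheared Y B D S' ↔ FamHom.Preserves B D (S' - S) := by
  have e : ∀ i (y : U.obj i), (S' - S) i y = S' i y - S i y := fun _ _ => rfl
  constructor
  · intro h' i y hy
    have h1 := ((h i (y, S' i y)).1 ((h' i _).2 ⟨hy, by
      rw [sub_self]; exact (D.carrier i).zero_mem⟩)).2
    rw [e]
    exact h1
  · intro h' i y
    rw [h i y]
    refine and_congr_right fun hy => ?_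
    have h1 := h' i y.1 hy
    rw [e] at h1
    rw [← (D.carrier i).sub_mem_iff_left h1]
    rw [show y.2 - S i y.1 - (S' i y.1 - S i y.1) = y.2 - S' i y.1 by abel]

theorem IsSheared.card {c : Cocycle U W} {Y : (extension c).Sub} {B : U.Sub} {D : W.Sub}
    {S : GradedHom U W} (h : IsSheared Y B D S) :
    Nat.card {S' : GradedHom U W // IsSheared Y B D S'} =
      Nat.card {S' : GradedHom U W // FamHom.Preserves B D S'} :=
  Nat.card_congr ((Equiv.subRight S).subtypeEquiv fun S' => h.iff_preserves S')

end Shear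

section Green

variable [IsAdmissible I d] {M : Type*} [AddCommMonoid M] [Module ℂ M] {U W : Rep F d}

-- A partition of unity: each Y has exactly one pair (B, D), and the shears producing it are
-- averaged with equal weights.
open Classical in
theorem sum_isSheared {c : Cocycle U W} (Y : (extension c).Sub) :
    ∑ B : U.Sub, ∑ D : W.Sub, ∑ S : GradedHom U W, (if IsSheared Y B D S then
      (Nat.card {S' : GradedHom U W // FamHom.Preserves B D S'} : ℂ)⁻¹ else 0) = 1 := by
  obtain ⟨B, D, S, h⟩ := exists_isSheared Y
  rw [Finset.sum_eq_single B, Finset.sum_eq_single D]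
  · rw [← Finset.sum_filter, Finset.sum_const, nsmul_eq_mul, ← Fintype.card_subtype,
      ← Nat.card_eq_fintype_card, h.card]
    refine mul_inv_cancel₀ ?_
    have : Nonempty {S' : GradedHom U W // FamHom.Preserves B D S'} :=
      ⟨⟨0, fun e y _ => (D.carrier e).zero_mem⟩⟩
    exact_mod_cast Nat.card_pos.ne'
  · intro D' _ hD
    exact Finset.sum_eq_zero fun S' _ => if_neg fun h' => hD (h.unique h').2.symm
  · exact fun h => (h (Finset.mem_univ _)).elim
  · intro B' _ hB
    exact Finset.sum_eq_zero fun D' _ => Finset.sum_eq_zero fun S' _ =>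
      if_neg fun h' => hB (h.unique h').1.symm
  · exact fun h => (h (Finset.mem_univ _)).elim

-- For fixed B, D, S at most one Y satisfies the condition, the image of B ⊕ D under the shear. It
-- is a subrepresentation exactly when the sheared cocycle maps B to D, and its class and that of
-- its quotient are then those of the restricted and the descended cocycle.
open Classical in
theorem sum_sub_isSheared (c : Cocycle U W) (B : U.Sub) (D : W.Sub) (S : GradedHom U W)
    (φ : IsoClass F d → IsoClass F d → M) :
    ∑ Y : (extension c).Sub, (if IsSheared Y B D S then φ Y.quotient.cls Y.toRep.cls else 0) =
      if h : FamHom.Preserves B D (shear S c) then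
        φ (extension ((shear S c).descend h)).cls (extension ((shear S c).restrict h)).cls
      else 0 := by
  split_ifs with h
  · simp only [fun Y : (extension c).Sub => isSheared_iff Y h]
    rw [Finset.sum_ite_eq' Finset.univ, if_pos (Finset.mem_univ _), Iso.cls_mapSub,
      Iso.cls_quotient_mapSub, cls_splitSub, cls_quotient_splitSub]
  · exact Finset.sum_eq_zero fun Y _ => if_neg fun hY => h hY.preserves

/-- Green's formula. -/
theorem sum_extension_sub (U W : Rep F d) (φ : IsoClass F d → IsoClass F d → M) :
    ∑ c : Cocycle U W, ∑ Y : (extension c).Sub, φ Y.quotient.cls Y.toRep.cls =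
      ∑ B : U.Sub, ∑ D : W.Sub,
        ((Nat.card (GradedHom U W) : ℂ) *
          (Nat.card {S : GradedHom U W // FamHom.Preserves B D S} : ℂ)⁻¹ *
          (Nat.card (Cocycle B.quotient D.toRep) : ℂ)) •
        ∑ y : Cocycle B.quotient D.quotient, ∑ z : Cocycle B.toRep D.toRep,
          φ (extension y).cls (extension z).cls := by
  classical
  -- Insert the partition of unity, so that B, D, S can be summed before the cocycle and Y.
  have h1 : ∀ (c : Cocycle U W) (Y : (extension c).Sub), φ Y.quotient.cls Y.toRep.cls =
      ∑ B : U.Sub, ∑ D : W.Sub, ∑ S : GradedHom U W,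
        (Nat.card {S' : GradedHom U W // FamHom.Preserves B D S'} : ℂ)⁻¹ •
          (if IsSheared Y B D S then φ Y.quotient.cls Y.toRep.cls else 0) := fun c Y => by
    conv_lhs => rw [← one_smul ℂ (φ Y.quotient.cls Y.toRep.cls), ← sum_isSheared Y]
    simp only [Finset.sum_smul, ite_smul, zero_smul, smul_ite, smul_zero]
  have h2 : ∑ c : Cocycle U W, ∑ Y : (extension c).Sub, φ Y.quotient.cls Y.toRep.cls =
      ∑ B : U.Sub, ∑ D : W.Sub, ∑ S : GradedHom U W, ∑ c : Cocycle U W,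
        (Nat.card {S' : GradedHom U W // FamHom.Preserves B D S'} : ℂ)⁻¹ •
          ∑ Y : (extension c).Sub, (if IsSheared Y B D S then φ Y.quotient.cls Y.toRep.cls
            else 0) := by
    have h3 : ∀ c : Cocycle U W, ∑ Y : (extension c).Sub, φ Y.quotient.cls Y.toRep.cls =
      ∑ B : U.Sub, ∑ D : W.Sub, ∑ S : GradedHom U W,
        (Nat.card {S' : GradedHom U W // FamHom.Preserves B D S'} : ℂ)⁻¹ •
          ∑ Y : (extension c).Sub, (if IsSheared Y B D S then φ Y.quotient.cls Y.toRep.cls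
            else 0) := fun c => by
      rw [Finset.sum_congr rfl fun Y _ => h1 c Y, Finset.sum_comm]
      refine Finset.sum_congr rfl fun B _ => ?_
      rw [Finset.sum_comm]
      refine Finset.sum_congr rfl fun D _ => ?_
      rw [Finset.sum_comm]
      exact Finset.sum_congr rfl fun S _ => Finset.smul_sum.symm
    rw [Finset.sum_congr rfl fun c _ => h3 c, Finset.sum_comm]
    refine Finset.sum_congr rfl fun B _ => ?_
    rw [Finset.sum_comm]
    refine Finset.sum_congr rfl fun D _ => ?_
    rw [Finset.sum_comm]
  rw [h2]
  refine Finset.sum_congr rfl fun B _ => Finset.sum_congr rfl fun D _ => ?_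
  -- For fixed S the substitution c ↦ `shear S c` permutes the cocycles, so the value does not
  -- depend on S. Only cocycles mapping B to D contribute, and their corner gives the factor
  -- |`Cocycle B.quotient D.toRep`|.
  have h4 : ∀ S : GradedHom U W, ∑ c : Cocycle U W,
        (Nat.card {S' : GradedHom U W // FamHom.Preserves B D S'} : ℂ)⁻¹ •
          ∑ Y : (extension c).Sub, (if IsSheared Y B D S then φ Y.quotient.cls Y.toRep.cls
            else 0) =
      (Nat.card {S' : GradedHom U W // FamHom.Preserves B D S'} : ℂ)⁻¹ •
        ((Nat.card (Cocycle B.quotient D.toRep) : ℂ) •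
        ∑ y : Cocycle B.quotient D.quotient, ∑ z : Cocycle B.toRep D.toRep,
          φ (extension y).cls (extension z).cls) := fun S => by
    rw [← Finset.smul_sum]
    congr 1
    simp only [sum_sub_isSheared]
    rw [(shear_bijective S).sum_comp fun c : Cocycle U W => if h : FamHom.Preserves B D c then
        φ (extension (c.descend h)).cls (extension (c.restrict h)).cls else 0,
      ← sum_preserves B D fun y z => φ (extension y).cls (extension z).cls]
    exact (sum_subtype_eq_sum_dite (FamHom.Preserves B D) fun c =>
      φ (extension (c.1.descend c.2)).cls (extension (c.1.restrict c.2)).cls).symm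
  rw [Finset.sum_congr rfl fun S _ => h4 S, Finset.sum_const, Finset.card_univ,
    ← Nat.card_eq_fintype_card, ← Nat.cast_smul_eq_nsmul ℂ, smul_smul, smul_smul]

end Green

end Rep

/-- After Green's formula both sides are sums over the same data: B in U, D in W, a cocycle for the
quotients and one for the subrepresentations. Only scalars remain to be compared. -/
theorem dualHall_comul_mul (f g : IsoClass F d →₀ ℂ) [IsAdmissible I d] :
    (dualHall F d).comul ((dualHall F d).mul f g) =
      (dualHall F d).twistedMul (twist F d) ((dualHall F d).comul f) ((dualHall F d).comul g) := by
  induction f using delta_induction with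
  | h₀ => simp
  | hadd a b ha hb => simp only [map_add, LinearMap.add_apply, ha, hb]
  | hsmul r U =>
  induction g using delta_induction with
  | h₀ => simp
  | hadd a b ha hb => simp only [map_add, ha, hb]
  | hsmul s W =>
    simp only [LinearMap.map_smul, LinearMap.smul_apply]
    congr 2
    have hl : (dualHall F d).comul ((dualHall F d).mul (delta U) (delta W)) =
        mulCoeff F d U.dimVec W.dimVec • ∑ c : Cocycle U W, ∑ Y : (extension c).Sub,
          comulCoeff F d Y.quotient.cls.dimVec Y.toRep.cls.dimVec •
            (Finsupp.single Y.quotient.cls (1 : ℂ) ⊗ₜ[ℂ] Finsupp.single Y.toRep.cls (1 : ℂ)) := by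
      rw [dualHall_mul_delta, LinearMap.map_smul, map_sum]
      simp only [dualHall_comul_delta']
    rw [hl, sum_extension_sub U W fun a b => comulCoeff F d a.dimVec b.dimVec •
      (Finsupp.single a (1 : ℂ) ⊗ₜ[ℂ] Finsupp.single b (1 : ℂ)), dualHall_comul_delta,
      dualHall_comul_delta, Finset.smul_sum]
    simp only [map_sum, LinearMap.sum_apply]
    rw [Finset.sum_comm (s := (Finset.univ : Finset W.Sub))]
    refine Finset.sum_congr rfl fun B _ => ?_
    rw [Finset.smul_sum]
    refine Finset.sum_congr rfl fun D _ => ?_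
    rw [LinearMap.map_smul, LinearMap.map_smul, LinearMap.smul_apply]
    rw [delta_eq_single, delta_eq_single, delta_eq_single, delta_eq_single,
      StructureMaps.twistedMul_tmul, ← delta_eq_single, ← delta_eq_single, ← delta_eq_single,
      ← delta_eq_single, dualHall_mul_delta, dualHall_mul_delta, dualHall_deg, dualHall_deg]
    simp only [← TensorProduct.smul_tmul', TensorProduct.tmul_smul, TensorProduct.sum_tmul,
      TensorProduct.tmul_sum, smul_smul, Finset.smul_sum, dimVec_cls, dimVec_extension]
    rw [Finset.sum_comm]
    refine Finset.sum_congr rfl fun z _ => Finset.sum_congr rfl fun y _ => ?_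
    rw [← delta_eq_single, ← delta_eq_single]
    congr 1
    -- Expand everything in the dimension vectors of U/B, B, W/D, D. The form for vertexwise maps
    -- matches in every pair and the Euler terms of (U/B, D) cancel. What is left over is ⟨B, W/D⟩ +
    -- ⟨W/D, B⟩, the exponent of the twist.
    rw [← B.dimVec_add, ← D.dimVec_add, FamHom.card_preserves]
    push_cast
    rw [card_gradedHom, card_gradedHom, card_gradedHom, card_gradedHom, card_cocycle,
      ← B.dimVec_add, ← D.dimVec_add]
    simp only [← vHalfPow_neg, mulCoeff, comulCoeff, twist, ← vHalfPow_add, symForm_neg_neg]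
    congr 1
    simp only [symForm_eq, euler_add_left, euler_add_right, homForm_add_left,
      homForm_add_right]
    ring

end ValuedQuiver

end

/-! ### Shuffle permutations sorted by their first letter. -/

section

namespace ValuedQuiver

section InsertPerm

/-- The permutation of `Fin (n + 1)` that maps `0` to `p` and is given by `τ` otherwise. -/
def insertPerm {n : ℕ} (p : Fin (n + 1)) (τ : Equiv.Perm (Fin n)) : Equiv.Perm (Fin (n + 1)) :=
  ((finSuccEquiv' 0).trans (Equiv.optionCongr τ)).trans (finSuccEquiv' p).symm

variable {n : ℕ} (p : Fin (n + 1)) (τ : Equiv.Perm (Fin n))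

theorem insertPerm_zero : insertPerm p τ 0 = p := by
  simp [insertPerm, finSuccEquiv'_at]

theorem insertPerm_succ (k : Fin n) : insertPerm p τ k.succ = p.succAbove (τ k) := by
  simp [insertPerm, finSuccEquiv'_zero]

theorem insertPerm_symm_self : (insertPerm p τ).symm p = 0 := by
  rw [Equiv.symm_apply_eq, insertPerm_zero]

theorem insertPerm_symm_succAbove (k : Fin n) :
    (insertPerm p τ).symm (p.succAbove k) = (τ.symm k).succ := by
  rw [Equiv.symm_apply_eq, insertPerm_succ, Equiv.apply_symm_apply]

theorem insertPerm_bijective : Function.Bijective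
    fun q : Fin (n + 1) × Equiv.Perm (Fin n) => insertPerm q.1 q.2 := by
  rw [Fintype.bijective_iff_injective_and_card]
  constructor
  · rintro ⟨p, τ⟩ ⟨p', τ'⟩ h
    have hp : p = p' := by
      have := congrArg (fun σ : Equiv.Perm (Fin (n + 1)) => σ 0) h
      simpa only [insertPerm_zero] using this
    subst hp
    refine Prod.ext rfl (Equiv.ext fun k => ?_)
    have := congrArg (fun σ : Equiv.Perm (Fin (n + 1)) => σ k.succ) h
    simpa only [insertPerm_succ, Fin.succAbove_right_inj] using this
  · rw [Fintype.card_prod, Fintype.card_perm, Fintype.card_perm, Fintype.card_fin,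
      Fintype.card_fin, Nat.factorial_succ]

/-- The number of the remaining letters of the first word after `p` is removed. -/
def cutAfter (r p : ℕ) : ℕ := if p < r then r - 1 else r

theorem succAbove_lt_iff (r : ℕ) (k : Fin n) :
    (p.succAbove k : ℕ) < r ↔ (k : ℕ) < cutAfter r p := by
  rw [cutAfter]
  rcases lt_or_ge k.castSucc p with h | h
  · rw [Fin.succAbove_of_castSucc_lt _ _ h]
    have : (k : ℕ) < p := h
    rw [Fin.val_castSucc]
    split_ifs <;> omega
  · rw [Fin.succAbove_of_le_castSucc _ _ h]
    have : (p : ℕ) ≤ k := h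
    rw [Fin.val_succ]
    split_ifs <;> omega

theorem le_succAbove_iff (r : ℕ) (k : Fin n) :
    r ≤ (p.succAbove k : ℕ) ↔ cutAfter r p ≤ (k : ℕ) := by
  rw [← not_lt, succAbove_lt_iff, not_lt]

/-- The value p at 0 is the index of the letter placed first. A shuffle keeps the order inside each
of the two words, so p must be the initial letter of one of them, and the remaining letters form a
shuffle of the shortened words. -/
theorem isShuffle_insertPerm (r : ℕ) : IsShuffle r (insertPerm p τ) ↔
    ((p : ℕ) = 0 ∨ (p : ℕ) = r) ∧ IsShuffle (cutAfter r p) τ := by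
  constructor
  · intro h
    refine ⟨?_, fun k l hkl hr => ?_⟩
    · by_contra hne
      rw [not_or] at hne
      -- Otherwise the letter p - 1 belongs to the same word as p and would have to stand before
      -- position 0.
      have hp : 0 < (p : ℕ) := Nat.pos_of_ne_zero hne.1
      have h1 := h ⟨(p : ℕ) - 1, by omega⟩ p (Fin.lt_def.2 (by change (p : ℕ) - 1 < p; omega))
        (by change (p : ℕ) < r ∨ r ≤ (p : ℕ) - 1; omega)
      rw [insertPerm_symm_self] at h1
      exact absurd h1 (Fin.not_lt_zero _)
    · have h1 := h (p.succAbove k) (p.succAbove l) (Fin.succAbove_lt_succAbove_iff.2 hkl)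
        (hr.imp (succAbove_lt_iff p r l).2 fun h2 =>
          not_lt.1 fun h3 => not_lt.2 h2 ((succAbove_lt_iff p r k).1 h3))
      rwa [insertPerm_symm_succAbove, insertPerm_symm_succAbove, Fin.succ_lt_succ_iff] at h1
  · rintro ⟨hp, h⟩ k l hkl hr
    rcases Fin.eq_self_or_eq_succAbove p l with rfl | ⟨l, rfl⟩
    · exfalso
      have h1 : (k : ℕ) < l := hkl
      omega
    · rw [insertPerm_symm_succAbove]
      rcases Fin.eq_self_or_eq_succAbove p k with rfl | ⟨k, rfl⟩
      · rw [insertPerm_symm_self]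
        exact Fin.succ_pos _
      · rw [insertPerm_symm_succAbove, Fin.succ_lt_succ_iff]
        exact h k l (Fin.succAbove_lt_succAbove_iff.1 hkl)
          (hr.imp (succAbove_lt_iff p r l).1 fun h2 =>
            not_lt.1 fun h3 => not_lt.2 h2 ((succAbove_lt_iff p r k).2 h3))

end InsertPerm

section ShuffleSum

variable (F : Type u) [Field F] [Finite F] {I : Type w} [Quiver.{x + 1} I] (d : I → ℕ)

/-- Twice the exponent `ζ(σ)` for a word given as a function. -/
def twoZetaFun {n : ℕ} (g : Fin n → I) (r : ℕ) (σ : Equiv.Perm (Fin n)) : ℤ :=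
  ∑ k : Fin n, ∑ l : Fin n,
    if k.val < r ∧ r ≤ l.val then
      (if σ.symm l < σ.symm k then 1 else -1) *
        symForm d (wordDegree [g k]) (wordDegree [g l])
    else 0

open Classical in
/-- The sum over the shuffles for a word given as a function. -/
def shuffleSum {n : ℕ} (g : Fin n → I) (r : ℕ) : List I →₀ ℂ :=
  ∑ σ : Equiv.Perm (Fin n),
    if IsShuffle r σ then
      Finsupp.single (List.ofFn fun k => g (σ k)) (vHalfPow F (twoZetaFun d g r σ))
    else 0

theorem shuffleWords_eq_shuffleSum (j₁ j₂ : List I) :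
    shuffleWords F d j₁ j₂ = shuffleSum F d (j₁ ++ j₂).get j₁.length := rfl

/-- The contribution of the first letter to the exponent. -/
def firstZeta {n : ℕ} (g : Fin (n + 1) → I) (r : ℕ) (p : Fin (n + 1)) : ℤ :=
  if (p : ℕ) < r then
    -∑ l : Fin n, if r ≤ (p.succAbove l : ℕ) then
      symForm d (wordDegree [g p]) (wordDegree [g (p.succAbove l)]) else 0
  else
    ∑ k : Fin n, if (p.succAbove k : ℕ) < r then
      symForm d (wordDegree [g (p.succAbove k)]) (wordDegree [g p]) else 0

/-- Separate the pairs that contain p from the others. Since p stands first, its pairs all count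
with sign - if p is in the first word and with sign + if it is in the second. -/
theorem twoZetaFun_insertPerm {n : ℕ} (g : Fin (n + 1) → I) (r : ℕ) (p : Fin (n + 1))
    (τ : Equiv.Perm (Fin n)) : twoZetaFun d g r (insertPerm p τ) =
      firstZeta d g r p + twoZetaFun d (fun k => g (p.succAbove k)) (cutAfter r p) τ := by
  have h1 : ∀ k l : Fin n, (if (p.succAbove k : ℕ) < r ∧ r ≤ (p.succAbove l : ℕ) then
      (if (insertPerm p τ).symm (p.succAbove l) < (insertPerm p τ).symm (p.succAbove k)
        then (1 : ℤ) else -1) *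
        symForm d (wordDegree [g (p.succAbove k)]) (wordDegree [g (p.succAbove l)]) else 0) =
      (if k.val < cutAfter r p ∧ cutAfter r p ≤ l.val then
      (if τ.symm l < τ.symm k then 1 else -1) *
        symForm d (wordDegree [g (p.succAbove k)]) (wordDegree [g (p.succAbove l)])
      else 0) := fun k l => by
    simp only [insertPerm_symm_succAbove, succAbove_lt_iff, le_succAbove_iff, Fin.succ_lt_succ_iff]
  rw [twoZetaFun, Fin.sum_univ_succAbove _ p, Fin.sum_univ_succAbove _ p]
  simp only [fun k : Fin n => Fin.sum_univ_succAbove (fun l : Fin (n + 1) =>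
    if (p.succAbove k : ℕ) < r ∧ r ≤ l.val then
      (if (insertPerm p τ).symm l < (insertPerm p τ).symm (p.succAbove k)
        then (1 : ℤ) else -1) *
        symForm d (wordDegree [g (p.succAbove k)]) (wordDegree [g l]) else 0) p, h1,
    Finset.sum_add_distrib]
  rw [← add_assoc, if_neg (by omega), zero_add]
  change _ = firstZeta d g r p + ∑ k : Fin n, ∑ l : Fin n, _
  congr 1
  rw [firstZeta]
  split_ifs with hp
  · rw [Finset.sum_congr rfl (s₁ := Finset.univ) (f := fun k : Fin n => if (p.succAbove k : ℕ) < r ∧ r ≤ (p : ℕ) then _ else _)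
      fun k _ => if_neg fun h => absurd hp (not_lt.2 h.2), Finset.sum_const_zero, add_zero,
      ← Finset.sum_neg_distrib]
    refine Finset.sum_congr rfl fun l _ => ?_
    rw [insertPerm_symm_self, insertPerm_symm_succAbove, if_neg (Fin.not_lt_zero _)]
    by_cases hl : r ≤ (p.succAbove l : ℕ)
    · rw [if_pos ⟨hp, hl⟩, if_pos hl, neg_one_mul]
    · rw [if_neg fun h => hl h.2, if_neg hl, neg_zero]
  · rw [Finset.sum_congr rfl (s₁ := Finset.univ) (f := fun l : Fin n => if (p : ℕ) < r ∧ r ≤ (p.succAbove l : ℕ) then _ else _)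
      fun k _ => if_neg fun h => hp h.1, Finset.sum_const_zero, zero_add]
    refine Finset.sum_congr rfl fun k _ => ?_
    rw [insertPerm_symm_self, insertPerm_symm_succAbove, if_pos (Fin.succ_pos _)]
    by_cases hk : (p.succAbove k : ℕ) < r
    · rw [if_pos ⟨hk, not_lt.1 hp⟩, if_pos hk, one_mul]
    · rw [if_neg fun h => hk h.1, if_neg hk]

theorem shuffleSum_succ {n : ℕ} (g : Fin (n + 1) → I) (r : ℕ) : shuffleSum F d g r =
    ∑ p : Fin (n + 1), if (p : ℕ) = 0 ∨ (p : ℕ) = r then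
      vHalfPow F (firstZeta d g r p) • Finsupp.mapDomain (List.cons (g p))
        (shuffleSum F d (fun k => g (p.succAbove k)) (cutAfter r p)) else 0 := by
  classical
  rw [shuffleSum, ← insertPerm_bijective.sum_comp, Fintype.sum_prod_type]
  refine Finset.sum_congr rfl fun p _ => ?_
  simp only [isShuffle_insertPerm]
  split_ifs with hp
  · rw [shuffleSum, Finsupp.mapDomain_finsetSum, Finset.smul_sum]
    refine Finset.sum_congr rfl fun τ _ => ?_
    by_cases hτ : IsShuffle (cutAfter r p) τ
    · rw [if_pos ⟨hp, hτ⟩, if_pos hτ, Finsupp.mapDomain_single, Finsupp.smul_single, smul_eq_mul,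
        ← vHalfPow_add, twoZetaFun_insertPerm, List.ofFn_succ, insertPerm_zero]
      simp only [insertPerm_succ]
    · rw [if_neg fun h => hτ h.2, if_neg hτ, Finsupp.mapDomain_zero, smul_zero]
  · exact Finset.sum_eq_zero fun τ _ => if_neg fun h => hp h.1

end ShuffleSum
end ValuedQuiver

end

/-! ### The recursion for the quantum shuffle product. -/

section

namespace ValuedQuiver

section WordSums

variable {I : Type w}

theorem sum_ofFn_right {n : ℕ} (g : Fin n → I) (f : I → ℤ) (a b : List I)
    (h : List.ofFn g = a ++ b) :
    ∑ l : Fin n, (if a.length ≤ (l : ℕ) then f (g l) else 0) = (b.map f).sum := by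
  induction a generalizing n with
  | nil =>
    rw [List.nil_append] at h
    simp [← h, List.map_ofFn, List.sum_ofFn]
  | cons i a ih =>
    cases n with
    | zero => simp at h
    | succ n =>
      rw [List.ofFn_succ, List.cons_append, List.cons.injEq] at h
      rw [Fin.sum_univ_succ, ← ih _ h.2]
      simp

theorem sum_ofFn_left {n : ℕ} (g : Fin n → I) (f : I → ℤ) (a b : List I)
    (h : List.ofFn g = a ++ b) :
    ∑ l : Fin n, (if (l : ℕ) < a.length then f (g l) else 0) = (a.map f).sum := by
  induction a generalizing n with
  | nil => simp
  | cons i a ih =>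
    cases n with
    | zero => simp at h
    | succ n =>
      rw [List.ofFn_succ, List.cons_append, List.cons.injEq] at h
      rw [Fin.sum_univ_succ, List.map_cons, List.sum_cons, ← ih _ h.2, ← h.1]
      simp

theorem ofFn_succAbove {n : ℕ} (g : Fin (n + 1) → I) (p : Fin (n + 1)) (a b : List I) (j : I)
    (h : List.ofFn g = a ++ j :: b) (hp : (p : ℕ) = a.length) :
    g p = j ∧ List.ofFn (fun k => g (p.succAbove k)) = a ++ b := by
  induction a generalizing n with
  | nil =>
    obtain rfl : p = 0 := Fin.ext hp
    rw [List.ofFn_succ, List.nil_append, List.cons.injEq] at h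
    exact ⟨h.1, by simpa using h.2⟩
  | cons i a ih =>
    rw [List.ofFn_succ, List.cons_append, List.cons.injEq] at h
    cases n with
    | zero =>
      have := congrArg List.length h.2
      simp at this
    | succ n =>
      have h0 : p ≠ 0 := fun h0 => by rw [h0] at hp; simp at hp
      obtain ⟨p, rfl⟩ := Fin.exists_succ_eq_of_ne_zero h0
      obtain ⟨h1, h2⟩ := ih (fun k => g k.succ) p h.2 (by simpa using hp)
      refine ⟨h1, ?_⟩
      rw [List.ofFn_succ, List.cons_append, ← h2]
      simp [h.1]

end WordSums

section ShuffleRec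

variable (F : Type u) [Field F] [Finite F] {I : Type w} [Quiver.{x + 1} I] (d : I → ℕ)

theorem wordDegree_nil : wordDegree ([] : List I) = 0 := rfl

theorem wordDegree_cons (i : I) (a : List I) :
    wordDegree (i :: a) = Finsupp.single i 1 + wordDegree a := by
  simp [wordDegree]

theorem wordDegree_singleton (i : I) : wordDegree [i] = Finsupp.single i 1 := by
  simp [wordDegree]

theorem wordDegree_append (a b : List I) : wordDegree (a ++ b) = wordDegree a + wordDegree b := by
  simp [wordDegree]

theorem sum_symForm_right (β : I →₀ ℤ) (a : List I) :
    (a.map fun i => symForm d β (wordDegree [i])).sum = symForm d β (wordDegree a) := by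
  induction a with
  | nil => simp [wordDegree_nil, symForm_zero_right]
  | cons i a ih => rw [List.map_cons, List.sum_cons, ih, ← symForm_add_right,
      wordDegree_singleton, wordDegree_cons]

theorem sum_symForm_left (β : I →₀ ℤ) (a : List I) :
    (a.map fun i => symForm d (wordDegree [i]) β).sum = symForm d (wordDegree a) β := by
  induction a with
  | nil => simp [wordDegree_nil, symForm_zero_left]
  | cons i a ih => rw [List.map_cons, List.sum_cons, ih, ← symForm_add_left,
      wordDegree_singleton, wordDegree_cons]

/-- The quantum shuffle product by recursion on the first letter. -/
def shuffleRec : List I → List I → (List I →₀ ℂ)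
  | [], b => Finsupp.single b 1
  | i :: a, [] => Finsupp.single (i :: a) 1
  | i :: a, j :: b =>
    vHalfPow F (-symForm d (Finsupp.single i 1) (wordDegree (j :: b))) •
      Finsupp.mapDomain (List.cons i) (shuffleRec a (j :: b)) +
    vHalfPow F (symForm d (wordDegree (i :: a)) (Finsupp.single j 1)) •
      Finsupp.mapDomain (List.cons j) (shuffleRec (i :: a) b)
termination_by a b => a.length + b.length

theorem shuffleRec_nil_left (b : List I) : shuffleRec F d [] b = Finsupp.single b 1 := by
  rw [shuffleRec]

theorem shuffleRec_nil_right (a : List I) : shuffleRec F d a [] = Finsupp.single a 1 := by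
  cases a <;> rw [shuffleRec]

theorem firstZeta_of_lt {n : ℕ} (g : Fin (n + 1) → I) (r : ℕ) (p : Fin (n + 1)) (hp : (p : ℕ) < r)
    (a b : List I) (h : List.ofFn (fun k => g (p.succAbove k)) = a ++ b)
    (ha : cutAfter r p = a.length) :
    firstZeta d g r p = -symForm d (wordDegree [g p]) (wordDegree b) := by
  rw [firstZeta, if_pos hp]
  simp only [le_succAbove_iff, ha]
  rw [sum_ofFn_right _ (fun i => symForm d (wordDegree [g p]) (wordDegree [i])) a b h,
    sum_symForm_right]

theorem firstZeta_of_le {n : ℕ} (g : Fin (n + 1) → I) (r : ℕ) (p : Fin (n + 1)) (hp : r ≤ (p : ℕ))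
    (a b : List I) (h : List.ofFn (fun k => g (p.succAbove k)) = a ++ b)
    (ha : cutAfter r p = a.length) :
    firstZeta d g r p = symForm d (wordDegree a) (wordDegree [g p]) := by
  rw [firstZeta, if_neg (not_lt.2 hp)]
  simp only [succAbove_lt_iff, ha]
  rw [sum_ofFn_left _ (fun i => symForm d (wordDegree [i]) (wordDegree [g p])) a b h,
    sum_symForm_left]

/-- At most two first letters are possible, the indices 0 and r. If the first word is empty, then r
= 0 and they coincide; if the second is empty, then r is outside the range. In these two cases a
single branch remains, with trivial scalar. -/
theorem shuffleSum_eq_shuffleRec {n : ℕ} (g : Fin n → I) (a b : List I)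
    (h : List.ofFn g = a ++ b) : shuffleSum F d g a.length = shuffleRec F d a b := by
  induction n generalizing a b with
  | zero =>
    obtain ⟨rfl, rfl⟩ : a = [] ∧ b = [] := by simpa using h.symm
    have hs : IsShuffle 0 (default : Equiv.Perm (Fin 0)) := fun k => k.elim0
    rw [shuffleRec_nil_left, shuffleSum, Fintype.sum_unique, List.length_nil, if_pos hs]
    simp [twoZetaFun, vHalfPow_zero]
  | succ n ih =>
    rw [shuffleSum_succ]
    have hlen : n + 1 = a.length + b.length := by
      simpa using congrArg List.length h
    cases a with
    | nil =>
      cases b with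
      | nil => simp at hlen
      | cons j b =>
        obtain ⟨h1, h2⟩ := ofFn_succAbove g 0 [] b j h rfl
        rw [Finset.sum_eq_single 0, if_pos (Or.inl (Fin.val_zero _)),
          firstZeta_of_le d g ([] : List I).length 0 (Nat.zero_le _) [] b h2 rfl, h1]
        · have h3 := ih _ [] b h2
          change _ • Finsupp.mapDomain _ (shuffleSum F d _ 0) = _
          rw [List.length_nil] at h3
          rw [h3, shuffleRec_nil_left, shuffleRec_nil_left, Finsupp.mapDomain_single,
            wordDegree_nil, symForm_zero_left, vHalfPow_zero, one_smul]
        · intro p _ hp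
          refine if_neg fun h0 => hp (Fin.ext ?_)
          simpa using h0
        · exact fun h0 => (h0 (Finset.mem_univ _)).elim
    | cons i a =>
      obtain ⟨h1, h2⟩ := ofFn_succAbove g 0 [] (a ++ b) i h rfl
      rw [List.nil_append] at h2
      have hr : cutAfter (i :: a).length ((0 : Fin (n + 1)) : ℕ) = a.length := by
        simp [cutAfter]
      have hz := firstZeta_of_lt d g (i :: a).length 0 (by simp) a b h2 hr
      have hfirst : vHalfPow F (firstZeta d g (i :: a).length 0) • Finsupp.mapDomain
          (List.cons (g 0)) (shuffleSum F d (fun k => g (Fin.succAbove 0 k))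
            (cutAfter (i :: a).length ((0 : Fin (n + 1)) : ℕ))) =
          vHalfPow F (-symForm d (Finsupp.single i 1) (wordDegree b)) •
            Finsupp.mapDomain (List.cons i) (shuffleRec F d a b) := by
        rw [hz, hr, ih _ a b h2, h1, wordDegree_singleton]
      cases b with
      | nil =>
        rw [Finset.sum_eq_single 0, if_pos (Or.inl (Fin.val_zero _)), hfirst, wordDegree_nil,
          symForm_zero_right, neg_zero, vHalfPow_zero, one_smul, shuffleRec_nil_right,
          shuffleRec_nil_right, Finsupp.mapDomain_single]
        · intro p _ hp
          refine if_neg fun h0 => hp (Fin.ext ?_)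
          have := p.2
          simp only [List.length_cons, List.length_nil] at h0 hlen
          simp only [Fin.val_zero]
          omega
        · exact fun h0 => (h0 (Finset.mem_univ _)).elim
      | cons j b =>
        have hq : (i :: a).length < n + 1 := by
          rw [hlen]; simp
        let q : Fin (n + 1) := ⟨(i :: a).length, hq⟩
        have hq0 : (0 : Fin (n + 1)) ≠ q := fun h0 => by
          have := congrArg Fin.val h0
          simp [q] at this
        obtain ⟨h3, h4⟩ := ofFn_succAbove g q (i :: a) b j h rfl
        have hrq : cutAfter (i :: a).length (q : ℕ) = (i :: a).length := by
          simp [cutAfter, q]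
        have hzq := firstZeta_of_le d g (i :: a).length q le_rfl (i :: a) b h4 hrq
        rw [← Finset.sum_subset (Finset.subset_univ {0, q}), Finset.sum_pair hq0,
          if_pos (Or.inl (Fin.val_zero _)), if_pos (show (q : ℕ) = 0 ∨ (q : ℕ) = (i :: a).length from Or.inr rfl), hfirst, hzq, hrq, ih _ (i :: a) b h4, h3,
          wordDegree_singleton, shuffleRec.eq_3]
        intro p _ hp
        refine if_neg fun h0 => hp ?_
        rw [Finset.mem_insert, Finset.mem_singleton]
        exact h0.imp (fun h => Fin.ext h) fun h => Fin.ext h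

theorem shuffleWords_eq_shuffleRec (a b : List I) :
    shuffleWords F d a b = shuffleRec F d a b := by
  rw [shuffleWords_eq_shuffleSum]
  exact shuffleSum_eq_shuffleRec F d _ a b (List.ofFn_get _)

end ShuffleRec
end ValuedQuiver

end

/-! ### Deletion of first letters, weight operators, and the shuffle algebra. -/

section

namespace ValuedQuiver

open GradedBialgebra

section Words

variable {I : Type w}

/-- A word as a basis element. -/
def word (a : List I) : List I →₀ ℂ := Finsupp.single a 1

theorem word_linearMap_ext {M : Type*} [AddCommMonoid M] [Module ℂ M]
    {f g : (List I →₀ ℂ) →ₗ[ℂ] M} (h : ∀ a, f (word a) = g (word a)) : f = g :=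
  Finsupp.lhom_ext' fun a => LinearMap.ext_ring (h a)

theorem word_tensor_ext {J M : Type*} [AddCommMonoid M] [Module ℂ M]
    {f g : (List I →₀ ℂ) ⊗[ℂ] (List J →₀ ℂ) →ₗ[ℂ] M}
    (h : ∀ a b, f (word a ⊗ₜ word b) = g (word a ⊗ₜ word b)) : f = g :=
  TensorProduct.ext <| word_linearMap_ext fun a => word_linearMap_ext fun b => h a b

/-- Adding a first letter. -/
def consLetter (i : I) : (List I →₀ ℂ) →ₗ[ℂ] (List I →₀ ℂ) := Finsupp.lmapDomain ℂ ℂ (List.cons i)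

theorem consLetter_word (i : I) (a : List I) : consLetter i (word a) = word (i :: a) :=
  Finsupp.mapDomain_single

/-- Removing the first letter `i`; words starting with another letter are mapped to zero. -/
def dropLetter (i : I) : (List I →₀ ℂ) →ₗ[ℂ] (List I →₀ ℂ) :=
  Finsupp.lcomapDomain (List.cons i) (List.cons_injective)

theorem dropLetter_apply (i : I) (f : List I →₀ ℂ) (a : List I) : dropLetter i f a = f (i :: a) :=
  rfl

theorem dropLetter_word_nil (i : I) : dropLetter i (word []) = 0 := by
  ext a
  rw [dropLetter_apply, word, Finsupp.single_apply, if_neg (by simp), Finsupp.zero_apply]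

theorem dropLetter_consLetter_self (i : I) (f : List I →₀ ℂ) :
    dropLetter i (consLetter i f) = f := by
  ext a
  exact Finsupp.mapDomain_apply List.cons_injective f a

theorem dropLetter_consLetter_of_ne {i j : I} (h : j ≠ i) (f : List I →₀ ℂ) :
    dropLetter i (consLetter j f) = 0 := by
  ext a
  exact Finsupp.mapDomain_of_notMem_range _ _ fun ⟨b, hb⟩ => h (List.cons.inj hb).1

theorem consLetter_apply_nil (i : I) (f : List I →₀ ℂ) : consLetter i f [] = 0 :=
  Finsupp.mapDomain_of_notMem_range _ _ fun ⟨_, hb⟩ => List.cons_ne_nil _ _ hb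

theorem ext_dropLetter {f g : List I →₀ ℂ} (h0 : f [] = g [])
    (h : ∀ i, dropLetter i f = dropLetter i g) : f = g := by
  ext a
  cases a with
  | nil => exact h0
  | cons i a => exact DFunLike.congr_fun (h i) a

/-- The coefficient of a word in the first factor of a tensor. -/
def leftCoeff (N : Type*) [AddCommGroup N] [Module ℂ N] (a : List I) :
    (List I →₀ ℂ) ⊗[ℂ] N →ₗ[ℂ] N :=
  (TensorProduct.lid ℂ N).toLinearMap ∘ₗ (Finsupp.lapply a).rTensor N

theorem leftCoeff_tmul {N : Type*} [AddCommGroup N] [Module ℂ N] (a : List I) (f : List I →₀ ℂ)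
    (y : N) : leftCoeff N a (f ⊗ₜ y) = f a • y := rfl

theorem leftCoeff_cons {N : Type*} [AddCommGroup N] [Module ℂ N] (i : I) (a : List I)
    (t : (List I →₀ ℂ) ⊗[ℂ] N) :
    leftCoeff N (i :: a) t = leftCoeff N a ((dropLetter i).rTensor N t) := by
  have : leftCoeff N (i :: a) = leftCoeff N a ∘ₗ (dropLetter i).rTensor N :=
    TensorProduct.ext' fun f y => rfl
  rw [this]
  rfl

theorem tensor_ext_leftCoeff {N : Type*} [AddCommGroup N] [Module ℂ N]
    {s t : (List I →₀ ℂ) ⊗[ℂ] N} (h : ∀ a, leftCoeff N a s = leftCoeff N a t) : s = t := by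
  classical
  refine (TensorProduct.finsuppLeft ℂ ℂ ℂ N (List I)).injective (Finsupp.ext fun a => ?_)
  rw [TensorProduct.finsuppLeft_apply, TensorProduct.finsuppLeft_apply]
  exact (TensorProduct.lid ℂ N).injective (h a)

theorem tensor_ext_dropLetter {N : Type*} [AddCommGroup N] [Module ℂ N]
    {s t : (List I →₀ ℂ) ⊗[ℂ] N} (h0 : leftCoeff N [] s = leftCoeff N [] t)
    (h : ∀ i, (dropLetter i).rTensor N s = (dropLetter i).rTensor N t) : s = t := by
  refine tensor_ext_leftCoeff fun a => ?_
  cases a with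
  | nil => exact h0
  | cons i a => rw [leftCoeff_cons, leftCoeff_cons, h]

end Words

section Operators

variable (F : Type u) [Field F] [Finite F] {I : Type w} [Quiver.{x + 1} I] (d : I → ℕ)

/-- The operator that multiplies elements of weight `γ` by `v ^ ((β, γ) / 2)`. -/
def weightOp (β : I →₀ ℤ) : (List I →₀ ℂ) →ₗ[ℂ] (List I →₀ ℂ) :=
  Finsupp.linearCombination ℂ fun a => vHalfPow F (symForm d β (wordDegree a)) • word a

theorem weightOp_word (β : I →₀ ℤ) (a : List I) :
    weightOp F d β (word a) = vHalfPow F (symForm d β (wordDegree a)) • word a := by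
  rw [weightOp, word, Finsupp.linearCombination_single, one_smul, word]

theorem weightOp_weightOp (β γ : I →₀ ℤ) (f : List I →₀ ℂ) :
    weightOp F d β (weightOp F d γ f) = weightOp F d (β + γ) f := by
  have : weightOp F d β ∘ₗ weightOp F d γ = weightOp F d (β + γ) := word_linearMap_ext fun a => by
    rw [LinearMap.comp_apply, weightOp_word, LinearMap.map_smul, weightOp_word, weightOp_word,
      smul_smul, ← vHalfPow_add, symForm_add_left, add_comm]
  rw [← this]
  rfl

theorem weightOp_zero : weightOp F d 0 = LinearMap.id := word_linearMap_ext fun a => by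
  rw [weightOp_word, symForm_zero_left, vHalfPow_zero, one_smul, LinearMap.id_apply]

theorem shuffle_mul_word (a b : List I) :
    (shuffle F d).mul (word a) (word b) = shuffleRec F d a b := by
  simp [shuffle, word, shuffleWords_eq_shuffleRec]

theorem shuffleRec_cons_cons (i j : I) (a b : List I) : shuffleRec F d (i :: a) (j :: b) =
    vHalfPow F (-symForm d (Finsupp.single i 1) (wordDegree (j :: b))) •
      consLetter i (shuffleRec F d a (j :: b)) +
    vHalfPow F (symForm d (wordDegree (i :: a)) (Finsupp.single j 1)) •
      consLetter j (shuffleRec F d (i :: a) b) :=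
  shuffleRec.eq_3 F d i a j b

theorem consLetter_mem (i : I) {γ : I →₀ ℤ} {f : List I →₀ ℂ}
    (hf : f ∈ (shuffle F d).component (-γ)) :
    consLetter i f ∈ (shuffle F d).component (-(Finsupp.single i 1 + γ)) := by
  refine (shuffle F d).map_mem_of_basis (consLetter i) (fun b hb => ?_) f hf
  have : consLetter i (word b) = word (i :: b) := consLetter_word i b
  rw [word] at this
  rw [this]
  refine (shuffle F d).single_mem_component _ _ ?_
  have hb' : -wordDegree b = -γ := hb
  change -wordDegree (i :: b) = _
  rw [wordDegree_cons, neg_inj.1 hb']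

theorem shuffleRec_mem (a b : List I) :
    shuffleRec F d a b ∈ (shuffle F d).component (-(wordDegree a + wordDegree b)) := by
  induction a generalizing b with
  | nil =>
    rw [shuffleRec_nil_left, wordDegree_nil, zero_add]
    exact (shuffle F d).single_mem_component _ _ rfl
  | cons i a iha =>
    induction b with
    | nil =>
      rw [shuffleRec_nil_right, wordDegree_nil, add_zero]
      exact (shuffle F d).single_mem_component _ _ rfl
    | cons j b ihb =>
      rw [shuffleRec_cons_cons]
      refine Submodule.add_mem _ (Submodule.smul_mem _ _ ?_) (Submodule.smul_mem _ _ ?_)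
      · rw [wordDegree_cons i, add_assoc]
        exact consLetter_mem F d i (iha (j :: b))
      · rw [wordDegree_cons j, add_left_comm]
        exact consLetter_mem F d j ihb

theorem weightOp_of_mem (β : I →₀ ℤ) {γ : I →₀ ℤ} {f : List I →₀ ℂ}
    (hf : f ∈ (shuffle F d).component (-γ)) :
    weightOp F d β f = vHalfPow F (symForm d β γ) • f := by
  have := (shuffle F d).map_mem_of_basis (γ := -γ)
    (weightOp F d β - vHalfPow F (symForm d β γ) • LinearMap.id) (P := ⊥) (fun b hb => ?_) f hf
  · rw [Submodule.mem_bot, LinearMap.sub_apply, sub_eq_zero] at this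
    exact this
  · have hb' : wordDegree b = γ := neg_inj.1 hb
    rw [Submodule.mem_bot, LinearMap.sub_apply, sub_eq_zero]
    have := weightOp_word F d β b
    rw [hb'] at this
    exact this

/-- The product is graded and the form is additive in its second argument, so the weight operators
are algebra automorphisms. -/
theorem weightOp_mul (β : I →₀ ℤ) (f g : List I →₀ ℂ) : weightOp F d β ((shuffle F d).mul f g) =
    (shuffle F d).mul (weightOp F d β f) (weightOp F d β g) := by
  have : (shuffle F d).mul.compr₂ (weightOp F d β) =
      (shuffle F d).mul.compl₁₂ (weightOp F d β) (weightOp F d β) := bilinear_ext fun a b => by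
    change weightOp F d β ((shuffle F d).mul (word a) (word b)) =
      (shuffle F d).mul (weightOp F d β (word a)) (weightOp F d β (word b))
    rw [weightOp_word, weightOp_word, LinearMap.map_smul₂, LinearMap.map_smul, smul_smul,
      ← vHalfPow_add, shuffle_mul_word, weightOp_of_mem F d β (shuffleRec_mem F d a b),
      symForm_add_right]
  exact LinearMap.congr_fun₂ this f g

variable [IsAdmissible I d]

/-- The recursion read as a Leibniz rule: the first letter of a shuffle comes from the left or from
the right word, and the two scalars of the recursion are the eigenvalues of the weight operators on
the other word. All inductions on length below rest on this identity. -/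
theorem dropLetter_mul (i : I) (f g : List I →₀ ℂ) : dropLetter i ((shuffle F d).mul f g) =
    (shuffle F d).mul (dropLetter i f) (weightOp F d (-Finsupp.single i 1) g) +
      (shuffle F d).mul (weightOp F d (Finsupp.single i 1) f) (dropLetter i g) := by
  have : (shuffle F d).mul.compr₂ (dropLetter i) =
      (shuffle F d).mul.compl₁₂ (dropLetter i) (weightOp F d (-Finsupp.single i 1)) +
      (shuffle F d).mul.compl₁₂ (weightOp F d (Finsupp.single i 1)) (dropLetter i) :=
    bilinear_ext fun a b => by
    change dropLetter i ((shuffle F d).mul (word a) (word b)) =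
      (shuffle F d).mul (dropLetter i (word a)) (weightOp F d (-Finsupp.single i 1) (word b)) +
      (shuffle F d).mul (weightOp F d (Finsupp.single i 1) (word a)) (dropLetter i (word b))
    have hneg : ∀ γ, symForm d (-Finsupp.single i 1) γ = -symForm d (Finsupp.single i 1) γ :=
      fun γ => bilin_neg_left _ _ γ
    rw [shuffle_mul_word, weightOp_word, weightOp_word, LinearMap.map_smul, LinearMap.map_smul₂,
      hneg]
    cases a with
    | nil =>
      rw [shuffleRec_nil_left, dropLetter_word_nil, LinearMap.map_zero₂, smul_zero, zero_add,
        wordDegree_nil, symForm_zero_right, vHalfPow_zero, one_smul]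
      cases b with
      | nil => rw [dropLetter_word_nil, LinearMap.map_zero]; exact dropLetter_word_nil i
      | cons j b =>
        rw [← consLetter_word j b]
        by_cases h : j = i
        · subst h
          rw [dropLetter_consLetter_self, shuffle_mul_word, shuffleRec_nil_left]
          change dropLetter j (word (j :: b)) = _
          rw [← consLetter_word j b, dropLetter_consLetter_self]
          rfl
        · rw [dropLetter_consLetter_of_ne h, LinearMap.map_zero]
          change dropLetter i (word (j :: b)) = _
          rw [← consLetter_word j b, dropLetter_consLetter_of_ne h]
    | cons k a =>
      cases b with
      | nil =>
        rw [shuffleRec_nil_right, dropLetter_word_nil, LinearMap.map_zero, smul_zero, add_zero,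
          wordDegree_nil, symForm_zero_right, neg_zero, vHalfPow_zero, one_smul]
        change dropLetter i (word (k :: a)) = _
        rw [← consLetter_word k a]
        by_cases h : k = i
        · subst h
          rw [dropLetter_consLetter_self, shuffle_mul_word, shuffleRec_nil_right]
          rfl
        · rw [dropLetter_consLetter_of_ne h, LinearMap.map_zero₂]
      | cons j b =>
        rw [shuffleRec_cons_cons, map_add, LinearMap.map_smul, LinearMap.map_smul]
        congr 1
        · rw [← consLetter_word k a]
          by_cases h : k = i
          · subst h
            rw [dropLetter_consLetter_self, dropLetter_consLetter_self, shuffle_mul_word]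
          · rw [dropLetter_consLetter_of_ne h, dropLetter_consLetter_of_ne h, LinearMap.map_zero₂,
              smul_zero, smul_zero]
        · rw [← consLetter_word j b]
          by_cases h : j = i
          · subst h
            rw [dropLetter_consLetter_self, dropLetter_consLetter_self, shuffle_mul_word,
              symForm_comm]
          · rw [dropLetter_consLetter_of_ne h, dropLetter_consLetter_of_ne h, LinearMap.map_zero,
              smul_zero, smul_zero]
  exact LinearMap.congr_fun₂ this f g

theorem shuffle_one_mul (f : List I →₀ ℂ) : (shuffle F d).mul (word []) f = f := by
  have : (shuffle F d).mul (word []) = LinearMap.id := word_linearMap_ext fun a => by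
    rw [shuffle_mul_word, shuffleRec_nil_left]
    rfl
  rw [this, LinearMap.id_apply]

theorem shuffle_mul_one (f : List I →₀ ℂ) : (shuffle F d).mul f (word []) = f := by
  have : (shuffle F d).mul.flip (word []) = LinearMap.id := word_linearMap_ext fun a => by
    rw [LinearMap.flip_apply, shuffle_mul_word, shuffleRec_nil_right]
    rfl
  exact LinearMap.congr_fun this f

theorem shuffle_mul_apply_nil (f g : List I →₀ ℂ) : (shuffle F d).mul f g [] = f [] * g [] := by
  have : (shuffle F d).mul.compr₂ (Finsupp.lapply []) =
      (LinearMap.mul ℂ ℂ).compl₁₂ (Finsupp.lapply []) (Finsupp.lapply []) :=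
    bilinear_ext fun a b => by
    change (shuffle F d).mul (word a) (word b) [] = word a [] * word b []
    cases a with
    | nil =>
      rw [shuffle_one_mul, show word ([] : List I) [] = 1 from Finsupp.single_eq_same, one_mul]
    | cons i a =>
      rw [← consLetter_word i a, consLetter_apply_nil, zero_mul, consLetter_word]
      cases b with
      | nil => rw [shuffle_mul_one, ← consLetter_word, consLetter_apply_nil]
      | cons j b =>
        rw [shuffle_mul_word, shuffleRec_cons_cons, Finsupp.add_apply, Finsupp.smul_apply,
          Finsupp.smul_apply, consLetter_apply_nil, consLetter_apply_nil, smul_zero, smul_zero,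
          add_zero]
  exact LinearMap.congr_fun₂ this f g

/-- Removing a letter from a word gives zero or a shorter word. -/
theorem dropLetter_word_cases {p : (List I →₀ ℂ) → Prop} (h0 : p 0) (i : I) (a : List I)
    (h : ∀ b : List I, b.length < a.length → p (word b)) : p (dropLetter i (word a)) := by
  cases a with
  | nil => rwa [dropLetter_word_nil]
  | cons j a =>
    rw [← consLetter_word]
    by_cases hj : j = i
    · rw [hj, dropLetter_consLetter_self]
      exact h a (by simp)
    · rwa [dropLetter_consLetter_of_ne hj]

/-- Both sides have the same constant term. Deleting a letter from either side yields three terms,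
according to the word that loses the letter, and in each of them the total length has dropped. -/
theorem shuffle_mul_assoc_word (a b c : List I) :
    (shuffle F d).mul ((shuffle F d).mul (word a) (word b)) (word c) =
      (shuffle F d).mul (word a) ((shuffle F d).mul (word b) (word c)) := by
  induction hn : a.length + b.length + c.length using Nat.strong_induction_on
    generalizing a b c with
  | _ n ih =>
  subst hn
  have ih' := fun a' b' c' h => ih _ h a' b' c' rfl
  refine ext_dropLetter (by simp only [shuffle_mul_apply_nil, mul_assoc]) fun i => ?_
  have h1 := dropLetter_word_cases (p := fun f => (shuffle F d).mul ((shuffle F d).mul f (word b))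
    (word c) = (shuffle F d).mul f ((shuffle F d).mul (word b) (word c)))
    (by simp only [LinearMap.map_zero₂]) i a fun a' h => ih' a' b c (by omega)
  have h2 := dropLetter_word_cases (p := fun f => (shuffle F d).mul ((shuffle F d).mul (word a) f)
    (word c) = (shuffle F d).mul (word a) ((shuffle F d).mul f (word c)))
    (by simp only [LinearMap.map_zero, LinearMap.zero_apply]) i b fun b' h => ih' a b' c (by omega)
  have h3 := dropLetter_word_cases (p := fun f => (shuffle F d).mul ((shuffle F d).mul (word a)
    (word b)) f = (shuffle F d).mul (word a) ((shuffle F d).mul (word b) f))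
    (by simp only [LinearMap.map_zero]) i c fun c' h => ih' a b c' (by omega)
  -- On words the weight operators act by scalars, and these agree on the two sides term by term.
  simp only [dropLetter_mul, weightOp_mul, map_add, LinearMap.add_apply, weightOp_word,
    LinearMap.map_smul, LinearMap.smul_apply, h1, h2, h3]
  module

theorem shuffle_mul_assoc (f g h : List I →₀ ℂ) :
    (shuffle F d).mul ((shuffle F d).mul f g) h =
      (shuffle F d).mul f ((shuffle F d).mul g h) := by
  induction f using Finsupp.induction_linear with
  | zero => simp
  | add f f' hf hf' => simp only [map_add, LinearMap.add_apply, hf, hf']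
  | single a r =>
    have : (shuffle F d).mul.compr₂ ((shuffle F d).mul (word a)) =
        (shuffle F d).mul ∘ₗ (shuffle F d).mul (word a) := bilinear_ext fun b c =>
      (shuffle_mul_assoc_word F d a b c).symm
    have h1 := LinearMap.congr_fun₂ this g h
    have h2 : Finsupp.single a r = r • word a := by
      rw [word, Finsupp.smul_single, smul_eq_mul, mul_one]
    rw [h2, LinearMap.map_smul₂, LinearMap.map_smul₂, LinearMap.map_smul₂]
    exact congrArg (r • ·) h1.symm

end Operators
end ValuedQuiver

end

/-! ### The shuffle coalgebra and its compatibility with the product. -/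

section

namespace ValuedQuiver

open GradedBialgebra

variable (F : Type u) [Field F] [Finite F] {I : Type w} [Quiver.{x + 1} I] (d : I → ℕ)

theorem shuffle_comul_word (h : List I) : (shuffle F d).comul (word h) =
    ∑ m ∈ Finset.range (h.length + 1),
      vHalfPow F (symForm d (wordDegree (h.take m)) (wordDegree (h.drop m))) •
        (word (h.take m) ⊗ₜ[ℂ] word (h.drop m)) := by
  simp [shuffle, word]

theorem shuffle_comul_nil : (shuffle F d).comul (word []) = word [] ⊗ₜ[ℂ] word [] := by
  rw [shuffle_comul_word]
  simp [wordDegree_nil, symForm_zero_left, vHalfPow_zero]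

/-- The cut before the first letter gives the first summand. The other cuts are cuts of `h` with i
added on the left, and i pairs with the right part through the weight operator. -/
theorem shuffle_comul_cons (i : I) (h : List I) : (shuffle F d).comul (word (i :: h)) =
    word [] ⊗ₜ[ℂ] word (i :: h) + TensorProduct.map (consLetter i)
      (weightOp F d (Finsupp.single i 1)) ((shuffle F d).comul (word h)) := by
  rw [shuffle_comul_word, shuffle_comul_word, List.length_cons, Finset.sum_range_succ', add_comm,
    map_sum]
  congr 1
  · rw [List.take_zero, List.drop_zero, wordDegree_nil, symForm_zero_left, vHalfPow_zero, one_smul]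
  · refine Finset.sum_congr rfl fun m _ => ?_
    rw [List.take_succ_cons, List.drop_succ_cons, LinearMap.map_smul, TensorProduct.map_tmul,
      consLetter_word, weightOp_word, TensorProduct.tmul_smul, smul_smul, ← vHalfPow_add,
      wordDegree_cons, symForm_add_left, add_comm]

/-- The weight operators are automorphisms of the coalgebra. -/
theorem shuffle_comul_weightOp (β : I →₀ ℤ) (f : List I →₀ ℂ) :
    (shuffle F d).comul (weightOp F d β f) =
      TensorProduct.map (weightOp F d β) (weightOp F d β) ((shuffle F d).comul f) := by
  have : (shuffle F d).comul ∘ₗ weightOp F d β =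
      TensorProduct.map (weightOp F d β) (weightOp F d β) ∘ₗ (shuffle F d).comul :=
    word_linearMap_ext fun a => by
    rw [LinearMap.comp_apply, LinearMap.comp_apply, weightOp_word, LinearMap.map_smul,
      shuffle_comul_word, map_sum, Finset.smul_sum]
    refine Finset.sum_congr rfl fun m _ => ?_
    rw [LinearMap.map_smul, TensorProduct.map_tmul, weightOp_word, weightOp_word,
      TensorProduct.smul_tmul_smul, smul_comm, ← vHalfPow_add, ← symForm_add_right,
      ← wordDegree_append, List.take_append_drop]
  exact LinearMap.congr_fun this f

/-- Only cuts with a nonempty left part survive. They are the cuts of the shortened word, each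
corrected by the pairing of i with its right part. -/
theorem dropLetter_comul (i : I) (f : List I →₀ ℂ) :
    (dropLetter i).rTensor _ ((shuffle F d).comul f) =
      (weightOp F d (Finsupp.single i 1)).lTensor _ ((shuffle F d).comul (dropLetter i f)) := by
  have : (dropLetter i).rTensor _ ∘ₗ (shuffle F d).comul =
      (weightOp F d (Finsupp.single i 1)).lTensor _ ∘ₗ (shuffle F d).comul ∘ₗ dropLetter i :=
    word_linearMap_ext fun a => by
    simp only [LinearMap.comp_apply]
    cases a with
    | nil => rw [dropLetter_word_nil, map_zero, map_zero, shuffle_comul_nil, LinearMap.rTensor_tmul,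
        dropLetter_word_nil, TensorProduct.zero_tmul]
    | cons j a =>
      rw [shuffle_comul_cons, map_add, LinearMap.rTensor_tmul, dropLetter_word_nil,
        TensorProduct.zero_tmul, zero_add, LinearMap.rTensor, ← LinearMap.comp_apply,
        ← TensorProduct.map_comp, ← consLetter_word]
      by_cases h : j = i
      · subst h
        rw [dropLetter_consLetter_self, LinearMap.id_comp, LinearMap.lTensor,
          show dropLetter j ∘ₗ consLetter j = LinearMap.id from
            LinearMap.ext (dropLetter_consLetter_self j)]
      · rw [dropLetter_consLetter_of_ne h, map_zero, map_zero,
          show dropLetter i ∘ₗ consLetter j = 0 from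
            LinearMap.ext (dropLetter_consLetter_of_ne h), TensorProduct.map_zero_left,
          LinearMap.zero_apply]
  exact LinearMap.congr_fun this f

/-- Only the empty left part counts and its scalar is 1. As the counit is the coefficient of the
empty word, this is also one of the two counit laws. -/
theorem leftCoeff_nil_comul (f : List I →₀ ℂ) : leftCoeff _ [] ((shuffle F d).comul f) = f := by
  have : leftCoeff _ [] ∘ₗ (shuffle F d).comul = LinearMap.id := word_linearMap_ext fun a => by
    rw [LinearMap.comp_apply, LinearMap.id_apply]
    cases a with
    | nil => rw [shuffle_comul_nil, leftCoeff_tmul,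
        show word ([] : List I) [] = 1 from Finsupp.single_eq_same, one_smul]
    | cons i a =>
      have h0 : leftCoeff (List I →₀ ℂ) [] ∘ₗ TensorProduct.map (consLetter i)
          (weightOp F d (Finsupp.single i 1)) = 0 := TensorProduct.ext' fun f g => by
        rw [LinearMap.comp_apply, TensorProduct.map_tmul, leftCoeff_tmul, consLetter_apply_nil,
          zero_smul, LinearMap.zero_apply]
      rw [shuffle_comul_cons, map_add, leftCoeff_tmul,
        show word ([] : List I) [] = 1 from Finsupp.single_eq_same, one_smul,
        ← LinearMap.comp_apply (leftCoeff _ _), h0, LinearMap.zero_apply, add_zero]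
  exact LinearMap.congr_fun this f

/-- Together with `lTensor_comul_map` this shows that both iterated coproducts react in the same way
to a new first letter, up to the term with an empty leftmost part. Coassociativity then follows by
induction on the word. -/
theorem assoc_rTensor_comul_map (i : I) (t : (List I →₀ ℂ) ⊗[ℂ] (List I →₀ ℂ)) :
    TensorProduct.assoc ℂ _ _ _ ((shuffle F d).comul.rTensor (List I →₀ ℂ)
      (TensorProduct.map (consLetter i) (weightOp F d (Finsupp.single i 1)) t)) =
    word [] ⊗ₜ TensorProduct.map (consLetter i) (weightOp F d (Finsupp.single i 1)) t +
      TensorProduct.map (consLetter i) (TensorProduct.map (weightOp F d (Finsupp.single i 1))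
        (weightOp F d (Finsupp.single i 1))) (TensorProduct.assoc ℂ _ _ _
          ((shuffle F d).comul.rTensor (List I →₀ ℂ) t)) := by
  induction t using TensorProduct.induction_on with
  | zero => simp only [map_zero, TensorProduct.tmul_zero, add_zero]
  | add s t hs ht => simp only [map_add, hs, ht, TensorProduct.tmul_add]; abel
  | tmul f g =>
    induction f using Finsupp.induction_linear with
    | zero => simp only [TensorProduct.zero_tmul, map_zero, TensorProduct.tmul_zero, add_zero]
    | add f f' hf hf' => simp only [TensorProduct.add_tmul, map_add, hf, hf',
        TensorProduct.tmul_add]; abel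
    | single a r =>
      have h2 : Finsupp.single a r = r • word a := by
        rw [word, Finsupp.smul_single, smul_eq_mul, mul_one]
      have h3 (s : (List I →₀ ℂ) ⊗[ℂ] (List I →₀ ℂ)) : TensorProduct.assoc ℂ _ _ _
          (TensorProduct.map (consLetter i) (weightOp F d (Finsupp.single i 1)) s ⊗ₜ[ℂ]
            weightOp F d (Finsupp.single i 1) g) =
          TensorProduct.map (consLetter i) (TensorProduct.map (weightOp F d (Finsupp.single i 1))
            (weightOp F d (Finsupp.single i 1))) (TensorProduct.assoc ℂ _ _ _ (s ⊗ₜ[ℂ] g)) := by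
        induction s using TensorProduct.induction_on with
        | zero => simp only [map_zero, TensorProduct.zero_tmul]
        | add s t hs ht => simp only [map_add, hs, ht, TensorProduct.add_tmul]
        | tmul f f' => simp only [TensorProduct.map_tmul, TensorProduct.assoc_tmul]
      have h4 : TensorProduct.assoc ℂ _ _ _ ((shuffle F d).comul.rTensor (List I →₀ ℂ)
          (TensorProduct.map (consLetter i) (weightOp F d (Finsupp.single i 1)) (word a ⊗ₜ g))) =
          word [] ⊗ₜ TensorProduct.map (consLetter i) (weightOp F d (Finsupp.single i 1))
            (word a ⊗ₜ g) +
          TensorProduct.map (consLetter i) (TensorProduct.map (weightOp F d (Finsupp.single i 1))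
            (weightOp F d (Finsupp.single i 1))) (TensorProduct.assoc ℂ _ _ _
              ((shuffle F d).comul.rTensor (List I →₀ ℂ) (word a ⊗ₜ g))) := by
        rw [TensorProduct.map_tmul, LinearMap.rTensor_tmul, LinearMap.rTensor_tmul, ← h3,
          consLetter_word, shuffle_comul_cons, TensorProduct.add_tmul, map_add,
          TensorProduct.assoc_tmul]
      rw [h2, ← TensorProduct.smul_tmul']
      simp only [LinearMap.map_smul, LinearEquiv.map_smul, h4, TensorProduct.tmul_smul, smul_add]

theorem lTensor_comul_map (i : I) (t : (List I →₀ ℂ) ⊗[ℂ] (List I →₀ ℂ)) :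
    (shuffle F d).comul.lTensor (List I →₀ ℂ)
      (TensorProduct.map (consLetter i) (weightOp F d (Finsupp.single i 1)) t) =
    TensorProduct.map (consLetter i) (TensorProduct.map (weightOp F d (Finsupp.single i 1))
      (weightOp F d (Finsupp.single i 1))) ((shuffle F d).comul.lTensor (List I →₀ ℂ) t) := by
  induction t using TensorProduct.induction_on with
  | zero => simp only [map_zero]
  | add s t hs ht => simp only [map_add, hs, ht]
  | tmul f g => rw [TensorProduct.map_tmul, LinearMap.lTensor_tmul, LinearMap.lTensor_tmul,
      TensorProduct.map_tmul, shuffle_comul_weightOp]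

theorem shuffle_coassoc : (TensorProduct.assoc ℂ (List I →₀ ℂ) (List I →₀ ℂ)
      (List I →₀ ℂ)).toLinearMap ∘ₗ
    (shuffle F d).comul.rTensor (List I →₀ ℂ) ∘ₗ (shuffle F d).comul =
      (shuffle F d).comul.lTensor (List I →₀ ℂ) ∘ₗ (shuffle F d).comul :=
  word_linearMap_ext fun a => by
    change TensorProduct.assoc ℂ _ _ _ ((shuffle F d).comul.rTensor (List I →₀ ℂ)
      ((shuffle F d).comul (word a))) =
      (shuffle F d).comul.lTensor (List I →₀ ℂ) ((shuffle F d).comul (word a))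
    induction a with
    | nil => rw [shuffle_comul_nil, LinearMap.rTensor_tmul, LinearMap.lTensor_tmul,
        shuffle_comul_nil, TensorProduct.assoc_tmul]
    | cons i a ih =>
      rw [shuffle_comul_cons, map_add, map_add, map_add, assoc_rTensor_comul_map,
        lTensor_comul_map, ih, LinearMap.rTensor_tmul, LinearMap.lTensor_tmul,
        shuffle_comul_nil, TensorProduct.assoc_tmul, shuffle_comul_cons, TensorProduct.tmul_add,
        add_assoc]

section TwistedMul

variable [IsAdmissible I d]

/-- The twisted multiplication of the tensor square of the quantum shuffle algebra. -/
local notation "star" => StructureMaps.twistedMul (shuffle F d) (twist F d)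

theorem shuffle_twistedMul_word (a b c e : List I) :
    star (word a ⊗ₜ word b) (word c ⊗ₜ word e) =
      vHalfPow F (2 * symForm d (wordDegree b) (wordDegree c)) •
        ((shuffle F d).mul (word a) (word c) ⊗ₜ (shuffle F d).mul (word b) (word e)) := by
  have h := (shuffle F d).twistedMul_tmul (twist F d) a b c e
  rw [show twist F d ((shuffle F d).deg b) ((shuffle F d).deg c) =
    vHalfPow F (2 * symForm d (wordDegree b) (wordDegree c)) from
    congrArg (fun n => vHalfPow F (2 * n)) (symForm_neg_neg d _ _)] at h
  exact h

theorem tensor_bilinear_ext {M : Type*} [AddCommMonoid M] [Module ℂ M]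
    {φ ψ : (List I →₀ ℂ) ⊗[ℂ] (List I →₀ ℂ) →ₗ[ℂ] (List I →₀ ℂ) ⊗[ℂ] (List I →₀ ℂ) →ₗ[ℂ] M}
    (h : ∀ a b c e, φ (word a ⊗ₜ word b) (word c ⊗ₜ word e) =
      ψ (word a ⊗ₜ word b) (word c ⊗ₜ word e)) : φ = ψ :=
  word_tensor_ext fun a b => word_tensor_ext fun c e => h a b c e

/-- The twist is invisible here: the coefficient of the empty word forces the left factor of `t` to
be empty, where the pairing vanishes. -/
theorem leftCoeff_nil_twistedMul (s t : (List I →₀ ℂ) ⊗[ℂ] (List I →₀ ℂ)) :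
    leftCoeff _ [] (star s t) = (shuffle F d).mul (leftCoeff _ [] s) (leftCoeff _ [] t) := by
  have : (star).compr₂ (leftCoeff _ []) =
      (shuffle F d).mul.compl₁₂ (leftCoeff _ []) (leftCoeff _ []) :=
    tensor_bilinear_ext fun a b c e => by
    change leftCoeff _ [] (star _ _) = (shuffle F d).mul (leftCoeff _ [] _) (leftCoeff _ [] _)
    rw [shuffle_twistedMul_word, LinearMap.map_smul, leftCoeff_tmul, leftCoeff_tmul,
      leftCoeff_tmul, shuffle_mul_apply_nil, LinearMap.map_smul₂, LinearMap.map_smul, mul_smul]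
    cases c with
    | nil => rw [wordDegree_nil, symForm_zero_right, mul_zero, vHalfPow_zero, one_smul]
    | cons j c => simp [← consLetter_word, consLetter_apply_nil]
  exact LinearMap.congr_fun₂ this s t

theorem weightOp_lTensor_twistedMul (β : I →₀ ℤ) (s t : (List I →₀ ℂ) ⊗[ℂ] (List I →₀ ℂ)) :
    (weightOp F d β).lTensor _ (star s t) =
      star ((weightOp F d β).lTensor _ s) ((weightOp F d β).lTensor _ t) := by
  have : (star).compr₂ ((weightOp F d β).lTensor _) =
      (star).compl₁₂ ((weightOp F d β).lTensor _) ((weightOp F d β).lTensor _) :=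
    tensor_bilinear_ext fun a b c e => by
    change (weightOp F d β).lTensor _ (star _ _) =
      star ((weightOp F d β).lTensor _ _) ((weightOp F d β).lTensor _ _)
    rw [shuffle_twistedMul_word, LinearMap.map_smul, LinearMap.lTensor_tmul,
      LinearMap.lTensor_tmul, LinearMap.lTensor_tmul, weightOp_mul, weightOp_word, weightOp_word]
    simp only [TensorProduct.tmul_smul, LinearMap.map_smul, LinearMap.smul_apply]
    rw [shuffle_twistedMul_word]
    module
  exact LinearMap.congr_fun₂ this s t

/-- The Leibniz rule of the left factors, combined with the twist. When the letter is taken from the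
second tensor, the twist loses the full pairing of i with the right factor of `s`. Weight operators
carry half exponents, so restoring it needs the operator for 2α_i. -/
theorem dropLetter_twistedMul (i : I) (s t : (List I →₀ ℂ) ⊗[ℂ] (List I →₀ ℂ)) :
    (dropLetter i).rTensor _ (star s t) =
      star ((dropLetter i).rTensor _ s) ((weightOp F d (-Finsupp.single i 1)).rTensor _ t) +
      star (TensorProduct.map (weightOp F d (Finsupp.single i 1))
        (weightOp F d (Finsupp.single i 1 + Finsupp.single i 1)) s)
        ((dropLetter i).rTensor _ t) := by
  have : (star).compr₂ ((dropLetter i).rTensor _) =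
      (star).compl₁₂ ((dropLetter i).rTensor _)
        ((weightOp F d (-Finsupp.single i 1)).rTensor _) +
      (star).compl₁₂ (TensorProduct.map (weightOp F d (Finsupp.single i 1))
        (weightOp F d (Finsupp.single i 1 + Finsupp.single i 1))) ((dropLetter i).rTensor _) :=
    tensor_bilinear_ext fun a b c e => by
    change (dropLetter i).rTensor _ (star _ _) =
      star ((dropLetter i).rTensor _ _) ((weightOp F d (-Finsupp.single i 1)).rTensor _ _) +
      star (TensorProduct.map (weightOp F d (Finsupp.single i 1))
        (weightOp F d (Finsupp.single i 1 + Finsupp.single i 1)) _) ((dropLetter i).rTensor _ _)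
    rw [shuffle_twistedMul_word, LinearMap.map_smul, LinearMap.rTensor_tmul,
      LinearMap.rTensor_tmul, LinearMap.rTensor_tmul, LinearMap.rTensor_tmul,
      TensorProduct.map_tmul, dropLetter_mul, TensorProduct.add_tmul, smul_add]
    congr 1
    · refine dropLetter_word_cases (p := fun f =>
        vHalfPow F (2 * symForm d (wordDegree b) (wordDegree c)) •
          ((shuffle F d).mul f (weightOp F d (-Finsupp.single i 1) (word c)) ⊗ₜ
            (shuffle F d).mul (word b) (word e)) =
        star (f ⊗ₜ word b) (weightOp F d (-Finsupp.single i 1) (word c) ⊗ₜ word e)) ?_ i a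
        fun a' _ => ?_
      · simp only [LinearMap.map_zero₂, TensorProduct.zero_tmul, smul_zero]
      · rw [weightOp_word]
        simp only [← TensorProduct.smul_tmul', LinearMap.map_smul]
        rw [shuffle_twistedMul_word, smul_comm]
    · cases c with
      | nil => simp only [dropLetter_word_nil, map_zero, TensorProduct.zero_tmul, smul_zero]
      | cons j c =>
        rw [← consLetter_word j c]
        by_cases h : j = i
        · subst h
          rw [dropLetter_consLetter_self, weightOp_word, weightOp_word,
            TensorProduct.smul_tmul_smul, LinearMap.map_smul₂, LinearMap.map_smul₂,
            shuffle_twistedMul_word, ← TensorProduct.smul_tmul', smul_smul, smul_smul,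
            ← vHalfPow_add, ← vHalfPow_add, ← vHalfPow_add, wordDegree_cons,
            symForm_add_right, symForm_add_left, symForm_comm d (wordDegree b) (Finsupp.single j 1)]
          congr 2
          ring
        · simp only [dropLetter_consLetter_of_ne h, map_zero, TensorProduct.zero_tmul, smul_zero]
  exact LinearMap.congr_fun₂ this s t

/-- Weight operators respect the coproduct, so an operator on the left factor can be traded for one
applied before the coproduct and its inverse on the right factor. With `weightOp_map_comul` all
correction factors take the form 1 ⊗ K. -/
theorem weightOp_rTensor_comul (β : I →₀ ℤ) (f : List I →₀ ℂ) :
    (weightOp F d (-β)).rTensor _ ((shuffle F d).comul f) =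
      (weightOp F d β).lTensor _ ((shuffle F d).comul (weightOp F d (-β) f)) := by
  rw [shuffle_comul_weightOp, LinearMap.lTensor, ← LinearMap.comp_apply (TensorProduct.map LinearMap.id _),
    ← TensorProduct.map_comp, LinearMap.id_comp, show weightOp F d β ∘ₗ weightOp F d (-β) = LinearMap.id from
      LinearMap.ext fun g => by
        rw [LinearMap.comp_apply, weightOp_weightOp, add_neg_cancel, weightOp_zero]]
  rfl

theorem weightOp_map_comul (β : I →₀ ℤ) (f : List I →₀ ℂ) :
    TensorProduct.map (weightOp F d β) (weightOp F d (β + β)) ((shuffle F d).comul f) =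
      (weightOp F d β).lTensor _ ((shuffle F d).comul (weightOp F d β f)) := by
  rw [shuffle_comul_weightOp, LinearMap.lTensor, ← LinearMap.comp_apply (TensorProduct.map LinearMap.id _),
    ← TensorProduct.map_comp, LinearMap.id_comp, show weightOp F d β ∘ₗ weightOp F d β = weightOp F d (β + β) from
      LinearMap.ext fun g => weightOp_weightOp F d β β g]

/-- Induction on the total length, comparing the coefficient of the empty left word and all
deletions in the left factor: the two sides obey the same twisted Leibniz rule. -/
theorem shuffle_comul_mul_word (a b : List I) :
    (shuffle F d).comul ((shuffle F d).mul (word a) (word b)) =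
      star ((shuffle F d).comul (word a)) ((shuffle F d).comul (word b)) := by
  induction hn : a.length + b.length using Nat.strong_induction_on generalizing a b with
  | _ n ih =>
  subst hn
  refine tensor_ext_dropLetter ?_ fun i => ?_
  · rw [leftCoeff_nil_comul, leftCoeff_nil_twistedMul, leftCoeff_nil_comul, leftCoeff_nil_comul]
  · have h1 := dropLetter_word_cases (p := fun f => (shuffle F d).comul ((shuffle F d).mul f
      (word b)) = star ((shuffle F d).comul f) ((shuffle F d).comul (word b)))
      (by simp only [map_zero, LinearMap.zero_apply]) i a fun a' h => ih _ (by omega) a' b rfl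
    have h2 := dropLetter_word_cases (p := fun f => (shuffle F d).comul ((shuffle F d).mul
      (word a) f) = star ((shuffle F d).comul (word a)) ((shuffle F d).comul f))
      (by simp only [map_zero]) i b fun b' h => ih _ (by omega) a b' rfl
    -- All terms become images under 1 ⊗ K for the same weight operator K, which is multiplicative
    -- for the twisted product. The arguments of K are then products with one letter fewer.
    rw [dropLetter_comul, dropLetter_twistedMul, dropLetter_comul, dropLetter_comul,
      weightOp_rTensor_comul, weightOp_map_comul, ← weightOp_lTensor_twistedMul,
      ← weightOp_lTensor_twistedMul, ← map_add, dropLetter_mul, map_add]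
    simp only [weightOp_word, LinearMap.map_smul, LinearMap.smul_apply, h1, h2]

theorem shuffle_comul_mul (f g : List I →₀ ℂ) :
    (shuffle F d).comul ((shuffle F d).mul f g) =
      star ((shuffle F d).comul f) ((shuffle F d).comul g) := by
  have : (shuffle F d).mul.compr₂ (shuffle F d).comul =
      (star).compl₁₂ (shuffle F d).comul (shuffle F d).comul :=
    bilinear_ext fun a b => shuffle_comul_mul_word F d a b
  exact LinearMap.congr_fun₂ this f g

end TwistedMul

end ValuedQuiver

end

/-! ### Gradings and counits: both sides are twisted bialgebras. -/

section

namespace ValuedQuiver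

open GradedBialgebra

variable (F : Type u) [Field F] [Finite F] {I : Type w} [Quiver.{x + 1} I] (d : I → ℕ)

theorem shuffle_comul_counit : (TensorProduct.rid ℂ (List I →₀ ℂ)).toLinearMap ∘ₗ
    (shuffle F d).counit.lTensor (List I →₀ ℂ) ∘ₗ (shuffle F d).comul = LinearMap.id :=
  word_linearMap_ext fun a => by
    change TensorProduct.rid ℂ _ ((Finsupp.lapply []).lTensor _ ((shuffle F d).comul (word a))) =
      word a
    induction a with
    | nil => rw [shuffle_comul_nil, LinearMap.lTensor_tmul, TensorProduct.rid_tmul,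
        show Finsupp.lapply [] (word ([] : List I)) = (1 : ℂ) from Finsupp.single_eq_same, one_smul]
    | cons i a ih =>
      have h1 : (Finsupp.lapply [] : (List I →₀ ℂ) →ₗ[ℂ] ℂ) ∘ₗ
          weightOp F d (Finsupp.single i 1) = Finsupp.lapply [] := word_linearMap_ext fun b => by
        rw [LinearMap.comp_apply, weightOp_word, LinearMap.map_smul]
        cases b with
        | nil => rw [wordDegree_nil, symForm_zero_right, vHalfPow_zero, one_smul]
        | cons j b => rw [← consLetter_word, Finsupp.lapply_apply, consLetter_apply_nil, smul_zero]
      have h2 (t : (List I →₀ ℂ) ⊗[ℂ] (List I →₀ ℂ)) : TensorProduct.rid ℂ _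
          ((Finsupp.lapply []).lTensor _ (TensorProduct.map (consLetter i)
            (weightOp F d (Finsupp.single i 1)) t)) =
          consLetter i (TensorProduct.rid ℂ _ ((Finsupp.lapply []).lTensor _ t)) := by
        induction t using TensorProduct.induction_on with
        | zero => simp only [map_zero]
        | add s t hs ht => simp only [map_add, hs, ht]
        | tmul f g => rw [TensorProduct.map_tmul, LinearMap.lTensor_tmul, LinearMap.lTensor_tmul,
            TensorProduct.rid_tmul, TensorProduct.rid_tmul, LinearMap.map_smul,
            ← LinearMap.comp_apply (Finsupp.lapply []), h1]
      rw [shuffle_comul_cons, map_add, map_add, h2, ih, LinearMap.lTensor_tmul,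
        ← consLetter_word, Finsupp.lapply_apply, consLetter_apply_nil, TensorProduct.tmul_zero,
        map_zero, zero_add]

theorem shuffle_comul_mem (γ : I →₀ ℤ) : ∀ f ∈ (shuffle F d).component γ,
    (shuffle F d).comul f ∈ (shuffle F d).tensorComponent γ :=
  (shuffle F d).map_mem_of_basis _ fun b hb => by
    refine (shuffle_comul_word F d b).symm ▸ Submodule.sum_mem _ fun m _ =>
      Submodule.smul_mem _ _ (Submodule.subset_span ⟨b.take m, b.drop m, ?_, rfl⟩)
    rw [← hb]
    change -wordDegree (b.take m) + -wordDegree (b.drop m) = -wordDegree b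
    rw [← neg_add, ← wordDegree_append, List.take_append_drop]

theorem shuffle_mul_mem (β γ : I →₀ ℤ) : ∀ f ∈ (shuffle F d).component β,
    ∀ g ∈ (shuffle F d).component γ, (shuffle F d).mul f g ∈ (shuffle F d).component (β + γ) :=
  (shuffle F d).map₂_mem_of_basis _ fun b c hb hc => by
    have := shuffleRec_mem F d b c
    rw [← shuffle_mul_word, neg_add] at this
    rw [← hb, ← hc]
    exact this

/-- The degree of a word is a sum of simple roots. -/
theorem wordDegree_nonneg (a : List I) : 0 ≤ wordDegree a := by
  induction a with
  | nil => exact le_rfl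
  | cons i a ih =>
    rw [wordDegree_cons]
    exact add_nonneg (Finsupp.single_nonneg.2 zero_le_one) ih

theorem shuffle_counit_eq_zero (γ : I →₀ ℤ) (hγ : γ ≠ 0) :
    ∀ f ∈ (shuffle F d).component γ, (shuffle F d).counit f = 0 := fun f hf => by
  by_contra h
  have h1 : ([] : List I) ∈ f.support := Finsupp.mem_support_iff.2 h
  have h2 : -wordDegree [] = γ := hf h1
  exact hγ (by rw [← h2, wordDegree_nil, neg_zero])

theorem shuffle_isTwistedBialgebra [IsAdmissible I d] :
    (shuffle F d).IsTwistedBialgebra (twist F d) where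
  mul_assoc := shuffle_mul_assoc F d
  one_mul := shuffle_one_mul F d
  mul_one := shuffle_mul_one F d
  coassoc := shuffle_coassoc F d
  counit_comul := LinearMap.ext (leftCoeff_nil_comul F d)
  comul_counit := shuffle_comul_counit F d
  comul_mul := shuffle_comul_mul F d
  comul_one := shuffle_comul_nil F d
  counit_mul := shuffle_mul_apply_nil F d
  counit_one := Finsupp.single_eq_same
  mul_mem := shuffle_mul_mem F d
  one_mem := (shuffle F d).single_mem_component _ _ (by
    change -wordDegree ([] : List I) = 0
    rw [wordDegree_nil, neg_zero])
  comul_mem := shuffle_comul_mem F d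
  counit_eq_zero := shuffle_counit_eq_zero F d

theorem dualHall_isTwistedBialgebra [IsAdmissible I d] :
    (dualHall F d).IsTwistedBialgebra (twist F d) where
  mul_assoc := dualHall_mul_assoc
  one_mul := dualHall_one_mul
  mul_one := dualHall_mul_one
  coassoc := dualHall_coassoc
  counit_comul := dualHall_counit_comul
  comul_counit := dualHall_comul_counit
  comul_mul f g := dualHall_comul_mul f g
  comul_one := dualHall_comul_one
  counit_mul := dualHall_counit_mul
  counit_one := dualHall_counit_one
  mul_mem := dualHall_mul_mem
  one_mem := (dualHall F d).single_mem_component _ _ (by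
    rw [dualHall_deg, dimVec_zero, neg_zero])
  comul_mem := dualHall_comul_mem
  counit_eq_zero := dualHall_counit_eq_zero

end ValuedQuiver

end

/-! ### Counting flags by recursion on their type. -/

section

namespace ValuedQuiver

attribute [local instance 50] Fintype.ofFinite

variable {F : Type u} [Field F] [Finite F] {I : Type w} [Quiver.{x + 1} I] {d : I → ℕ}

namespace Rep

/-- The chains of subrepresentations from `Y` down to zero with subquotients given by a word. -/
def IsFlagFrom {V : Rep F d} (Y : V.Sub) (j : List I) (s : Fin (j.length + 1) → V.Sub) : Prop :=
  s 0 = Y ∧ s (Fin.last j.length) = Sub.bot V ∧ ∀ k : Fin j.length,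
    (∀ i, (s k.succ).carrier i ≤ (s k.castSucc).carrier i) ∧
      ((s k.succ).within (s k.castSucc)).quotient.cls = (simple F d (j.get k)).cls

/-- Flags as chains from the whole representation. -/
def Flag.equivChain (V : Rep F d) (j : List I) :
    V.Flag j ≃ {s : Fin (j.length + 1) → V.Sub // IsFlagFrom (Sub.top V) j s} where
  toFun f := ⟨f.step, f.step_zero, f.step_last, fun k =>
    ⟨f.anti k, cls_eq_iff.2 (f.subquotient k)⟩⟩
  invFun s := ⟨s.1, s.2.1, s.2.2.1, fun k => (s.2.2.2 k).1, fun k => cls_eq_iff.1 (s.2.2.2 k).2⟩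

theorem isFlagFrom_cons {V : Rep F d} (Y : V.Sub) (i : I) (j : List I)
    (s : Fin ((i :: j).length + 1) → V.Sub) : IsFlagFrom Y (i :: j) s ↔
      s 0 = Y ∧ ((∀ k, (s 1).carrier k ≤ Y.carrier k) ∧
        ((s 1).within Y).quotient.cls = (simple F d i).cls) ∧
      IsFlagFrom (s 1) j fun k => s k.succ := by
  constructor
  · rintro ⟨rfl, h2, h3⟩
    exact ⟨rfl, h3 0, rfl, h2, fun k => h3 k.succ⟩
  · rintro ⟨rfl, h2, -, h3, h4⟩
    exact ⟨rfl, h3, Fin.cases h2 h4⟩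

/-- A nonempty flag is given by its first step and a shorter flag. -/
def flagFromConsEquiv {V : Rep F d} (Y : V.Sub) (i : I) (j : List I) :
    {s : Fin ((i :: j).length + 1) → V.Sub // IsFlagFrom Y (i :: j) s} ≃
      Σ Z : {Z : V.Sub // (∀ k, Z.carrier k ≤ Y.carrier k) ∧
        (Z.within Y).quotient.cls = (simple F d i).cls},
        {s : Fin (j.length + 1) → V.Sub // IsFlagFrom Z.1 j s} where
  toFun s := ⟨⟨s.1 1, ((isFlagFrom_cons Y i j s.1).1 s.2).2.1⟩,
    ⟨fun k => s.1 k.succ, ((isFlagFrom_cons Y i j s.1).1 s.2).2.2⟩⟩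
  invFun p := ⟨Fin.cons Y p.2.1, (isFlagFrom_cons Y i j _).2
    ⟨rfl, by
      rw [show (Fin.cons Y p.2.1 : Fin ((i :: j).length + 1) → V.Sub) 1 = p.1.1 from p.2.2.1]
      exact ⟨p.1.2, p.2.2⟩⟩⟩
  left_inv s := Subtype.ext (funext fun k => by
    refine Fin.cases ?_ (fun k => ?_) k
    · exact ((isFlagFrom_cons Y i j s.1).1 s.2).1.symm
    · rfl)
  right_inv := by
    rintro ⟨⟨Z, hZ⟩, ⟨s, hs⟩⟩
    obtain rfl : s 0 = Z := hs.1
    rfl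

variable [IsAdmissible I d]

open Classical in
variable (F d) in
/-- The number of flags of a given type, by recursion on the word. -/
def flagCount : List I → IsoClass F d → ℕ
  | [], V => if V = (Rep.zero F d).cls then 1 else 0
  | i :: j, V => ∑ X : (Quotient.out V).Sub,
      if X.quotient.cls = (simple F d i).cls then flagCount j X.toRep.cls else 0

open Classical in
theorem flagCount_nil (V : IsoClass F d) :
    flagCount F d [] V = if V = (Rep.zero F d).cls then 1 else 0 := rfl

open Classical in
theorem flagCount_cons (i : I) (j : List I) (V : Rep F d) : flagCount F d (i :: j) V.cls =
    ∑ X : V.Sub, if X.quotient.cls = (simple F d i).cls then flagCount F d j X.toRep.cls else 0 := by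
  obtain ⟨e⟩ := cls_eq_iff.1 (cls_out V.cls)
  exact e.sum_sub fun a b => if a = (simple F d i).cls then flagCount F d j b else 0

/-- A flag from Y is a first step Z in Y with simple quotient followed by a flag from Z, and
subrepresentations of Y are those of V contained in Y; this is the recursion of `flagCount`. -/
theorem card_flagFrom {V : Rep F d} (j : List I) (Y : V.Sub) :
    Nat.card {s : Fin (j.length + 1) → V.Sub // IsFlagFrom Y j s} =
      flagCount F d j Y.toRep.cls := by
  classical
  induction j generalizing Y with
  | nil =>
    rw [flagCount_nil]
    simp only [Sub.cls_toRep_eq_zero_iff]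
    split_ifs with h
    · subst h
      refine Nat.card_eq_one_iff_exists.2 ⟨⟨fun _ => Sub.bot V, rfl, rfl, fun k => k.elim0⟩,
        fun s => Subtype.ext (funext fun k => ?_)⟩
      obtain rfl : k = 0 := Subsingleton.elim (α := Fin 1) k 0
      exact s.2.1
    · have : IsEmpty {s : Fin (([] : List I).length + 1) → V.Sub // IsFlagFrom Y [] s} :=
        ⟨fun s => h (s.2.1.symm.trans s.2.2.1)⟩
      exact Nat.card_of_isEmpty
  | cons i j ih =>
    rw [Nat.card_congr (flagFromConsEquiv Y i j), Nat.card_sigma, flagCount_cons,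
      Y.sum_toRep_sub fun a b => if a = (simple F d i).cls then flagCount F d j b else 0]
    simp only [ih]
    rw [sum_subtype_eq_sum_dite, sum_subtype_eq_sum_dite]
    refine Finset.sum_congr rfl fun Z _ => ?_
    by_cases h1 : ∀ k, Z.carrier k ≤ Y.carrier k
    · by_cases h2 : (Z.within Y).quotient.cls = (simple F d i).cls
      · rw [dif_pos ⟨h1, h2⟩, dif_pos h1, if_pos h2]
      · rw [dif_neg fun h => h2 h.2, dif_pos h1, if_neg h2]
    · rw [dif_neg fun h => h1 h.1, dif_neg h1]

theorem card_flag (V : Rep F d) (j : List I) : Nat.card (V.Flag j) = flagCount F d j V.cls := by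
  rw [Nat.card_congr (Flag.equivChain V j), card_flagFrom, cls_toRep_top]

theorem dimVec_simple (i : I) : (simple F d i).dimVec = Finsupp.single i 1 := by
  classical
  ext k
  have h : (simple F d i).dimVec k = (Module.finrank (extField F (d k))
      ((if k = i then ⊤ else ⊥ : Submodule (extField F (d k)) (extField F (d k))) :
        Type u) : ℤ) := rfl
  rw [h, Finsupp.single_apply]
  by_cases hk : k = i
  · rw [if_pos hk, if_pos hk.symm, finrank_top, Module.finrank_self, Nat.cast_one]
  · rw [if_neg hk, if_neg (Ne.symm hk), finrank_bot, Nat.cast_zero]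

/-- The type of a flag determines the dimension vector. -/
theorem wordDegree_of_flagCount_ne_zero (j : List I) (V : Rep F d)
    (h : flagCount F d j V.cls ≠ 0) : wordDegree j = V.dimVec := by
  classical
  induction j generalizing V with
  | nil =>
    rw [flagCount_nil] at h
    rw [wordDegree_nil, cls_eq_zero_iff.1 (by_contra fun h0 => h (if_neg h0))]
  | cons i j ih =>
    rw [flagCount_cons] at h
    obtain ⟨X, -, hX⟩ := Finset.exists_ne_zero_of_sum_ne_zero h
    have h1 : X.quotient.cls = (simple F d i).cls := by_contra fun h0 => hX (if_neg h0)
    rw [if_pos h1] at hX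
    rw [wordDegree_cons, ih _ hX, ← X.dimVec_add, ← dimVec_cls X.quotient, h1, dimVec_cls,
      dimVec_simple]

/-- Flags of the type of a concatenation of two words. -/
theorem flagCount_append (a b : List I) (V : Rep F d) : flagCount F d (a ++ b) V.cls =
    ∑ X : V.Sub, flagCount F d a X.quotient.cls * flagCount F d b X.toRep.cls := by
  classical
  induction a generalizing V with
  | nil =>
    rw [List.nil_append, Finset.sum_eq_single (Sub.top V), flagCount_nil,
      if_pos ((Sub.top V).cls_quotient_eq_zero_iff.2 rfl), one_mul, cls_toRep_top]
    · intro X _ hX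
      rw [flagCount_nil, if_neg fun h => hX (X.cls_quotient_eq_zero_iff.1 h), zero_mul]
    · exact fun h => (h (Finset.mem_univ _)).elim
  | cons i a ih =>
    -- The left side chooses the first step Y of the flag and then the cut X inside Y; the right
    -- side chooses X first and then the first step in V/X. Both are chains X ⊂ Y ⊂ V.
    have h := sum_chains V fun p q r =>
      if p = (simple F d i).cls then flagCount F d a q * flagCount F d b r else 0
    rw [List.cons_append, flagCount_cons]
    refine (Finset.sum_congr rfl fun Y _ => ?_).trans (h.symm.trans
      (Finset.sum_congr rfl fun X _ => ?_))
    · rw [ih]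
      split_ifs <;> simp
    · rw [flagCount_cons, Finset.sum_mul]
      exact Finset.sum_congr rfl fun Z _ => by rw [ite_mul, zero_mul]

end Rep

theorem degree_wordDegree (j : List I) : (wordDegree j).degree = j.length := by
  induction j with
  | nil => rw [wordDegree_nil, map_zero, List.length_nil, Nat.cast_zero]
  | cons i j ih =>
    rw [wordDegree_cons, map_add, ih, Finsupp.degree_single, List.length_cons, Nat.cast_succ,
      add_comm]

theorem mem_support_wordDegree {i : I} {j : List I} (h : i ∈ j) :
    i ∈ (wordDegree j).support := by
  rw [Finsupp.mem_support_iff]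
  obtain ⟨a, b, rfl⟩ := List.append_of_mem h
  rw [wordDegree_append, wordDegree_cons, Finsupp.add_apply, Finsupp.add_apply,
    Finsupp.single_eq_same]
  have h1 : 0 ≤ wordDegree a i := wordDegree_nonneg a i
  have h2 : 0 ≤ wordDegree b i := wordDegree_nonneg b i
  omega

/-- There are only finitely many words of a given degree. -/
theorem finite_wordDegree_eq (a : I →₀ ℤ) : {j : List I | wordDegree j = a}.Finite := by
  let s : Set I := a.support
  have : Finite s := Finset.finite_toSet a.support
  refine ((List.finite_length_eq s a.degree.toNat).image (List.map Subtype.val)).subset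
    fun j hj => ?_
  have hj' : wordDegree j = a := hj
  obtain ⟨l, rfl⟩ : j ∈ Set.range (List.map (Subtype.val : s → I)) := by
    rw [Set.range_list_map_coe]
    intro i hi
    have h := mem_support_wordDegree hi
    rw [hj'] at h
    exact h
  refine ⟨l, ?_, rfl⟩
  change l.length = _
  rw [← hj', degree_wordDegree, Int.toNat_natCast, List.length_map]

end ValuedQuiver

end

/-! ### Coefficients of the character and compatibility with the coproduct. -/

section

namespace ValuedQuiver

open GradedBialgebra ValuedQuiver.Rep

attribute [local instance 50] Fintype.ofFinite

variable (F : Type u) [Field F] [Finite F] {I : Type w} [Quiver.{x + 1} I] (d : I → ℕ)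

section Exponents

theorem euler_single_single (i j : I) :
    euler d (Finsupp.single i 1) (Finsupp.single j 1) = eulerSimple d i j := by
  change bilin (eulerSimple d) _ _ = _
  rw [bilin_single, one_mul, one_mul]

theorem wordEuler_cons (i : I) (j : List I) :
    wordEuler d (i :: j) = euler d (wordDegree j) (Finsupp.single i 1) + wordEuler d j := by
  have h1 : ∑ l : Fin j.length, eulerSimple d (j.get l) i =
      euler d (wordDegree j) (Finsupp.single i 1) := by
    induction j with
    | nil => rw [wordDegree_nil, euler_zero_left]; rfl
    | cons k j ih =>
      rw [wordDegree_cons, euler_add_left, ← ih, euler_single_single]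
      exact Fin.sum_univ_succ _
  have h2 : wordEuler d (i :: j) = ∑ k : Fin (j.length + 1), ∑ l : Fin (j.length + 1),
      if k < l then eulerSimple d ((i :: j).get l) ((i :: j).get k) else 0 := rfl
  rw [h2, Fin.sum_univ_succ, ← h1]
  congr 1
  · rw [Fin.sum_univ_succ, if_neg (lt_irrefl _), zero_add]
    exact Finset.sum_congr rfl fun l _ => if_pos (Fin.succ_pos l)
  · refine Finset.sum_congr rfl fun k _ => ?_
    rw [Fin.sum_univ_succ, if_neg (Fin.not_lt_zero _), zero_add]
    exact Finset.sum_congr rfl fun l _ => by simp only [Fin.succ_lt_succ_iff]; rfl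

/-- The exponent (of `v ^ (1 / 2)`) of the coefficient of a word in the character of a delta
function. -/
def characterExp (j : List I) : ℤ :=
  euler d (wordDegree j) (wordDegree j) - weight d (wordDegree j) - 2 * wordEuler d j

theorem weight_add (a b : I →₀ ℤ) : weight d (a + b) = weight d a + weight d b :=
  Finsupp.sum_add_index' (fun _ => mul_zero _) fun _ _ _ => mul_add _ _ _

theorem characterExp_nil : characterExp d ([] : List I) = 0 := by
  rw [characterExp, wordDegree_nil, euler_zero_left]
  rfl

/-- The diagonal term ⟨α_i, α_i⟩ = d_i is cancelled by the linear part of the rescaling, and the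
ordering sum removes twice one of the two mixed terms. Only the antisymmetrized Euler form survives.
-/
theorem characterExp_cons (i : I) (j : List I) : characterExp d (i :: j) =
    characterExp d j + euler d (Finsupp.single i 1) (wordDegree j) -
      euler d (wordDegree j) (Finsupp.single i 1) := by
  have h1 : weight d (Finsupp.single i 1) = d i := by
    rw [weight, Finsupp.sum_single_index (mul_zero _), mul_one]
  have h2 : eulerSimple d i i = d i := if_pos rfl
  rw [characterExp, characterExp, wordDegree_cons, wordEuler_cons, weight_add, euler_add_left,
    euler_add_right, euler_add_right, euler_single_single, h1, h2]
  ring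

theorem characterExp_append (a b : List I) : characterExp d (a ++ b) =
    characterExp d a + characterExp d b + euler d (wordDegree a) (wordDegree b) -
      euler d (wordDegree b) (wordDegree a) := by
  induction a with
  | nil =>
    rw [List.nil_append, characterExp_nil, wordDegree_nil, euler_zero_left, euler_zero_right]
    ring
  | cons i a ih =>
    rw [List.cons_append, characterExp_cons, ih, characterExp_cons, wordDegree_cons,
      wordDegree_append, euler_add_left, euler_add_right, euler_add_left, euler_add_right]
    ring

end Exponents

variable [IsAdmissible I d]

theorem finite_support_flagSeries (V : Rep F d) :
    (fun j : List I => vHalfPow F (-(2 * wordEuler d j)) *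
      (Nat.card (V.Flag j) : ℂ)).support.Finite :=
  (finite_wordDegree_eq V.dimVec).subset fun j hj => by
    refine wordDegree_of_flagCount_ne_zero j V fun h => hj ?_
    change _ * _ = (0 : ℂ)
    rw [card_flag, h, Nat.cast_zero, mul_zero]

theorem flagSeries_apply (V : Rep F d) (j : List I) :
    flagSeries V j = vHalfPow F (-(2 * wordEuler d j)) * (flagCount F d j V.cls : ℂ) := by
  rw [flagSeries, finsum_single_apply _ (finite_support_flagSeries F d V), card_flag]

theorem shuffleCharacter_delta (V : Rep F d) : shuffleCharacter F d (delta V) =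
    (rescale F d V.dimVec)⁻¹ • flagSeries V := by
  rw [shuffleCharacter, delta, Finsupp.linearCombination_single, one_smul, dimVec_cls]
  congr 1
  ext j
  rw [flagSeries_apply, flagSeries_apply, cls_out]

theorem shuffleCharacter_dualCls (V : Rep F d) :
    shuffleCharacter F d V.dualCls = flagSeries V := by
  have h : V.dualCls = rescale F d V.dimVec • delta V := by
    rw [dualCls, delta, Finsupp.smul_single, smul_eq_mul, mul_one]
  rw [h, LinearMap.map_smul, shuffleCharacter_delta]
  exact smul_inv_smul₀ (vHalfPow_ne_zero F _) _

theorem shuffleCharacter_delta_apply (V : Rep F d) (j : List I) :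
    shuffleCharacter F d (delta V) j =
      vHalfPow F (characterExp d j) * (flagCount F d j V.cls : ℂ) := by
  rw [shuffleCharacter_delta, Finsupp.smul_apply, smul_eq_mul, flagSeries_apply]
  -- The exponents involve |V| on one side and |j| on the other. They agree once a flag of type j
  -- exists; otherwise both sides vanish.
  by_cases h : flagCount F d j V.cls = 0
  · rw [h, Nat.cast_zero, mul_zero, mul_zero, mul_zero]
  · rw [rescale, ← vHalfPow_neg, ← mul_assoc, ← vHalfPow_add, characterExp,
      wordDegree_of_flagCount_ne_zero j V h]
    congr 2
    ring

theorem shuffleCharacter_delta_mem (V : Rep F d) :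
    shuffleCharacter F d (delta V) ∈ (shuffle F d).component (-V.dimVec) := by
  intro j hj
  have h : shuffleCharacter F d (delta V) j ≠ 0 := Finsupp.mem_support_iff.1 hj
  rw [shuffleCharacter_delta_apply] at h
  change -wordDegree j = -V.dimVec
  rw [wordDegree_of_flagCount_ne_zero j V fun h0 => h (by rw [h0, Nat.cast_zero, mul_zero])]

theorem shuffleCharacter_mem (γ : I →₀ ℤ) : ∀ f ∈ (dualHall F d).component γ,
    shuffleCharacter F d f ∈ (shuffle F d).component γ :=
  (dualHall F d).map_mem_of_basis _ fun b hb => by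
    rw [← cls_out b, dualHall_deg] at hb
    rw [← cls_out b, ← delta_eq_single, ← hb]
    exact shuffleCharacter_delta_mem F d _

theorem shuffleCharacter_counit :
    (shuffle F d).counit ∘ₗ shuffleCharacter F d = (dualHall F d).counit := by
  classical
  refine linearMap_ext_delta fun V => ?_
  rw [dualHall_counit_delta]
  change shuffleCharacter F d (delta V) [] = _
  rw [shuffleCharacter_delta_apply, characterExp_nil, vHalfPow_zero, one_mul, flagCount_nil]
  split_ifs <;> simp

theorem shuffleCharacter_one :
    shuffleCharacter F d (dualHall F d).one = (shuffle F d).one := by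
  rw [dualHall_one]
  ext j
  change _ = word [] j
  cases j with
  | nil =>
    rw [shuffleCharacter_delta_apply, characterExp_nil, vHalfPow_zero, one_mul, flagCount_nil,
      if_pos rfl, Nat.cast_one]
    exact Finsupp.single_eq_same.symm
  | cons i j =>
    rw [shuffleCharacter_delta_apply, show word ([] : List I) (i :: j) = 0 from
      Finsupp.single_eq_of_ne (by simp)]
    by_cases h : flagCount F d (i :: j) (Rep.zero F d).cls = 0
    · rw [h, Nat.cast_zero, mul_zero]
    · have h1 := degree_wordDegree (i :: j)
      rw [wordDegree_of_flagCount_ne_zero _ _ h, dimVec_zero, map_zero] at h1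
      simp only [List.length_cons] at h1
      omega

theorem leftCoeff_lTensor {M N : Type*} [AddCommGroup M] [Module ℂ M] [AddCommGroup N]
    [Module ℂ N] (φ : M →ₗ[ℂ] N) (a : List I) (t : (List I →₀ ℂ) ⊗[ℂ] M) :
    leftCoeff N a (φ.lTensor _ t) = φ (leftCoeff M a t) := by
  induction t using TensorProduct.induction_on with
  | zero => simp only [map_zero]
  | add s t hs ht => simp only [map_add, hs, ht]
  | tmul f g => rw [LinearMap.lTensor_tmul, leftCoeff_tmul, leftCoeff_tmul, LinearMap.map_smul]

/-- A pair of words arises from a single word and a single cut, so the coefficient is that of the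
concatenation. -/
theorem leftCoeff_comul (a b : List I) (f : List I →₀ ℂ) :
    leftCoeff _ a ((shuffle F d).comul f) b =
      vHalfPow F (symForm d (wordDegree a) (wordDegree b)) * f (a ++ b) := by
  have hw (β : I →₀ ℤ) (g : List I →₀ ℂ) :
      weightOp F d β g b = vHalfPow F (symForm d β (wordDegree b)) * g b := by
    induction g using Finsupp.induction_linear with
    | zero => rw [map_zero, Finsupp.zero_apply, mul_zero]
    | add g g' hg hg' => rw [map_add, Finsupp.add_apply, Finsupp.add_apply, hg, hg', mul_add]
    | single c r =>
      have h2 : Finsupp.single c r = r • word c := by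
        rw [word, Finsupp.smul_single, smul_eq_mul, mul_one]
      rw [h2, LinearMap.map_smul, weightOp_word, Finsupp.smul_apply, Finsupp.smul_apply,
        Finsupp.smul_apply, smul_eq_mul, smul_eq_mul, smul_eq_mul]
      by_cases h : c = b
      · rw [h]; ring
      · rw [show word c b = 0 from Finsupp.single_eq_of_ne (Ne.symm h)]; ring
  induction a generalizing f with
  | nil => rw [leftCoeff_nil_comul, wordDegree_nil, symForm_zero_left, vHalfPow_zero, one_mul,
      List.nil_append]
  | cons i a ih =>
    rw [leftCoeff_cons, dropLetter_comul, leftCoeff_lTensor, hw, ih, dropLetter_apply, ← mul_assoc,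
      ← vHalfPow_add, wordDegree_cons, symForm_add_left, List.cons_append]

/-- In the coefficient of a ⊗ b, flags of type ab split along a subrepresentation X. For the
exponents, the symmetric form plus the antisymmetrized Euler form is twice the Euler form, which is
the Hall coefficient in half powers of v. -/
theorem shuffleCharacter_comul : (shuffle F d).comul ∘ₗ shuffleCharacter F d =
    TensorProduct.map (shuffleCharacter F d) (shuffleCharacter F d) ∘ₗ (dualHall F d).comul := by
  refine linearMap_ext_delta fun V => tensor_ext_leftCoeff fun a => Finsupp.ext fun b => ?_
  rw [LinearMap.comp_apply, LinearMap.comp_apply, leftCoeff_comul, dualHall_comul_delta, map_sum,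
    map_sum, Finsupp.finsetSum_apply, shuffleCharacter_delta_apply, flagCount_append, Nat.cast_sum,
    Finset.mul_sum, Finset.mul_sum]
  refine Finset.sum_congr rfl fun X _ => ?_
  rw [LinearMap.map_smul, LinearMap.map_smul, TensorProduct.map_tmul, leftCoeff_tmul,
    Finsupp.smul_apply, Finsupp.smul_apply, shuffleCharacter_delta_apply,
    shuffleCharacter_delta_apply, smul_eq_mul, smul_eq_mul, Nat.cast_mul]
  -- When both counts are nonzero, the dimension vectors of V/X and X are the degrees of a and b,
  -- which makes the exponents comparable.
  by_cases ha : flagCount F d a X.quotient.cls = 0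
  · rw [ha]; simp
  by_cases hb : flagCount F d b X.toRep.cls = 0
  · rw [hb]; simp
  rw [← wordDegree_of_flagCount_ne_zero _ _ ha, ← wordDegree_of_flagCount_ne_zero _ _ hb,
    ← mul_assoc, ← vHalfPow_add]
  have h : symForm d (wordDegree a) (wordDegree b) + characterExp d (a ++ b) =
      2 * euler d (wordDegree a) (wordDegree b) + characterExp d a + characterExp d b := by
    rw [symForm_eq, characterExp_append]
    ring
  rw [h, vHalfPow_add, vHalfPow_add]
  ring

end ValuedQuiver

end

/-! ### Multiplicativity of the character. -/

section

namespace GradedBialgebra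

/-- The twisted product of tensors of homogeneous elements. -/
theorem StructureMaps.twistedMul_tmul_of_mem {R : Type*} [CommRing R] {Γ : Type*} {B : Type*}
    (S : StructureMaps R Γ B) (χ : Γ → Γ → R) {β γ : Γ} (f g f' g' : B →₀ R)
    (hg : g ∈ S.component β) (hf' : f' ∈ S.component γ) :
    S.twistedMul χ (f ⊗ₜ[R] g) (f' ⊗ₜ[R] g') = χ β γ • (S.mul f f' ⊗ₜ[R] S.mul g g') := by
  rw [S.component_eq_span] at hg hf'
  induction hg using Submodule.span_induction with
  | zero => simp only [TensorProduct.tmul_zero, map_zero, LinearMap.zero_apply, smul_zero]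
  | add g₁ g₂ _ _ h₁ h₂ => simp only [TensorProduct.tmul_add, map_add, LinearMap.add_apply, h₁, h₂,
      smul_add]
  | smul r g _ h => simp only [TensorProduct.tmul_smul, LinearMap.map_smul, LinearMap.smul_apply, h,
      smul_comm r]
  | mem g hg =>
  obtain ⟨b, hb, rfl⟩ := hg
  induction hf' using Submodule.span_induction with
  | zero => simp only [TensorProduct.zero_tmul, map_zero, smul_zero]
  | add g₁ g₂ _ _ h₁ h₂ => simp only [TensorProduct.add_tmul, map_add, h₁, h₂, smul_add]
  | smul r g _ h => simp only [← TensorProduct.smul_tmul', LinearMap.map_smul, h, smul_comm r]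
  | mem f' hf' =>
  obtain ⟨c, hc, rfl⟩ := hf'
  induction f using Finsupp.induction_linear with
  | zero => simp only [TensorProduct.zero_tmul, map_zero, LinearMap.zero_apply, smul_zero]
  | add g₁ g₂ h₁ h₂ => simp only [TensorProduct.add_tmul, map_add, LinearMap.add_apply, h₁, h₂,
      smul_add]
  | single a r =>
  induction g' using Finsupp.induction_linear with
  | zero => simp only [TensorProduct.tmul_zero, map_zero, smul_zero]
  | add g₁ g₂ h₁ h₂ => simp only [TensorProduct.tmul_add, map_add, h₁, h₂, smul_add]
  | single e s =>
  have hs (a : B) (r : R) : Finsupp.single a r = r • Finsupp.single a 1 := by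
    rw [Finsupp.smul_single, smul_eq_mul, mul_one]
  have hb' : S.deg b = β := hb
  have hc' : S.deg c = γ := hc
  rw [hs a r, hs e s]
  simp only [← TensorProduct.smul_tmul', TensorProduct.tmul_smul, LinearMap.map_smul,
    LinearMap.smul_apply, S.twistedMul_tmul, hb', hc']
  module

end GradedBialgebra

namespace ValuedQuiver

open GradedBialgebra ValuedQuiver.Rep

attribute [local instance 50] Fintype.ofFinite

variable (F : Type u) [Field F] [Finite F] {I : Type w} [Quiver.{x + 1} I] (d : I → ℕ)
  [IsAdmissible I d]

theorem delta_mem (V : Rep F d) : delta V ∈ (dualHall F d).component (-V.dimVec) :=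
  (dualHall F d).single_mem_component _ _ (dualHall_deg V)

theorem degree_dimVec_nonneg (V : Rep F d) : 0 ≤ V.dimVec.degree :=
  Finset.sum_nonneg fun i _ => V.dimVec_nonneg i

theorem dimVec_eq_zero_of_degree {V : Rep F d} (h : V.dimVec.degree = 0) : V.dimVec = 0 := by
  by_contra h0
  obtain ⟨i, hi⟩ := Finsupp.support_nonempty_iff.2 h0
  have h1 := (Finset.sum_eq_zero_iff_of_nonneg fun i _ => V.dimVec_nonneg i).1 h i hi
  exact Finsupp.mem_support_iff.1 hi h1

/-- The character is multiplicative in the coefficients of one-letter words. -/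
theorem shuffleCharacter_mul_apply_letter (U W : Rep F d) (i : I) :
    shuffleCharacter F d ((dualHall F d).mul (delta U) (delta W)) [i] =
      (shuffle F d).mul (shuffleCharacter F d (delta U)) (shuffleCharacter F d (delta W)) [i] := by
  by_cases hU : U.dimVec = 0
  · rw [delta, cls_eq_zero_of_dimVec hU, ← delta, ← dualHall_one, dualHall_one_mul,
      shuffleCharacter_one]
    exact (DFunLike.congr_fun (shuffle_one_mul F d _) _).symm
  by_cases hW : W.dimVec = 0
  · rw [delta, delta, cls_eq_zero_of_dimVec hW, ← delta, ← delta, ← dualHall_one, dualHall_mul_one,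
      shuffleCharacter_one]
    exact (DFunLike.congr_fun (shuffle_mul_one F d _) _).symm
  -- If U and W are both nonzero, their product has total degree at least two, so no one-letter word
  -- occurs on either side.
  have hne : -wordDegree [i] ≠ -U.dimVec + -W.dimVec := fun h => by
    rw [← neg_add, neg_inj] at h
    have h1 := degree_wordDegree [i]
    rw [h, map_add] at h1
    have h2 := degree_dimVec_nonneg F d U
    have h3 := degree_dimVec_nonneg F d W
    have h4 : U.dimVec.degree ≠ 0 := fun h => hU (dimVec_eq_zero_of_degree F d h)
    have h5 : W.dimVec.degree ≠ 0 := fun h => hW (dimVec_eq_zero_of_degree F d h)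
    simp only [List.length_cons, List.length_nil] at h1
    omega
  have hzero : ∀ f ∈ (shuffle F d).component (-U.dimVec + -W.dimVec), f [i] = 0 := fun f hf => by
    by_contra h
    exact hne (hf (Finsupp.mem_support_iff.2 h))
  rw [hzero _ (shuffleCharacter_mem F d _ _ (dualHall_mul_mem _ _ _ (delta_mem F d U) _
      (delta_mem F d W))),
    hzero _ (shuffle_mul_mem F d _ _ _ (shuffleCharacter_delta_mem F d U) _
      (shuffleCharacter_delta_mem F d W))]

/-- The weight operators are invertible, so the coproduct determines all deletions and hence the
element up to its constant term. -/
theorem leftCoeff_letter_comul (i : I) (f : List I →₀ ℂ) :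
    leftCoeff _ [i] ((shuffle F d).comul f) =
      weightOp F d (Finsupp.single i 1) (dropLetter i f) := by
  rw [leftCoeff_cons, dropLetter_comul, leftCoeff_lTensor, leftCoeff_nil_comul]

theorem weightOp_injective (β : I →₀ ℤ) : Function.Injective (weightOp F d β) :=
  Function.LeftInverse.injective (g := weightOp F d (-β)) fun f => by
    rw [weightOp_weightOp, neg_add_cancel, weightOp_zero, LinearMap.id_apply]

/-- Induction on the total dimension. The character respects coproducts and both algebras satisfy
the same twisted compatibility, so the coproducts of the two sides are expanded over the same pairs
of subrepresentations of U and W and compared where the left factor is a single letter. -/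
theorem shuffleCharacter_mul_delta (U W : Rep F d) :
    shuffleCharacter F d ((dualHall F d).mul (delta U) (delta W)) =
      (shuffle F d).mul (shuffleCharacter F d (delta U)) (shuffleCharacter F d (delta W)) := by
  induction hn : (U.dimVec.degree + W.dimVec.degree).toNat using Nat.strong_induction_on
    generalizing U W with
  | _ n ih =>
  subst hn
  have hcounit (f : IsoClass F d →₀ ℂ) :
      shuffleCharacter F d f [] = (dualHall F d).counit f :=
    LinearMap.congr_fun (shuffleCharacter_counit F d) f
  have hcomul (f : IsoClass F d →₀ ℂ) : (shuffle F d).comul (shuffleCharacter F d f) =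
      TensorProduct.map (shuffleCharacter F d) (shuffleCharacter F d) ((dualHall F d).comul f) :=
    LinearMap.congr_fun (shuffleCharacter_comul F d) f
  refine ext_dropLetter ?_ fun i => weightOp_injective F d (Finsupp.single i 1) ?_
  · rw [shuffle_mul_apply_nil, hcounit, hcounit, hcounit, dualHall_counit_mul]
  rw [← leftCoeff_letter_comul, ← leftCoeff_letter_comul, shuffle_comul_mul, hcomul,
    hcomul, hcomul, dualHall_comul_mul, dualHall_comul_delta, dualHall_comul_delta]
  simp only [map_sum, LinearMap.sum_apply, LinearMap.map_smul, LinearMap.smul_apply,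
    TensorProduct.map_tmul]
  refine Finset.sum_congr rfl fun Y _ => Finset.sum_congr rfl fun X _ => ?_
  rw [(dualHall F d).twistedMul_tmul_of_mem _ _ _ _ _ (delta_mem F d _) (delta_mem F d _),
    (shuffle F d).twistedMul_tmul_of_mem _ _ _ _ _ (shuffleCharacter_delta_mem F d _)
      (shuffleCharacter_delta_mem F d _), LinearMap.map_smul, LinearMap.map_smul,
    LinearMap.map_smul, TensorProduct.map_tmul, leftCoeff_tmul, leftCoeff_tmul,
    shuffleCharacter_mul_apply_letter]
  -- A nonzero left coefficient forces the two quotients to have total dimension one. The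
  -- subrepresentations X and Y then have total dimension one less than U and W, and the induction
  -- hypothesis applies to the right factors.
  by_cases h0 : (shuffle F d).mul (shuffleCharacter F d (delta X.quotient))
      (shuffleCharacter F d (delta Y.quotient)) [i] = 0
  · rw [h0, zero_smul, zero_smul]
  have hdeg : -wordDegree [i] = -X.quotient.dimVec + -Y.quotient.dimVec :=
    shuffle_mul_mem F d _ _ _ (shuffleCharacter_delta_mem F d X.quotient) _
      (shuffleCharacter_delta_mem F d Y.quotient) (Finsupp.mem_support_iff.2 h0)
  have h1 := degree_wordDegree [i]
  rw [← neg_add, neg_inj] at hdeg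
  rw [hdeg, map_add] at h1
  have h2 := congrArg Finsupp.degree X.dimVec_add
  have h3 := congrArg Finsupp.degree Y.dimVec_add
  rw [map_add] at h2 h3
  have h4 := degree_dimVec_nonneg F d X.toRep
  have h5 := degree_dimVec_nonneg F d Y.toRep
  simp only [List.length_cons, List.length_nil] at h1
  rw [ih _ (by omega) X.toRep Y.toRep rfl]

theorem shuffleCharacter_mul (f g : IsoClass F d →₀ ℂ) :
    shuffleCharacter F d ((dualHall F d).mul f g) =
      (shuffle F d).mul (shuffleCharacter F d f) (shuffleCharacter F d g) := by
  have : (dualHall F d).mul.compr₂ (shuffleCharacter F d) =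
      (shuffle F d).mul.compl₁₂ (shuffleCharacter F d) (shuffleCharacter F d) :=
    linearMap_ext_delta fun U => linearMap_ext_delta fun W => shuffleCharacter_mul_delta F d U W
  exact LinearMap.congr_fun₂ this f g

end ValuedQuiver

end

end

/-- The quantum shuffle character is a homomorphism of twisted bialgebras from the dual Hall--Ringel
bialgebra of an acyclic valued quiver to the quantum shuffle algebra. -/
theorem mainTheorem1 {F : Type u} [Field F] [Finite F] {I : Type w} [Quiver.{x + 1} I]
    (hfin : ∀ i : I, Finite (Quiver.Star i) ∧ Finite (Quiver.Costar i))
    (hacyc : ValuedQuiver.IsAcyclic I) (d : I → ℕ) (hd : ∀ i, 0 < d i) :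
    (∀ V : ValuedQuiver.Rep F d,
      ValuedQuiver.shuffleCharacter F d V.dualCls = ValuedQuiver.flagSeries V) ∧
    GradedBialgebra.IsTwistedBialgebraHom (ValuedQuiver.twist F d)
      (ValuedQuiver.dualHall F d) (ValuedQuiver.shuffle F d)
      (ValuedQuiver.shuffleCharacter F d) := by
  have : ValuedQuiver.IsAdmissible I d := ⟨hfin, hacyc, hd⟩
  exact ⟨ValuedQuiver.shuffleCharacter_dualCls F d,
    { source := ValuedQuiver.dualHall_isTwistedBialgebra F d
      target := ValuedQuiver.shuffle_isTwistedBialgebra F d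
      map_mul := ValuedQuiver.shuffleCharacter_mul F d
      map_one := ValuedQuiver.shuffleCharacter_one F d
      map_comul := ValuedQuiver.shuffleCharacter_comul F d
      map_counit := ValuedQuiver.shuffleCharacter_counit F d
      map_component := ValuedQuiver.shuffleCharacter_mem F d }⟩
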